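/- **Setting.** Let $\omega$ be an open polygon (the interior of a simple closed polygonal line) in the half-plane $\{(r,z): r>0\}$ whose closure meets the axis $r=0$ exactly in one side $\gamma_a$, and let $\gamma_b$ be the union of the other sides, with unit outward normal $\nu$. All functions are complex valued. For $\tau\in\mathbb R$ let $L^2_\tau(\omega)$ be the space of measurable $w$ with $\|w\|_{0,\tau}^2=\iint_\omega |w|^2\,r^\tau\,dr\,dz<\infty$, and let $H^1_\tau(\omega)$ be the space of $w\in L^2_\tau(\omega)$ whose weak derivatives $\partial_r w,\partial_z w$ are in $L^2_\tau(\omega)$; we write $\nabla=(\partial_r,\partial_z)$, $\|\nabla w\|_{0,\tau}^2=\|\partial_r w\|_{0,\tau}^2+\|\partial_z w\|_{0,\tau}^2$ and $\Delta_0=\partial_r^2+\frac1r\partial_r+\partial_z^2$ (in the sense of distributions in $\omega$). **Boundary values.** There is exactly one continuous linear map $T:H^1_1(\omega)\to L^2(\gamma_b,r\,d\gamma)$ (the trace on $\gamma_b$) with $Tu=u|_{\gamma_b}$ for all $u\in H^1_1(\omega)$ that are smooth up to the boundary (restrictions to $\omega$ of functions in $C^\infty(\mathbb R^2)$). Let $H$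 be the space of fields $p=(p_r,p_z)\in L^2_1(\omega)^2$ with $\partial_r p_r+\frac1r p_r+\partial_z p_z\in L^2_1(\omega)$, with the graph norm. There is exactly one continuous linear map from $H$ to the dual of the trace space $T(H^1_1(\omega))\cong H^1_1(\omega)/\ker T$, written $p\mapsto p\cdot\nu$, such that $\langle p\cdot\nu,Tu\rangle=\int_{\gamma_b}(Tu)\,(p\cdot\nu)\,r\,d\gamma$ for all $u\in H^1_1(\omega)$ and all $p\in H$ that are smooth up to the boundary. If $v\in H^1_1(\omega)$ and $\Delta_0v\in L^2_1(\omega)$, then $\nabla v\in H$; put $\frac{\partial v}{\partial\nu}=\nabla v\cdot\nu$, and write $\int_{\gamma_b}u\,\frac{\partial v}{\partial\nu}\,r\,d\gamma$ for $\langle\frac{\partial v}{\partial\nu},Tu\rangle$. **Theorem.** The two maps above exist and are unique, and the following hold. 1. For all $u,v\in H^1_1(\omega)$ such that $\Delta_0 v\in L^2_1(\omega)$, the integrand on the left is integrable with respect to $r\,dr\,dz$ and $$\iint_\omega\{u\,\Delta_0 v+\nabla u\cdot\nabla v\}\,r\,dr\,dz=\int_{\gamma_b}u\,\frac{\partial v}{\partial\nu}\,r\,d\gamma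 .$$ 2. For all $w\in H^1_{-1}(\omega)$ that vanish on $\gamma_b$ (that is, $Tw=0$; note that $H^1_{-1}(\omega)\subset H^1_1(\omega)$) and satisfy $\Delta_0 w\in L^2_1(\omega)$, one has $w\in L^2_{-3}(\omega)$, the function $\frac{\overline w}{r^2}\,\Delta_0 w$ is integrable with respect to $r\,dr\,dz$, and $$\Re\iint_\omega-\Big\{\frac{\overline w}{r^2}\,\Delta_0 w\Big\}\,r\,dr\,dz=\|\nabla w\|_{0,-1}^2-2\,\|w\|_{0,-3}^2 .$$ -/

import Mathlib

open MeasureTheory Filter Set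
open scoped Topology ENNReal

noncomputable section

namespace Meridian

/-! Points of the meridian half-plane are pairs `x = (r, z)`, so `r = x.1` and `z = x.2`. -/

/-- Rotation of a plane vector by a quarter turn to the left. -/
def rotLeft (d : ℝ × ℝ) : ℝ × ℝ := (-d.2, d.1)

/-- Euclidean length (the norm of `ℝ × ℝ` in the library is the sup norm). -/
def euclLength (d : ℝ × ℝ) : ℝ := Real.sqrt (d.1 ^ 2 + d.2 ^ 2)

/-- A polygon `ω` in the half-plane `r > 0`, bounded by a simple closed polygonal line with
vertices `P 0, P 1, …, P (m + 2)` (indices are cyclic), listed counterclockwise: each side has `ω`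
on its left, and only there.  The side `[P 0, P 1]` is `γ_a`, the part of the boundary on the axis
`r = 0`; the other sides form `γ_b`. -/
structure Polygon where
  m : ℕ
  P : Fin (m + 3) → ℝ × ℝ
  ω : Set (ℝ × ℝ)
  injective_P : Function.Injective P
  simple : ∀ i j, i ≠ j →
    segment ℝ (P i) (P (i + 1)) ∩ segment ℝ (P j) (P (j + 1)) ⊆
      {P i, P (i + 1)} ∩ {P j, P (j + 1)}
  isOpen : IsOpen ω
  isConnected : IsConnected ω
  isBounded : Bornology.IsBounded ω
  frontier_eq : frontier ω = ⋃ i, segment ℝ (P i) (P (i + 1))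
  left_side : ∀ i, ∀ x ∈ openSegment ℝ (P i) (P (i + 1)), ∀ᶠ ε in 𝓝[>] (0 : ℝ),
    x + ε • rotLeft (P (i + 1) - P i) ∈ ω ∧ x - ε • rotLeft (P (i + 1) - P i) ∉ ω
  pos : ∀ x ∈ ω, 0 < x.1
  axis_zero : (P 0).1 = 0
  axis_one : (P 1).1 = 0
  off_axis : ∀ i, i ≠ 0 → i ≠ 1 → 0 < (P i).1

/-- The measure `r ^ τ dr dz` on `ω`. -/
def wt (ω : Set (ℝ × ℝ)) (τ : ℝ) : Measure (ℝ × ℝ) :=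
  (volume.restrict ω).withDensity fun x => ENNReal.ofReal (x.1 ^ τ)

/-- Test functions on `ω`: smooth, with compact support contained in `ω`. -/
structure IsTest (ω : Set (ℝ × ℝ)) (φ : ℝ × ℝ → ℂ) : Prop where
  smooth : ContDiff ℝ (⊤ : ℕ∞) φ
  compact : HasCompactSupport φ
  supp : tsupport φ ⊆ ω

/-- `g` is the weak (distributional) derivative of `u` in `ω` in the direction `e`. -/
def IsWeakDeriv (ω : Set (ℝ × ℝ)) (e : ℝ × ℝ) (u g : ℝ × ℝ → ℂ) : Prop :=
  ∀ φ, IsTest ω φ → ∫ x in ω, u x * fderiv ℝ φ x e = -∫ x in ω, g x * φ x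

/-- `d = ∂_r a + a / r + ∂_z b` in the sense of distributions in `ω`; this is the axisymmetric
divergence of the field `(a, b)`. -/
def IsWeakDiv (ω : Set (ℝ × ℝ)) (a b d : ℝ × ℝ → ℂ) : Prop :=
  ∀ φ, IsTest ω φ →
    ∫ x in ω, (a x * fderiv ℝ φ x (1, 0) + b x * fderiv ℝ φ x (0, 1) - a x / (x.1 : ℂ) * φ x) =
      -∫ x in ω, d x * φ x

theorem isFiniteMeasure_wt_one (D : Polygon) : IsFiniteMeasure (wt D.ω 1) := by
  obtain ⟨R, hR⟩ := D.isBounded.exists_norm_le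
  refine isFiniteMeasure_withDensity (ne_of_lt ?_)
  calc ∫⁻ x in D.ω, ENNReal.ofReal (x.1 ^ (1 : ℝ))
      ≤ ∫⁻ _ in D.ω, ENNReal.ofReal R := by
        refine setLIntegral_mono' D.isOpen.measurableSet fun x hx => ?_
        rw [Real.rpow_one]
        exact ENNReal.ofReal_le_ofReal
          (((le_abs_self _).trans (norm_fst_le x)).trans (hR x hx))
    _ < ⊤ := by
        rw [setLIntegral_const]
        exact ENNReal.mul_lt_top ENNReal.ofReal_lt_top D.isBounded.measure_lt_top

theorem continuous_div_r (D : Polygon) {ψ : ℝ × ℝ → ℂ} (hψ : Continuous ψ)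
    (hs : tsupport ψ ⊆ D.ω) : Continuous fun x => ψ x / (x.1 : ℂ) := by
  rw [continuous_iff_continuousAt]
  intro x
  by_cases hx : x ∈ tsupport ψ
  · refine ContinuousAt.div hψ.continuousAt (by fun_prop) ?_
    exact_mod_cast (D.pos x (hs hx)).ne'
  · have h0 : (fun x => ψ x / (x.1 : ℂ)) =ᶠ[𝓝 x] fun _ => 0 := by
      filter_upwards [notMem_tsupport_iff_eventuallyEq.mp hx] with y hy
      simp [hy]
    exact continuousAt_const.congr h0.symm

theorem integrableOn_mul_test (D : Polygon) {f ψ : ℝ × ℝ → ℂ} (hf : MemLp f 2 (wt D.ω 1))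
    (hψ : Continuous ψ) (hc : HasCompactSupport ψ) (hs : tsupport ψ ⊆ D.ω) :
    IntegrableOn (fun x => f x * ψ x) D.ω := by
  have hfin := isFiniteMeasure_wt_one D
  have hcont := continuous_div_r D hψ hs
  have hcs : HasCompactSupport fun x => ψ x / (x.1 : ℂ) := by
    refine hc.mono fun x hx => ?_
    simp only [Function.mem_support, ne_eq, div_eq_zero_iff, not_or] at hx ⊢
    exact hx.1
  obtain ⟨C, hC⟩ := hcs.exists_bound_of_continuous hcont
  have h2 : MemLp (fun x => ψ x / (x.1 : ℂ)) 2 (wt D.ω 1) :=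
    MemLp.of_bound hcont.aestronglyMeasurable C (Eventually.of_forall hC)
  have h3 : Integrable (fun x => f x * (ψ x / (x.1 : ℂ))) (wt D.ω 1) := hf.integrable_mul h2
  rw [wt, integrable_withDensity_iff_integrable_smul' (by fun_prop)
    (Eventually.of_forall fun _ => ENNReal.ofReal_lt_top)] at h3
  refine h3.congr ?_
  filter_upwards [ae_restrict_mem D.isOpen.measurableSet] with x hx
  have hp := D.pos x hx
  have hp' : (x.1 : ℂ) ≠ 0 := by exact_mod_cast hp.ne'
  rw [Real.rpow_one, ENNReal.toReal_ofReal hp.le, Complex.real_smul]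
  field_simp

theorem IsTest.integrableOn_mul {D : Polygon} {φ : ℝ × ℝ → ℂ} (hφ : IsTest D.ω φ)
    (f : Lp ℂ 2 (wt D.ω 1)) : IntegrableOn (fun x => f x * φ x) D.ω :=
  integrableOn_mul_test D (Lp.memLp f) hφ.smooth.continuous hφ.compact hφ.supp

theorem IsTest.integrableOn_mul_fderiv {D : Polygon} {φ : ℝ × ℝ → ℂ} (hφ : IsTest D.ω φ)
    (f : Lp ℂ 2 (wt D.ω 1)) (e : ℝ × ℝ) :
    IntegrableOn (fun x => f x * fderiv ℝ φ x e) D.ω := by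
  have hsub : (tsupport fun x => fderiv ℝ φ x e) ⊆ tsupport φ := tsupport_fderiv_apply_subset ℝ e
  exact integrableOn_mul_test D (Lp.memLp f)
    ((hφ.smooth.continuous_fderiv (by simp)).clm_apply continuous_const)
    (hφ.compact.of_isClosed_subset (isClosed_tsupport _) hsub) (hsub.trans hφ.supp)

theorem IsTest.integrableOn_div_mul {D : Polygon} {φ : ℝ × ℝ → ℂ} (hφ : IsTest D.ω φ)
    (f : Lp ℂ 2 (wt D.ω 1)) : IntegrableOn (fun x => f x / (x.1 : ℂ) * φ x) D.ω := by
  have hsub : (tsupport fun x : ℝ × ℝ => φ x / (x.1 : ℂ)) ⊆ tsupport φ := by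
    refine closure_mono fun x hx => ?_
    simp only [Function.mem_support, ne_eq, div_eq_zero_iff, not_or] at hx ⊢
    exact hx.1
  have h := integrableOn_mul_test D (Lp.memLp f)
    (continuous_div_r D hφ.smooth.continuous hφ.supp)
    (hφ.compact.of_isClosed_subset (isClosed_tsupport _) hsub) (hsub.trans hφ.supp)
  refine h.congr_fun (fun x _ => ?_) D.isOpen.measurableSet
  ring

/-- On `ω`, the measures `wt D.ω 1` and Lebesgue measure have the same null sets. -/
theorem ae_restrict_of_ae_wt (D : Polygon) {p : ℝ × ℝ → Prop} (h : ∀ᵐ x ∂(wt D.ω 1), p x) :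
    ∀ᵐ x ∂(volume.restrict D.ω), p x := by
  rw [wt, ae_withDensity_iff (by fun_prop)] at h
  filter_upwards [h, ae_restrict_mem D.isOpen.measurableSet] with x hx hm
  refine hx ?_
  rw [Real.rpow_one]
  exact (ENNReal.ofReal_pos.mpr (D.pos x hm)).ne'

theorem IsWeakDeriv.congr {D : Polygon} {e : ℝ × ℝ} {u u' g g' : ℝ × ℝ → ℂ}
    (h : IsWeakDeriv D.ω e u g) (hu : u' =ᵐ[wt D.ω 1] u) (hg : g' =ᵐ[wt D.ω 1] g) :
    IsWeakDeriv D.ω e u' g' := by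
  intro φ hφ
  have h1 : ∫ x in D.ω, u' x * fderiv ℝ φ x e = ∫ x in D.ω, u x * fderiv ℝ φ x e :=
    integral_congr_ae ((ae_restrict_of_ae_wt D hu).mono fun x hx => by simp only [hx])
  have h2 : ∫ x in D.ω, g' x * φ x = ∫ x in D.ω, g x * φ x :=
    integral_congr_ae ((ae_restrict_of_ae_wt D hg).mono fun x hx => by simp only [hx])
  rw [h1, h2, h φ hφ]

theorem IsWeakDeriv.add {D : Polygon} {e : ℝ × ℝ} {u u' g g' : Lp ℂ 2 (wt D.ω 1)}
    (h : IsWeakDeriv D.ω e u g) (h' : IsWeakDeriv D.ω e u' g') :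
    IsWeakDeriv D.ω e (u + u' : Lp ℂ 2 (wt D.ω 1)) (g + g' : Lp ℂ 2 (wt D.ω 1)) := by
  refine IsWeakDeriv.congr (u := fun x => u x + u' x) (g := fun x => g x + g' x) ?_
    (Lp.coeFn_add u u') (Lp.coeFn_add g g')
  intro φ hφ
  simp only [add_mul]
  rw [integral_add (hφ.integrableOn_mul_fderiv u e) (hφ.integrableOn_mul_fderiv u' e),
    integral_add (hφ.integrableOn_mul g) (hφ.integrableOn_mul g'), h φ hφ, h' φ hφ]
  ring

theorem IsWeakDeriv.smul {D : Polygon} {e : ℝ × ℝ} {u g : Lp ℂ 2 (wt D.ω 1)} (c : ℂ)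
    (h : IsWeakDeriv D.ω e u g) :
    IsWeakDeriv D.ω e (c • u : Lp ℂ 2 (wt D.ω 1)) (c • g : Lp ℂ 2 (wt D.ω 1)) := by
  refine IsWeakDeriv.congr (u := fun x => c * u x) (g := fun x => c * g x) ?_
    (Lp.coeFn_smul c u) (Lp.coeFn_smul c g)
  intro φ hφ
  simp only [mul_assoc]
  rw [integral_const_mul, integral_const_mul, h φ hφ]
  ring

theorem IsWeakDeriv.zero {D : Polygon} {e : ℝ × ℝ} :
    IsWeakDeriv D.ω e (0 : Lp ℂ 2 (wt D.ω 1)) (0 : Lp ℂ 2 (wt D.ω 1)) := by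
  refine IsWeakDeriv.congr (u := fun _ => 0) (g := fun _ => 0) ?_
    (Lp.coeFn_zero ℂ 2 _) (Lp.coeFn_zero ℂ 2 _)
  intro φ hφ
  simp

theorem IsWeakDiv.congr {D : Polygon} {a a' b b' d d' : ℝ × ℝ → ℂ}
    (h : IsWeakDiv D.ω a b d) (ha : a' =ᵐ[wt D.ω 1] a) (hb : b' =ᵐ[wt D.ω 1] b)
    (hd : d' =ᵐ[wt D.ω 1] d) : IsWeakDiv D.ω a' b' d' := by
  intro φ hφ
  have h2 : ∫ x in D.ω, d' x * φ x = ∫ x in D.ω, d x * φ x :=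
    integral_congr_ae ((ae_restrict_of_ae_wt D hd).mono fun x hx => by simp only [hx])
  rw [h2, ← h φ hφ]
  refine integral_congr_ae ?_
  filter_upwards [ae_restrict_of_ae_wt D ha, ae_restrict_of_ae_wt D hb] with x hx hy
  simp only [hx, hy]

theorem IsWeakDiv.add {D : Polygon} {a a' b b' d d' : Lp ℂ 2 (wt D.ω 1)}
    (h : IsWeakDiv D.ω a b d) (h' : IsWeakDiv D.ω a' b' d') :
    IsWeakDiv D.ω (a + a' : Lp ℂ 2 (wt D.ω 1)) (b + b' : Lp ℂ 2 (wt D.ω 1))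
      (d + d' : Lp ℂ 2 (wt D.ω 1)) := by
  refine IsWeakDiv.congr (a := fun x => a x + a' x) (b := fun x => b x + b' x)
    (d := fun x => d x + d' x) ?_ (Lp.coeFn_add a a') (Lp.coeFn_add b b') (Lp.coeFn_add d d')
  intro φ hφ
  have hi : ∀ a b : Lp ℂ 2 (wt D.ω 1), IntegrableOn (fun x => a x * fderiv ℝ φ x (1, 0) +
      b x * fderiv ℝ φ x (0, 1) - a x / (x.1 : ℂ) * φ x) D.ω := fun a b =>
    ((hφ.integrableOn_mul_fderiv a (1, 0)).add (hφ.integrableOn_mul_fderiv b (0, 1))).sub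
      (hφ.integrableOn_div_mul a)
  have h2 : ∫ x in D.ω, (d x + d' x) * φ x =
      (∫ x in D.ω, d x * φ x) + ∫ x in D.ω, d' x * φ x := by
    simp only [add_mul]
    exact integral_add (hφ.integrableOn_mul d) (hφ.integrableOn_mul d')
  rw [h2, neg_add, ← h φ hφ, ← h' φ hφ, ← integral_add (hi a b) (hi a' b')]
  refine integral_congr_ae (Eventually.of_forall fun x => ?_)
  ring

theorem IsWeakDiv.smul {D : Polygon} {a b d : Lp ℂ 2 (wt D.ω 1)} (c : ℂ)
    (h : IsWeakDiv D.ω a b d) :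
    IsWeakDiv D.ω (c • a : Lp ℂ 2 (wt D.ω 1)) (c • b : Lp ℂ 2 (wt D.ω 1))
      (c • d : Lp ℂ 2 (wt D.ω 1)) := by
  refine IsWeakDiv.congr (a := fun x => c * a x) (b := fun x => c * b x)
    (d := fun x => c * d x) ?_ (Lp.coeFn_smul c a) (Lp.coeFn_smul c b) (Lp.coeFn_smul c d)
  intro φ hφ
  have h2 : ∫ x in D.ω, c * d x * φ x = c * ∫ x in D.ω, d x * φ x := by
    simp only [mul_assoc]
    exact integral_const_mul _ _
  rw [h2, ← mul_neg, ← h φ hφ, ← integral_const_mul]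
  refine integral_congr_ae (Eventually.of_forall fun x => ?_)
  ring

theorem IsWeakDiv.zero {D : Polygon} : IsWeakDiv D.ω (0 : Lp ℂ 2 (wt D.ω 1))
    (0 : Lp ℂ 2 (wt D.ω 1)) (0 : Lp ℂ 2 (wt D.ω 1)) := by
  refine IsWeakDiv.congr (a := fun _ => 0) (b := fun _ => 0) (d := fun _ => 0) ?_
    (Lp.coeFn_zero ℂ 2 _) (Lp.coeFn_zero ℂ 2 _) (Lp.coeFn_zero ℂ 2 _)
  intro φ hφ
  simp

/-- Triples of elements of `L²_1(ω)`, with the Hilbert norm. -/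
abbrev L2Triple (D : Polygon) : Type := PiLp 2 fun _ : Fin 3 => Lp ℂ 2 (wt D.ω 1)

/-- The space `H¹_1(ω)`: an element `u` is stored with its weak gradient as the triple
`(u, ∂_r u, ∂_z u)` of elements of `L²_1(ω)`; the norm is the canonical one. -/
def H1 (D : Polygon) : Submodule ℂ (L2Triple D) where
  carrier := {u | IsWeakDeriv D.ω (1, 0) (u 0) (u 1) ∧ IsWeakDeriv D.ω (0, 1) (u 0) (u 2)}
  add_mem' h h' := ⟨h.1.add h'.1, h.2.add h'.2⟩
  zero_mem' := ⟨IsWeakDeriv.zero, IsWeakDeriv.zero⟩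
  smul_mem' c _ h := ⟨h.1.smul c, h.2.smul c⟩

/-- The fields `(a, b)` in `L²_1(ω)²` whose axisymmetric divergence `d` is in `L²_1(ω)`, stored as
the triple `(a, b, d)`; the norm is the graph norm. -/
def HDiv (D : Polygon) : Submodule ℂ (L2Triple D) where
  carrier := {p | IsWeakDiv D.ω (p 0) (p 1) (p 2)}
  add_mem' h h' := IsWeakDiv.add h h'
  zero_mem' := IsWeakDiv.zero
  smul_mem' c _ h := IsWeakDiv.smul c h

/-- The triple `(∂_r v, ∂_z v, f)`. -/
def gradTriple {D : Polygon} (v : H1 D) (f : Lp ℂ 2 (wt D.ω 1)) : L2Triple D :=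
  WithLp.toLp 2 ![v.1 1, v.1 2, f]

/-- `Δ₀ v = f` in the sense of distributions in `ω`, where `f ∈ L²_1(ω)` and
`Δ₀ v = ∂_r (∂_r v) + (1/r) ∂_r v + ∂_z (∂_z v)`; the inner derivatives `∂_r v`, `∂_z v` are the
weak ones stored in `v`, the outer ones are taken against test functions. -/
def IsLaplacian {D : Polygon} (v : H1 D) (f : Lp ℂ 2 (wt D.ω 1)) : Prop :=
  IsWeakDiv D.ω (v.1 1) (v.1 2) f

/-- If `Δ₀ v = f ∈ L²_1(ω)`, then `∇v` as an element of `HDiv D`. -/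
def gradField {D : Polygon} (v : H1 D) (f : Lp ℂ 2 (wt D.ω 1)) (h : IsLaplacian v f) : HDiv D :=
  ⟨gradTriple v f, h⟩

/-- Arc length on the side `[P i, P (i + 1)]`. -/
def sideMeasure (D : Polygon) (i : Fin (D.m + 3)) : Measure (ℝ × ℝ) :=
  ENNReal.ofReal (euclLength (D.P (i + 1) - D.P i)) •
    Measure.map (fun t : ℝ => AffineMap.lineMap (D.P i) (D.P (i + 1)) t)
      (volume.restrict (Icc (0 : ℝ) 1))

/-- The unit outward normal on the side `[P i, P (i + 1)]`. -/
def normal (D : Polygon) (i : Fin (D.m + 3)) : ℝ × ℝ :=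
  -(euclLength (D.P (i + 1) - D.P i))⁻¹ • rotLeft (D.P (i + 1) - D.P i)

/-- The sides that form `γ_b`: all except `[P 0, P 1]`. -/
def sidesB (D : Polygon) : Finset (Fin (D.m + 3)) := Finset.univ.erase 0

/-- The measure `r dγ` on `γ_b`. -/
def bdryMeasure (D : Polygon) : Measure (ℝ × ℝ) :=
  (∑ i ∈ sidesB D, sideMeasure D i).withDensity fun x => ENNReal.ofReal x.1

/-- `T` is the trace operator on `γ_b`: the continuous linear map from `H¹_1(ω)` to
`L²(γ_b, r dγ)` that is the restriction to `γ_b` for functions that are smooth up to the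
boundary. -/
def IsTraceOp (D : Polygon) (T : H1 D →L[ℂ] Lp ℂ 2 (bdryMeasure D)) : Prop :=
  ∀ (u : H1 D) (φ : ℝ × ℝ → ℂ), ContDiff ℝ (⊤ : ℕ∞) φ → u.1 0 =ᵐ[wt D.ω 1] φ →
    T u =ᵐ[bdryMeasure D] φ

/-- `N` is the normal trace operator on `γ_b`: it sends a field `p ∈ HDiv D`, continuously and
linearly, to an element `p · ν` of the dual of the trace space `T (H¹_1(ω)) ≅ H¹_1(ω) / ker T`
(that is, to a continuous linear functional on `H¹_1(ω)` that vanishes on `ker T`), and for fields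
`p = (a, b)` that are smooth up to the boundary, this functional is
`u ↦ ∫_{γ_b} u (p · ν) r dγ`. -/
structure IsNormalTraceOp (D : Polygon) (T : H1 D →L[ℂ] Lp ℂ 2 (bdryMeasure D))
    (N : HDiv D →L[ℂ] H1 D →L[ℂ] ℂ) : Prop where
  ker : ∀ (p : HDiv D) (u : H1 D), T u = 0 → N p u = 0
  smooth : ∀ (p : HDiv D) (a b : ℝ × ℝ → ℂ), ContDiff ℝ (⊤ : ℕ∞) a → ContDiff ℝ (⊤ : ℕ∞) b →
    p.1 0 =ᵐ[wt D.ω 1] a → p.1 1 =ᵐ[wt D.ω 1] b → ∀ u : H1 D,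
      N p u = ∑ i ∈ sidesB D, ∫ x, T u x *
        (a x * ((normal D i).1 : ℂ) + b x * ((normal D i).2 : ℂ)) * (x.1 : ℂ) ∂(sideMeasure D i)

/-- `w ∈ H¹_{-1}(ω)`, for `w` in the larger space `H¹_1(ω)`. -/
def MemH1Neg {D : Polygon} (w : H1 D) : Prop :=
  ∀ i, MemLp (w.1 i) 2 (wt D.ω (-1))

end Meridian

end

/-!
The proof consists of two density statements for `ω`, a trace inequality, and Hardy's inequality at
the axis.

All integrals over `ω` are written with the bilinear pairing `pairing D w u` of triples
`w = (w₀, w₁, w₂)` and `u = (u, ∂_r u, ∂_z u)` with the weight `r`. With `p = (a, b)` of divergence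
`d` and `w = (d, a, b)` it is `∬ (u d + p · ∇u) r dr dz`; this form, `normalOp`, is the
normal trace, and Green's formula is then its definition. What has to be shown is that it is given
by the boundary integral for smooth fields, that it vanishes for `T u = 0`, and that smooth fields
are dense.

*Density.* `IsGradIn D O u` says that the integration by parts formula holds for test functions
supported in `O`. For `O = ω` this is membership in `H¹_1(ω)`. For `O = offVerts D`, the open
half-plane without the vertices, it says in addition that `u` vanishes on `γ_b`. Functions of the
first kind are limits of functions smooth up to the boundary (`pairing_eq_zero_of_isLocalSmooth`),
functions of the second kind are limits of test functions (`pairing_eq_zero_of_isTest`). Both are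
shown by duality, in the form that a triple which pairs to zero with the small class pairs to zero
with the large one. The functions are truncated, then cut off near the axis and the vertices: the
weight `r` and the dimension two permit cut-off functions with bounded energy, so that the
commutator terms vanish weakly. The rest is local, and near a side one mollifies with kernels
supported on one side of a line.

*Traces.* On each side of `γ_b` there is a triangle inside `ω` (`Polygon.exists_triangle`), whose
apex is chosen on the axis if the side ends there. Integration along the segments from the base to
the apex gives the trace inequality (`exists_side_bound`), and `T` is the continuous extension from
the smooth functions. The divergence theorem is needed only for functions supported near one side
(`IsLocalSmooth.integral_fderiv`), by density. Applied to the smooth fields `e ψ / r` it shows that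
`T u = 0` implies `IsGradIn D (offVerts D) u`, hence that `normalOp` vanishes on `ker T`. The same
fields give the density of the smooth fields in `HDiv D` (`dense_span_smooth_HDiv`): a triple that
annihilates them is, up to the order of its components, of the second kind above.

*The weighted identity.* If `T w = 0`, then `w` may be multiplied by smooth functions of `r` that
vanish near the axis and used in the integration by parts formulas. The cut-off is removed by
dominated convergence, since `r η_n'` is bounded (`exists_axis_cutoff_limit`). With the field
`w̄ e_r / (r (r² + e))` and `e → 0` one gets `w ∈ L²_{-3}(ω)` and
`Re ∬ w̄ ∂_r w r⁻² dr dz = ∬ |w|² r⁻³ dr dz` (`hardy`). Testing the equation `Δ₀ w = f` with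
`w̄ / r²` gives `∬ |∇w|² r⁻¹ dr dz - 2 Re ∬ w̄ ∂_r w r⁻² dr dz`, where the second
term comes from the derivative of `r⁻²`, and this is the right-hand side.
-/

noncomputable section

namespace Meridian

open scoped Convolution Pointwise

/-! ### Mollification in the plane -/

/-- A mollifying kernel: smooth, nonnegative, of integral one, with support in the ball of
radius `δ` around the origin. -/
structure IsMollifier (κ : ℝ × ℝ → ℝ) (δ : ℝ) : Prop where
  smooth : ContDiff ℝ (⊤ : ℕ∞) κ
  compact : HasCompactSupport κ
  nonneg : ∀ x, 0 ≤ κ x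
  integral_eq : ∫ x, κ x = 1
  supp : tsupport κ ⊆ Metric.ball 0 δ

/-- The convolution of a real kernel with a complex function on the plane. -/
abbrev conv (κ : ℝ × ℝ → ℝ) (U : ℝ × ℝ → ℂ) : ℝ × ℝ → ℂ :=
  κ ⋆[ContinuousLinearMap.lsmul ℝ ℝ, volume] U

theorem conv_apply (κ : ℝ × ℝ → ℝ) (U : ℝ × ℝ → ℂ) (x : ℝ × ℝ) :
    conv κ U x = ∫ s, κ s • U (x - s) := rfl

theorem conv_apply' (κ : ℝ × ℝ → ℝ) (U : ℝ × ℝ → ℂ) (x : ℝ × ℝ) :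
    conv κ U x = ∫ y, κ (x - y) • U y := by
  rw [conv_apply, ← integral_sub_left_eq_self _ volume x]
  simp

/-- Mollifying kernels exist with supports in any open half-plane through the origin; this makes
it possible to mollify a function on one side of a line. -/
theorem exists_isMollifier (ℓ : ℝ × ℝ →L[ℝ] ℝ) {v : ℝ × ℝ} (hv : 0 < ℓ v) {δ : ℝ} (hδ : 0 < δ) :
    ∃ κ, IsMollifier κ δ ∧ ∀ s ∈ tsupport κ, 0 < ℓ s := by
  obtain ⟨c, hc, hcv⟩ : ∃ c > 0, ‖ℓ‖ * c < ℓ v := by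
    refine ⟨ℓ v / (‖ℓ‖ + 1), by positivity, ?_⟩
    rw [mul_div_assoc', div_lt_iff₀ (by positivity)]
    nlinarith [norm_nonneg ℓ]
  obtain ⟨τ, hτ, hτδ⟩ : ∃ τ > 0, τ * (‖v‖ + c) < δ := by
    refine ⟨δ / (2 * (‖v‖ + c)), by positivity, ?_⟩
    have : 0 < ‖v‖ + c := by positivity
    field_simp
    linarith
  let φ : ContDiffBump (τ • v) := ⟨τ * c / 2, τ * c, by positivity, by
    have : 0 < τ * c := by positivity
    linarith⟩
  have hts : tsupport (φ.normed volume) = Metric.closedBall (τ • v) (τ * c) :=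
    φ.tsupport_normed_eq
  refine ⟨φ.normed volume, ⟨φ.contDiff_normed, φ.hasCompactSupport_normed, φ.nonneg_normed,
    φ.integral_normed, ?_⟩, ?_⟩
  · rw [hts]
    intro s hs
    rw [mem_closedBall_iff_norm] at hs
    rw [mem_ball_zero_iff]
    calc ‖s‖ = ‖(s - τ • v) + τ • v‖ := by simp
      _ ≤ τ * c + τ * ‖v‖ := (norm_add_le _ _).trans
          (add_le_add hs (by rw [norm_smul, Real.norm_of_nonneg hτ.le]))
      _ < δ := by linarith
  · rw [hts]
    intro s hs
    rw [mem_closedBall_iff_norm] at hs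
    have h1 : ℓ s = ℓ (s - τ • v) + τ * ℓ v := by simp
    have h2 : |ℓ (s - τ • v)| ≤ ‖ℓ‖ * (τ * c) :=
      (ℓ.le_opNorm _).trans (mul_le_mul_of_nonneg_left hs (norm_nonneg _))
    have h3 := neg_abs_le (ℓ (s - τ • v))
    nlinarith

theorem integral_norm_mul_le {α : Type*} [MeasurableSpace α] {μ : Measure α} {f g : α → ℂ}
    (hf : MemLp f 2 μ) (hg : MemLp g 2 μ) :
    ∫ x, ‖f x * g x‖ ∂μ ≤ (eLpNorm f 2 μ).toReal * (eLpNorm g 2 μ).toReal := by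
  have h1 : eLpNorm (f • g) 1 μ ≤ eLpNorm f 2 μ * eLpNorm g 2 μ :=
    eLpNorm_smul_le_mul_eLpNorm (p := 2) (q := 2) (r := 1) hg.1 hf.1
  have h2 : Integrable (fun x => f x * g x) μ := hf.integrable_mul hg
  rw [integral_norm_eq_lintegral_enorm h2.1, ← ENNReal.toReal_mul]
  rw [eLpNorm_one_eq_lintegral_enorm] at h1
  exact ENNReal.toReal_mono (ENNReal.mul_ne_top hf.2.ne hg.2.ne) h1

/-- Translation is continuous in `L^p`. -/
theorem tendsto_eLpNorm_translate_sub {p : ℝ≥0∞} [Fact (1 ≤ p)] (hp : p ≠ ∞) {f : ℝ × ℝ → ℂ}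
    (hf : MemLp f p volume) :
    Tendsto (fun s => eLpNorm (fun x => f (x - s) - f x) p volume) (𝓝 0) (𝓝 0) := by
  have hg : Continuous fun s : ℝ × ℝ => (⟨fun x => x - s, by fun_prop⟩ : C(ℝ × ℝ, ℝ × ℝ)) :=
    ContinuousMap.continuous_of_continuous_uncurry _
      (continuous_snd.sub continuous_fst : Continuous fun q : (ℝ × ℝ) × (ℝ × ℝ) => q.2 - q.1)
  have hm : ∀ s : ℝ × ℝ, MeasurePreserving
      (⟨fun x => x - s, by fun_prop⟩ : C(ℝ × ℝ, ℝ × ℝ)) volume volume :=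
    fun s => measurePreserving_sub_right volume s
  have h := Filter.Tendsto.compMeasurePreservingLp (f := fun _ => hf.toLp f)
    (tendsto_const_nhds) (hg.tendsto 0) hm (hm 0) hp
  rw [Lp.tendsto_Lp_iff_tendsto_eLpNorm'] at h
  refine h.congr fun s => eLpNorm_congr_ae ?_
  have h0 : ∀ s, ⇑(Lp.compMeasurePreserving (⟨fun x => x - s, by fun_prop⟩ : C(ℝ × ℝ, ℝ × ℝ)) (hm s)
      (hf.toLp f)) =ᵐ[volume] fun x => f (x - s) := fun s =>
    (Lp.coeFn_compMeasurePreserving _ _).trans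
      ((hm s).quasiMeasurePreserving.ae_eq_comp hf.coeFn_toLp)
  filter_upwards [h0 s, h0 0] with x h1 h2
  rw [Pi.sub_apply, h1, h2, sub_zero]

theorem IsMollifier.integrable {κ : ℝ × ℝ → ℝ} {δ : ℝ} (h : IsMollifier κ δ) : Integrable κ :=
  h.smooth.continuous.integrable_of_hasCompactSupport h.compact

/-- Averaging against a mollifying kernel: if `c` is within `ε` of `z` on the `δ`-ball, so is its
average. -/
theorem IsMollifier.norm_integral_smul_sub_le {κ : ℝ × ℝ → ℝ} {δ ε : ℝ} (h : IsMollifier κ δ)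
    {c : ℝ × ℝ → ℂ} {z : ℂ} (hc : AEStronglyMeasurable c volume)
    (hb : ∀ s ∈ Metric.ball (0 : ℝ × ℝ) δ, ‖c s - z‖ ≤ ε) :
    ‖(∫ s, κ s • c s) - z‖ ≤ ε := by
  have hpt : ∀ s, ‖κ s • (c s - z)‖ ≤ κ s * ε := by
    intro s
    rw [norm_smul, Real.norm_of_nonneg (h.nonneg s)]
    by_cases hs : s ∈ tsupport κ
    · exact mul_le_mul_of_nonneg_left (hb s (h.supp hs)) (h.nonneg s)
    · simp [image_eq_zero_of_notMem_tsupport hs]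
  have hi : Integrable (fun s => κ s • (c s - z)) :=
    (h.integrable.mul_const ε).mono' (h.smooth.continuous.aestronglyMeasurable.smul
      (hc.sub aestronglyMeasurable_const)) (Eventually.of_forall hpt)
  have hz : Integrable (fun s => κ s • z) := h.integrable.smul_const z
  have h1 : (∫ s, κ s • c s) - z = ∫ s, κ s • (c s - z) := by
    have : ∫ s, κ s • c s = ∫ s, (κ s • (c s - z) + κ s • z) := by
      congr 1; ext s; rw [← smul_add]; simp
    rw [this, integral_add hi hz, integral_smul_const, h.integral_eq]
    simp
  rw [h1]
  calc ‖∫ s, κ s • (c s - z)‖ ≤ ∫ s, κ s * ε :=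
        norm_integral_le_of_norm_le (h.integrable.mul_const ε) (Eventually.of_forall hpt)
    _ = ε := by rw [integral_mul_const, h.integral_eq, one_mul]

/-- Mollification converges weakly in `L²`. -/
theorem exists_forall_norm_integral_mul_conv_sub_le {W U : ℝ × ℝ → ℂ} (hW : MemLp W 2 volume)
    (hU : MemLp U 2 volume) {ε : ℝ} (hε : 0 < ε) :
    ∃ δ > 0, ∀ κ, IsMollifier κ δ → ‖(∫ x, W x * conv κ U x) - ∫ x, W x * U x‖ ≤ ε := by
  have hUs : ∀ s : ℝ × ℝ, MemLp (fun x => U (x - s)) 2 volume := fun s =>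
    hU.comp_measurePreserving (measurePreserving_sub_right volume s)
  have hint : ∀ s : ℝ × ℝ, Integrable (fun x => W x * U (x - s)) := fun s =>
    hW.integrable_mul (hUs s)
  have hF : AEStronglyMeasurable (fun q : (ℝ × ℝ) × (ℝ × ℝ) => W q.2 * U (q.2 - q.1))
      (volume.prod volume) := by
    refine hW.1.comp_snd.mul ?_
    have : Measure.QuasiMeasurePreserving (fun q : (ℝ × ℝ) × (ℝ × ℝ) => q.2 - q.1)
        (volume.prod volume) volume := by
      have := quasiMeasurePreserving_sub (μ := (volume : Measure (ℝ × ℝ)))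
        (ν := (volume : Measure (ℝ × ℝ)))
      exact this.comp (Measure.measurePreserving_swap).quasiMeasurePreserving
    exact hU.1.comp_quasiMeasurePreserving this
  have hb : ∀ s : ℝ × ℝ, ∫ x, ‖W x * U (x - s)‖ ≤
      (eLpNorm W 2 volume).toReal * (eLpNorm U 2 volume).toReal := by
    intro s
    refine (integral_norm_mul_le hW (hUs s)).trans_eq ?_
    rw [show eLpNorm (fun x => U (x - s)) 2 volume = eLpNorm U 2 volume from
        eLpNorm_comp_measurePreserving hU.1 (measurePreserving_sub_right volume s)]
  -- the correlation of `W` and `U` is continuous at the origin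
  have hcont : Tendsto (fun s : ℝ × ℝ => ∫ x, W x * U (x - s)) (𝓝 0)
      (𝓝 (∫ x, W x * U x)) := by
    have h2 := tendsto_eLpNorm_translate_sub (p := 2) (by simp) hU
    have h3 : Tendsto (fun s : ℝ × ℝ => (eLpNorm W 2 volume *
        eLpNorm (fun x => U (x - s) - U x) 2 volume).toReal) (𝓝 0) (𝓝 0) := by
      have := ENNReal.Tendsto.const_mul (a := eLpNorm W 2 volume) h2 (Or.inr hW.2.ne)
      rw [mul_zero] at this
      exact (ENNReal.tendsto_toReal ENNReal.zero_ne_top).comp this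
    rw [tendsto_iff_norm_sub_tendsto_zero]
    refine squeeze_zero (fun _ => norm_nonneg _) (fun s => ?_) h3
    have h4 : (∫ x, W x * U (x - s)) - ∫ x, W x * U x = ∫ x, W x * (U (x - s) - U x) := by
      have h0 : Integrable (fun x => W x * U x) := hW.integrable_mul hU
      rw [← integral_sub (hint s) h0]
      congr 1; ext x; ring
    rw [h4]
    refine (norm_integral_le_integral_norm _).trans ?_
    have hd : MemLp (fun x => U (x - s) - U x) 2 volume := (hUs s).sub hU
    rw [ENNReal.toReal_mul]
    exact integral_norm_mul_le hW hd
  obtain ⟨δ, hδ, hδε⟩ := Metric.tendsto_nhds_nhds.mp hcont ε hε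
  refine ⟨δ, hδ, fun κ hκ => ?_⟩
  -- Fubini: `∫ W (κ ⋆ U)` is the average of the correlation against `κ`
  have hprod : Integrable (fun q : (ℝ × ℝ) × (ℝ × ℝ) => κ q.1 • (W q.2 * U (q.2 - q.1)))
      (volume.prod volume) := by
    have hm : AEStronglyMeasurable (fun q : (ℝ × ℝ) × (ℝ × ℝ) => κ q.1 • (W q.2 * U (q.2 - q.1)))
        (volume.prod volume) :=
      (hκ.smooth.continuous.comp continuous_fst).aestronglyMeasurable.smul hF
    rw [integrable_prod_iff hm]
    refine ⟨Eventually.of_forall fun s => (hint s).smul (κ s), ?_⟩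
    refine (hκ.integrable.mul_const
      ((eLpNorm W 2 volume).toReal * (eLpNorm U 2 volume).toReal)).mono'
      hm.norm.integral_prod_right'
      (Eventually.of_forall fun s => ?_)
    simp only [norm_smul, integral_const_mul]
    rw [norm_mul, norm_norm, Real.norm_of_nonneg (hκ.nonneg s),
      Real.norm_of_nonneg (integral_nonneg fun _ => norm_nonneg _)]
    exact mul_le_mul_of_nonneg_left (hb s) (hκ.nonneg s)
  have hswap : ∫ x, W x * conv κ U x = ∫ s, κ s • ∫ x, W x * U (x - s) := by
    have := integral_integral_swap (f := fun s x : ℝ × ℝ => κ s • (W x * U (x - s))) hprod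
    simp only [integral_smul] at this
    rw [this]
    refine integral_congr_ae (Eventually.of_forall fun x => ?_)
    simp only [conv_apply]
    rw [← integral_const_mul]
    refine integral_congr_ae (Eventually.of_forall fun s => ?_)
    simp only [mul_smul_comm]
  rw [hswap]
  refine hκ.norm_integral_smul_sub_le ?_ fun s hs => ?_
  · exact hF.integral_prod_right'
  · have := hδε (x := s) (by simpa using hs)
    rw [dist_eq_norm] at this
    exact this.le

/-- Mollification converges in `L¹`. -/
theorem exists_forall_integral_norm_conv_sub_le {f : ℝ × ℝ → ℂ} (hf : Integrable f) {ε : ℝ}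
    (hε : 0 < ε) :
    ∃ δ > 0, ∀ κ, IsMollifier κ δ → Integrable (fun x => conv κ f x - f x) ∧
      ∫ x, ‖conv κ f x - f x‖ ≤ ε := by
  have hT := tendsto_eLpNorm_translate_sub (p := 1) (by simp) (memLp_one_iff_integrable.mpr hf)
  obtain ⟨δ, hδ, hδε⟩ := Metric.tendsto_nhds_nhds.mp
    ((ENNReal.tendsto_toReal ENNReal.zero_ne_top).comp hT) ε hε
  refine ⟨δ, hδ, fun κ hκ => ?_⟩
  have hfs : ∀ s : ℝ × ℝ, Integrable (fun x => f (x - s)) := fun s => hf.comp_sub_right s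
  have hprod1 : Integrable (fun q : (ℝ × ℝ) × (ℝ × ℝ) => κ q.2 • f (q.1 - q.2))
      (volume.prod volume) :=
    hκ.integrable.convolution_integrand (ContinuousLinearMap.lsmul ℝ ℝ) hf
  have hprod2 : Integrable (fun q : (ℝ × ℝ) × (ℝ × ℝ) => κ q.2 • f q.1)
      (volume.prod volume) := by
    have := (hκ.integrable.ofReal (𝕜 := ℂ))
    refine (hf.mul_prod this).congr (Eventually.of_forall fun q => ?_)
    simp [mul_comm]
  have hprod : Integrable (fun q : (ℝ × ℝ) × (ℝ × ℝ) => κ q.2 • (f (q.1 - q.2) - f q.1))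
      (volume.prod volume) := by
    refine (hprod1.sub hprod2).congr (Eventually.of_forall fun q => ?_)
    simp [smul_sub]
  have heq : ∀ᵐ x : ℝ × ℝ, conv κ f x - f x = ∫ s, κ s • (f (x - s) - f x) := by
    filter_upwards [hprod1.prod_right_ae, hprod2.prod_right_ae] with x h1 h2
    simp only [smul_sub]
    rw [integral_sub h1 h2, integral_smul_const, hκ.integral_eq, one_smul, conv_apply]
  refine ⟨hprod.integral_prod_left.congr (heq.mono fun x hx => hx.symm), ?_⟩
  calc ∫ x, ‖conv κ f x - f x‖ ≤ ∫ x, ∫ s, ‖κ s • (f (x - s) - f x)‖ := by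
        refine integral_mono_ae ?_ hprod.norm.integral_prod_left ?_
        · exact (hprod.integral_prod_left.congr (heq.mono fun x hx => hx.symm)).norm
        · filter_upwards [heq] with x hx
          rw [hx]
          exact norm_integral_le_integral_norm _
    _ = ∫ s, ∫ x, ‖κ s • (f (x - s) - f x)‖ := integral_integral_swap hprod.norm
    _ ≤ ∫ s, κ s * ε := by
        refine integral_mono hprod.norm.integral_prod_right (hκ.integrable.mul_const ε) fun s => ?_
        simp only [norm_smul, integral_const_mul, Real.norm_of_nonneg (hκ.nonneg s)]
        by_cases hs : s ∈ tsupport κ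
        · refine mul_le_mul_of_nonneg_left ?_ (hκ.nonneg s)
          have := hδε (x := s) (by simpa using hκ.supp hs)
          have hd : Integrable (fun x => f (x - s) - f x) := (hfs s).sub hf
          rw [Function.comp_apply, eLpNorm_one_eq_lintegral_enorm,
            ← integral_norm_eq_lintegral_enorm hd.1] at this
          simp only [ENNReal.toReal_zero, dist_zero_right] at this
          exact (le_abs_self _).trans this.le
        · simp [image_eq_zero_of_notMem_tsupport hs]
    _ = ε := by rw [integral_mul_const, hκ.integral_eq, one_mul]

theorem IsMollifier.contDiff_conv {κ : ℝ × ℝ → ℝ} {δ : ℝ} (h : IsMollifier κ δ) {U : ℝ × ℝ → ℂ}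
    (hU : LocallyIntegrable U) : ContDiff ℝ (⊤ : ℕ∞) (conv κ U) :=
  h.compact.contDiff_convolution_left _ h.smooth hU

theorem IsMollifier.fderiv_conv {κ : ℝ × ℝ → ℝ} {δ : ℝ} (h : IsMollifier κ δ) {U : ℝ × ℝ → ℂ}
    (hU : LocallyIntegrable U) (x e : ℝ × ℝ) :
    fderiv ℝ (conv κ U) x e = ∫ y, fderiv ℝ κ (x - y) e • U y := by
  have h1 := (h.compact.hasFDerivAt_convolution_left (ContinuousLinearMap.lsmul ℝ ℝ)
    (h.smooth.of_le (by exact_mod_cast le_top)) hU x).fderiv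
  rw [h1, convolution_def, ← integral_sub_left_eq_self _ volume x]
  simp only [sub_sub_cancel]
  rw [ContinuousLinearMap.integral_apply]
  · rfl
  · have hc : ConvolutionExistsAt (fderiv ℝ κ) U x
        ((ContinuousLinearMap.lsmul ℝ ℝ).precompL (ℝ × ℝ)) volume :=
      HasCompactSupport.convolutionExists_left _ (h.compact.fderiv ℝ)
        (h.smooth.continuous_fderiv (by simp)) hU x
    have := hc.integrable.comp_sub_left x
    simpa only [sub_sub_cancel] using this

theorem Polygon.measurableSet (D : Polygon) : MeasurableSet D.ω := D.isOpen.measurableSet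

/-! ### The weighted measures -/

theorem ae_wt_iff (D : Polygon) (τ : ℝ) {p : ℝ × ℝ → Prop} :
    (∀ᵐ x ∂(wt D.ω τ), p x) ↔ ∀ᵐ x ∂(volume.restrict D.ω), p x := by
  rw [wt, ae_withDensity_iff (by fun_prop)]
  refine eventually_congr ?_
  filter_upwards [ae_restrict_mem D.measurableSet] with x hx
  have : ENNReal.ofReal (x.1 ^ τ) ≠ 0 :=
    (ENNReal.ofReal_pos.mpr (Real.rpow_pos_of_pos (D.pos x hx) τ)).ne'
  simp [this]

theorem ae_wt_of_forall_mem (D : Polygon) (τ : ℝ) {p : ℝ × ℝ → Prop} (h : ∀ x ∈ D.ω, p x) :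
    ∀ᵐ x ∂(wt D.ω τ), p x :=
  (ae_wt_iff D τ).mpr ((ae_restrict_mem D.measurableSet).mono h)

theorem aestronglyMeasurable_wt_iff (D : Polygon) (τ : ℝ) {E : Type*} [TopologicalSpace E]
    {f : ℝ × ℝ → E} :
    AEStronglyMeasurable f (wt D.ω τ) ↔ AEStronglyMeasurable f (volume.restrict D.ω) := by
  constructor <;> refine fun h => h.mono_ac ?_
  · intro s hs
    rw [measure_eq_zero_iff_ae_notMem] at hs ⊢
    exact (ae_wt_iff D τ).mp hs
  · exact withDensity_absolutelyContinuous _ _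

theorem integral_wt (D : Polygon) (τ : ℝ) {E : Type*} [NormedAddCommGroup E] [NormedSpace ℝ E]
    (f : ℝ × ℝ → E) : ∫ x, f x ∂(wt D.ω τ) = ∫ x in D.ω, (x.1 ^ τ) • f x := by
  rw [wt, integral_withDensity_eq_integral_toReal_smul (by fun_prop)
    (Eventually.of_forall fun _ => ENNReal.ofReal_lt_top)]
  refine setIntegral_congr_fun D.measurableSet fun x hx => ?_
  rw [ENNReal.toReal_ofReal (Real.rpow_nonneg (D.pos x hx).le τ)]

theorem integrable_wt_iff (D : Polygon) (τ : ℝ) {E : Type*} [NormedAddCommGroup E]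
    [NormedSpace ℝ E] {f : ℝ × ℝ → E} :
    Integrable f (wt D.ω τ) ↔ IntegrableOn (fun x => (x.1 ^ τ) • f x) D.ω := by
  rw [wt, integrable_withDensity_iff_integrable_smul' (by fun_prop)
    (Eventually.of_forall fun _ => ENNReal.ofReal_lt_top)]
  refine integrable_congr ?_
  filter_upwards [ae_restrict_mem D.measurableSet] with x hx
  rw [ENNReal.toReal_ofReal (Real.rpow_nonneg (D.pos x hx).le τ)]

theorem integral_wt_one (D : Polygon) {E : Type*} [NormedAddCommGroup E] [NormedSpace ℝ E]
    (f : ℝ × ℝ → E) : ∫ x, f x ∂(wt D.ω 1) = ∫ x in D.ω, x.1 • f x := by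
  simp only [integral_wt, Real.rpow_one]

theorem integrable_wt_one_iff (D : Polygon) {E : Type*} [NormedAddCommGroup E]
    [NormedSpace ℝ E] {f : ℝ × ℝ → E} :
    Integrable f (wt D.ω 1) ↔ IntegrableOn (fun x => x.1 • f x) D.ω := by
  simp only [integrable_wt_iff, Real.rpow_one]

theorem memLp_two_wt_iff (D : Polygon) (τ : ℝ) {f : ℝ × ℝ → ℂ} :
    MemLp f 2 (wt D.ω τ) ↔ AEStronglyMeasurable f (volume.restrict D.ω) ∧
      IntegrableOn (fun x => x.1 ^ τ * ‖f x‖ ^ 2) D.ω := by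
  constructor
  · intro h
    refine ⟨(aestronglyMeasurable_wt_iff D τ).mp h.1, ?_⟩
    have := (memLp_two_iff_integrable_sq_norm h.1).mp h
    rwa [integrable_wt_iff] at this
  · rintro ⟨h1, h2⟩
    have h1' := (aestronglyMeasurable_wt_iff D τ).mpr h1
    rw [memLp_two_iff_integrable_sq_norm h1', integrable_wt_iff]
    exact h2

theorem continuous_div_fst {ψ : ℝ × ℝ → ℂ} (hψ : Continuous ψ)
    (hs : tsupport ψ ⊆ {x | 0 < x.1}) : Continuous fun x => ψ x / (x.1 : ℂ) := by
  rw [continuous_iff_continuousAt]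
  intro x
  by_cases hx : x ∈ tsupport ψ
  · refine ContinuousAt.div hψ.continuousAt (by fun_prop) ?_
    exact_mod_cast (hs hx : 0 < x.1).ne'
  · have h0 : (fun x => ψ x / (x.1 : ℂ)) =ᶠ[𝓝 x] fun _ => 0 := by
      filter_upwards [notMem_tsupport_iff_eventuallyEq.mp hx] with y hy
      simp [hy]
    exact continuousAt_const.congr h0.symm

theorem hasCompactSupport_div_fst {ψ : ℝ × ℝ → ℂ} (hc : HasCompactSupport ψ) :
    HasCompactSupport fun x => ψ x / (x.1 : ℂ) := by
  refine hc.mono fun x hx => ?_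
  simp only [Function.mem_support, ne_eq, div_eq_zero_iff, not_or] at hx ⊢
  exact hx.1

theorem integrableOn_mul_of_tsupport (D : Polygon) {f ψ : ℝ × ℝ → ℂ} (hf : MemLp f 2 (wt D.ω 1))
    (hψ : Continuous ψ) (hc : HasCompactSupport ψ) (hs : tsupport ψ ⊆ {x | 0 < x.1}) :
    IntegrableOn (fun x => f x * ψ x) D.ω := by
  have hfin := isFiniteMeasure_wt_one D
  have hcont := continuous_div_fst hψ hs
  obtain ⟨C, hC⟩ := (hasCompactSupport_div_fst hc).exists_bound_of_continuous hcont
  have h2 : MemLp (fun x => ψ x / (x.1 : ℂ)) 2 (wt D.ω 1) :=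
    MemLp.of_bound hcont.aestronglyMeasurable C (Eventually.of_forall hC)
  have h3 : Integrable (fun x => f x * (ψ x / (x.1 : ℂ))) (wt D.ω 1) := hf.integrable_mul h2
  rw [integrable_wt_one_iff] at h3
  refine h3.congr ?_
  filter_upwards [ae_restrict_mem D.measurableSet] with x hx
  have hp' : (x.1 : ℂ) ≠ 0 := by exact_mod_cast (D.pos x hx).ne'
  rw [Complex.real_smul]
  field_simp

theorem MemLp.continuous_mul {D : Polygon} {τ : ℝ} {f ψ : ℝ × ℝ → ℂ} (hf : MemLp f 2 (wt D.ω τ))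
    (hψ : Continuous ψ) {C : ℝ} (hC : ∀ x ∈ D.ω, ‖ψ x‖ ≤ C) :
    MemLp (fun x => ψ x * f x) 2 (wt D.ω τ) := by
  refine MemLp.of_le_mul (c := C) hf (hψ.aestronglyMeasurable.mul hf.1)
    (ae_wt_of_forall_mem D τ fun x hx => ?_)
  rw [norm_mul]
  exact mul_le_mul_of_nonneg_right (hC x hx) (norm_nonneg _)

theorem memLp_two_indicator_of_tsupport (D : Polygon) {f ψ : ℝ × ℝ → ℂ}
    (hf : MemLp f 2 (wt D.ω 1))
    (hψ : Continuous ψ) (hc : HasCompactSupport ψ) (hs : tsupport ψ ⊆ {x | 0 < x.1}) :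
    MemLp (D.ω.indicator fun x => ψ x * f x) 2 volume := by
  have hcont := continuous_div_fst hψ hs
  rw [memLp_indicator_iff_restrict D.measurableSet]
  have h1 := (memLp_two_wt_iff D 1).mp hf
  have hm : AEStronglyMeasurable (fun x => ψ x * f x) (volume.restrict D.ω) :=
    hψ.aestronglyMeasurable.mul h1.1
  rw [memLp_two_iff_integrable_sq_norm hm]
  obtain ⟨C, hC⟩ := (hasCompactSupport_div_fst hc).exists_bound_of_continuous hcont
  obtain ⟨C', hC'⟩ := hc.exists_bound_of_continuous hψ
  have h2 := h1.2.const_mul (C * C')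
  refine h2.mono' (hm.norm.aemeasurable.pow_const 2).aestronglyMeasurable ?_
  filter_upwards [ae_restrict_mem D.measurableSet] with x hx
  have hp := D.pos x hx
  have hCx := hC x
  rw [norm_div, Complex.norm_real, Real.norm_of_nonneg hp.le, div_le_iff₀ hp] at hCx
  have hC0 : 0 ≤ C' := (norm_nonneg _).trans (hC' x)
  rw [Real.rpow_one, norm_mul, Real.norm_of_nonneg (by positivity), mul_pow, pow_two ‖ψ x‖]
  calc ‖ψ x‖ * ‖ψ x‖ * ‖f x‖ ^ 2 ≤ ((C * x.1) * C') * ‖f x‖ ^ 2 := by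
        have := hC' x
        gcongr
        exact (norm_nonneg _).trans hCx
    _ = C * C' * (x.1 * ‖f x‖ ^ 2) := by ring

theorem memLp_two_indicator_fst_mul (D : Polygon) {f : ℝ × ℝ → ℂ} (hf : MemLp f 2 (wt D.ω 1)) :
    MemLp (D.ω.indicator fun x => (x.1 : ℂ) * f x) 2 volume := by
  rw [memLp_indicator_iff_restrict D.measurableSet]
  have h1 := (memLp_two_wt_iff D 1).mp hf
  have hm : AEStronglyMeasurable (fun x => (x.1 : ℂ) * f x) (volume.restrict D.ω) :=
    (by fun_prop : Continuous fun x : ℝ × ℝ => (x.1 : ℂ)).aestronglyMeasurable.mul h1.1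
  rw [memLp_two_iff_integrable_sq_norm hm]
  obtain ⟨R, hR⟩ := D.isBounded.exists_norm_le
  refine (h1.2.const_mul R).mono' (hm.norm.aemeasurable.pow_const 2).aestronglyMeasurable ?_
  filter_upwards [ae_restrict_mem D.measurableSet] with x hx
  have hp := D.pos x hx
  have hxR : x.1 ≤ R := ((le_abs_self _).trans (norm_fst_le x)).trans (hR x hx)
  rw [Real.rpow_one, norm_mul, Complex.norm_real, Real.norm_of_nonneg hp.le,
    Real.norm_of_nonneg (by positivity)]
  calc (x.1 * ‖f x‖) ^ 2 = x.1 * (x.1 * ‖f x‖ ^ 2) := by ring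
    _ ≤ R * (x.1 * ‖f x‖ ^ 2) := by gcongr

/-! ### Smooth cut-off functions -/

/-- `f` is smooth, compactly supported in `O`, with values in `[0, 1]`. -/
structure IsCutoff (O : Set (ℝ × ℝ)) (f : ℝ × ℝ → ℝ) : Prop where
  smooth : ContDiff ℝ (⊤ : ℕ∞) f
  compact : HasCompactSupport f
  supp : tsupport f ⊆ O
  nonneg : ∀ x, 0 ≤ f x
  le_one : ∀ x, f x ≤ 1

theorem exists_isCutoff_nhds {O : Set (ℝ × ℝ)} (hO : IsOpen O) {x : ℝ × ℝ} (hx : x ∈ O) :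
    ∃ f, IsCutoff O f ∧ f =ᶠ[𝓝 x] 1 := by
  obtain ⟨ε, hε, hεO⟩ := Metric.isOpen_iff.mp hO x hx
  let b : ContDiffBump x := ⟨ε / 4, ε / 2, by positivity, by linarith⟩
  exact ⟨b, ⟨b.contDiff, b.hasCompactSupport, b.tsupport_eq.trans_subset
    ((Metric.closedBall_subset_ball (by change ε / 2 < ε; linarith)).trans hεO),
    fun _ => b.nonneg, fun _ => b.le_one⟩, b.eventuallyEq_one⟩

theorem tsupport_add_sub_mul_subset {f g : ℝ × ℝ → ℝ} :
    tsupport (f + g - f * g) ⊆ tsupport f ∪ tsupport g := by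
  refine closure_minimal ?_ ((isClosed_tsupport f).union (isClosed_tsupport g))
  intro x hx
  by_contra hn
  rw [mem_union, not_or] at hn
  apply hx
  simp [image_eq_zero_of_notMem_tsupport hn.1, image_eq_zero_of_notMem_tsupport hn.2]

theorem IsCutoff.add_sub_mul {O : Set (ℝ × ℝ)} {f g : ℝ × ℝ → ℝ} (hf : IsCutoff O f)
    (hg : IsCutoff O g) : IsCutoff O (f + g - f * g) where
  smooth := (hf.smooth.add hg.smooth).sub (hf.smooth.mul hg.smooth)
  compact := (hf.compact.isCompact.union hg.compact.isCompact).of_isClosed_subset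
    (isClosed_tsupport _) tsupport_add_sub_mul_subset
  supp := tsupport_add_sub_mul_subset.trans (union_subset hf.supp hg.supp)
  nonneg x := by
    have := hf.nonneg x; have := hf.le_one x; have := hg.nonneg x; have := hg.le_one x
    simp only [Pi.sub_apply, Pi.add_apply, Pi.mul_apply]
    nlinarith
  le_one x := by
    have := hf.nonneg x; have := hf.le_one x; have := hg.nonneg x; have := hg.le_one x
    simp only [Pi.sub_apply, Pi.add_apply, Pi.mul_apply]
    nlinarith

theorem exists_isCutoff {O K : Set (ℝ × ℝ)} (hO : IsOpen O) (hK : IsCompact K) (hKO : K ⊆ O) :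
    ∃ f, IsCutoff O f ∧ ∀ x ∈ K, f =ᶠ[𝓝 x] 1 := by
  refine hK.induction_on (p := fun s => ∃ f, IsCutoff O f ∧ ∀ x ∈ s, f =ᶠ[𝓝 x] 1) ?_ ?_ ?_ ?_
  · exact ⟨0, ⟨contDiff_const, HasCompactSupport.zero, by simp,
      fun _ => le_rfl, fun _ => zero_le_one⟩, by simp⟩
  · rintro s t hst ⟨f, hf, hf1⟩
    exact ⟨f, hf, fun x hx => hf1 x (hst hx)⟩
  · rintro s t ⟨f, hf, hf1⟩ ⟨g, hg, hg1⟩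
    refine ⟨_, hf.add_sub_mul hg, ?_⟩
    rintro x (hx | hx)
    · filter_upwards [hf1 x hx] with y hy
      simp [hy]
    · filter_upwards [hg1 x hx] with y hy
      simp [hy]
  · intro x hx
    obtain ⟨f, hf, hf1⟩ := exists_isCutoff_nhds hO (hKO hx)
    obtain ⟨V, hV, hVO, hxV⟩ := eventually_nhds_iff.mp hf1
    exact ⟨V, mem_nhdsWithin_of_mem_nhds (hVO.mem_nhds hxV), f, hf, fun y hy =>
      eventually_nhds_iff.mpr ⟨V, hV, hVO, hy⟩⟩

/-! ### Weak derivatives: mollification, product rule and chain rule -/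

/-- The integration by parts formula on `ω` that defines the weak derivative `g = ∂_e u`, but for
test functions supported in an open set `O`.  For `O = ω` this is the weak derivative in `ω`.
If `O` also contains part of the boundary of `ω`, it says that the extension of `u` by
zero has a weak derivative in `O`, the extension of `g` by zero; thus `u` vanishes on that part of
the boundary in the weak sense. -/
def IsWeakDerivIn (ω O : Set (ℝ × ℝ)) (e : ℝ × ℝ) (u g : ℝ × ℝ → ℂ) : Prop :=
  ∀ φ, IsTest O φ → ∫ x in ω, u x * fderiv ℝ φ x e = -∫ x in ω, g x * φ x

theorem fderiv_conv_eq_conv {κ : ℝ × ℝ → ℝ} {δ : ℝ} (h : IsMollifier κ δ) {U g : ℝ × ℝ → ℂ}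
    (hU : LocallyIntegrable U) {x e : ℝ × ℝ} {χ : ℝ × ℝ → ℝ}
    (hχ : ∀ y, U y ≠ 0 ∨ g y ≠ 0 → χ =ᶠ[𝓝 y] 1)
    (hw : ∫ y, U y * fderiv ℝ (fun y => ((κ (x - y) * χ y : ℝ) : ℂ)) y e =
      -∫ y, g y * ((κ (x - y) * χ y : ℝ) : ℂ)) :
    fderiv ℝ (conv κ U) x e = conv κ g x := by
  rw [h.fderiv_conv hU, conv_apply']
  have h1 : ∫ y, fderiv ℝ κ (x - y) e • U y =
      -∫ y, U y * fderiv ℝ (fun y => ((κ (x - y) * χ y : ℝ) : ℂ)) y e := by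
    rw [← integral_neg]
    refine integral_congr_ae (Eventually.of_forall fun y => ?_)
    simp only
    by_cases hy : U y = 0
    · simp [hy]
    · have h2 : (fun y => ((κ (x - y) * χ y : ℝ) : ℂ)) =ᶠ[𝓝 y] fun y => ((κ (x - y) : ℝ) : ℂ) := by
        filter_upwards [hχ y (Or.inl hy)] with z hz
        simp [hz]
      have hd : HasFDerivAt κ (fderiv ℝ κ (x - y)) (x - y) :=
        (h.smooth.differentiable (by simp) _).hasFDerivAt
      have h3 : HasFDerivAt (fun y => ((κ (x - y) : ℝ) : ℂ))
          (Complex.ofRealCLM.comp ((fderiv ℝ κ (x - y)).comp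
            (-(ContinuousLinearMap.id ℝ (ℝ × ℝ))))) y := by
        refine Complex.ofRealCLM.hasFDerivAt.comp y (hd.comp y ?_)
        simpa using (hasFDerivAt_id y).const_sub x
      rw [h2.fderiv_eq, h3.fderiv]
      simp [mul_comm]
  rw [h1, hw, neg_neg]
  refine integral_congr_ae (Eventually.of_forall fun y => ?_)
  simp only
  by_cases hy : g y = 0
  · simp [hy]
  · have := (hχ y (Or.inr hy)).self_of_nhds
    simp [this, mul_comm]

/-- The chain rule for weak derivatives of integrable functions on the whole plane, by
mollification: `fderiv G (V_n) (h_n)` converges because `h_n → h` in `L¹` and `V_n → V` almost everywhere along a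
subsequence. -/
theorem IsWeakDeriv.comp_univ {V h : ℝ × ℝ → ℂ} {e : ℝ × ℝ} (hV : Integrable V)
    (hh : Integrable h) (hw : IsWeakDeriv univ e V h) {G : ℂ → ℂ} (hG : ContDiff ℝ 1 G) {B C : ℝ}
    (hB : ∀ z, ‖G z‖ ≤ B) (hC : ∀ z, ‖fderiv ℝ G z‖ ≤ C) :
    IsWeakDeriv univ e (fun x => G (V x)) (fun x => fderiv ℝ G (V x) (h x)) := by
  intro φ hφ
  simp only [setIntegral_univ]
  have hCn : 0 ≤ C := (norm_nonneg _).trans (hC 0)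
  -- kernels for which both mollifications are close in `L¹`
  have hex : ∀ n : ℕ, ∃ κ : ℝ × ℝ → ℝ, (∃ δ, IsMollifier κ δ) ∧
      (Integrable (fun x => conv κ V x - V x) ∧ ∫ x, ‖conv κ V x - V x‖ ≤ 1 / (n + 1)) ∧
      (Integrable (fun x => conv κ h x - h x) ∧ ∫ x, ‖conv κ h x - h x‖ ≤ 1 / (n + 1)) := by
    intro n
    obtain ⟨δ₁, h1, h1'⟩ := exists_forall_integral_norm_conv_sub_le hV
      (ε := 1 / ((n : ℝ) + 1)) (by positivity)
    obtain ⟨δ₂, h2, h2'⟩ := exists_forall_integral_norm_conv_sub_le hh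
      (ε := 1 / ((n : ℝ) + 1)) (by positivity)
    obtain ⟨κ, hκ, -⟩ := exists_isMollifier (ContinuousLinearMap.fst ℝ ℝ ℝ) (v := (1, 0))
      (by simp) (lt_min h1 h2)
    exact ⟨κ, ⟨_, hκ⟩,
      h1' κ { hκ with supp := hκ.supp.trans (Metric.ball_subset_ball (min_le_left _ _)) },
      h2' κ { hκ with supp := hκ.supp.trans (Metric.ball_subset_ball (min_le_right _ _)) }⟩
  choose κ hκ hκV hκh using hex
  have hlim0 : Tendsto (fun n : ℕ => (1 : ℝ) / (n + 1)) atTop (𝓝 0) :=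
    tendsto_one_div_add_atTop_nhds_zero_nat
  -- `L¹` convergence gives almost everywhere convergence along a subsequence
  obtain ⟨ns, hns, hae⟩ : ∃ ns : ℕ → ℕ, StrictMono ns ∧
      ∀ᵐ x, Tendsto (fun i => conv (κ (ns i)) V x) atTop (𝓝 (V x)) := by
    have hm : ∀ n, AEStronglyMeasurable (conv (κ n) V) volume := fun n => by
      obtain ⟨δ, hδ⟩ := hκ n
      exact (hδ.contDiff_conv hV.locallyIntegrable).continuous.aestronglyMeasurable
    have hT : Tendsto (fun n => eLpNorm (conv (κ n) V - V) 1 volume) atTop (𝓝 0) := by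
      have : ∀ n, eLpNorm (conv (κ n) V - V) 1 volume = ENNReal.ofReal
          (∫ x, ‖conv (κ n) V x - V x‖) := fun n => by
        rw [eLpNorm_one_eq_lintegral_enorm,
          ofReal_integral_norm_eq_lintegral_enorm (hκV n).1]
        rfl
      simp only [this]
      rw [← ENNReal.ofReal_zero]
      exact ENNReal.tendsto_ofReal (squeeze_zero (fun n => integral_nonneg fun _ => norm_nonneg _)
        (fun n => (hκV n).2) hlim0)
    exact (tendstoInMeasure_of_tendsto_eLpNorm one_ne_zero hm hV.1 hT).exists_seq_tendsto_ae
  obtain ⟨M, hM⟩ := hφ.compact.exists_bound_of_continuous hφ.smooth.continuous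
  have hφi : Integrable φ := hφ.smooth.continuous.integrable_of_hasCompactSupport hφ.compact
  have hφec : Continuous fun x => fderiv ℝ φ x e :=
    (hφ.smooth.continuous_fderiv (by simp)).clm_apply continuous_const
  have hφei : Integrable (fun x => fderiv ℝ φ x e) :=
    hφec.integrable_of_hasCompactSupport (hφ.compact.fderiv_apply ℝ e)
  have hGf : Continuous (fderiv ℝ G) := hG.continuous_fderiv one_ne_zero
  have hGapp : ∀ z w, ‖fderiv ℝ G z w‖ ≤ C * ‖w‖ := fun z w =>
    ((fderiv ℝ G z).le_opNorm w).trans (mul_le_mul_of_nonneg_right (hC z) (norm_nonneg _))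
  -- the classical chain rule and integration by parts for the mollified function
  have hcl : ∀ n, ∫ x, G (conv (κ n) V x) * fderiv ℝ φ x e =
      -∫ x, fderiv ℝ G (conv (κ n) V x) (conv (κ n) h x) * φ x := by
    intro n
    obtain ⟨δ, hδ⟩ := hκ n
    have hs := hδ.contDiff_conv hV.locallyIntegrable
    have hGs : ContDiff ℝ 1 fun x => G (conv (κ n) V x) :=
      hG.comp (hs.of_le (by exact_mod_cast le_top))
    have hder : ∀ x, fderiv ℝ (fun x => G (conv (κ n) V x)) x e =
        fderiv ℝ G (conv (κ n) V x) (conv (κ n) h x) := by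
      intro x
      have h1 := ((hG.differentiable one_ne_zero (conv (κ n) V x)).hasFDerivAt.comp x
        (hs.differentiable (by simp) x).hasFDerivAt).fderiv
      have h2 : fderiv ℝ (conv (κ n) V) x e = conv (κ n) h x := by
        refine fderiv_conv_eq_conv hδ hV.locallyIntegrable (χ := 1)
          (fun _ _ => EventuallyEq.rfl) ?_
        have := hw (fun y => ((κ n (x - y) * (1 : ℝ × ℝ → ℝ) y : ℝ) : ℂ)) ⟨?_, ?_, subset_univ _⟩
        · simpa only [setIntegral_univ] using this
        · simp only [Pi.one_apply, mul_one]
          exact Complex.ofRealCLM.contDiff.comp (hδ.smooth.comp (contDiff_const.sub contDiff_id))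
        · simp only [Pi.one_apply, mul_one]
          exact (hδ.compact.comp_homeomorph (Homeomorph.subLeft x)).comp_left
            (g := fun r : ℝ => (r : ℂ)) Complex.ofReal_zero
      rw [← h2]
      exact congrArg (fun L => L e) h1
    simp only [← hder]
    have hcs : Continuous fun x => fderiv ℝ (fun x => G (conv (κ n) V x)) x e :=
      (hGs.continuous_fderiv one_ne_zero).clm_apply continuous_const
    refine integral_mul_fderiv_eq_neg_fderiv_mul_of_integrable ?_ ?_ ?_
      (fun x _ => hGs.differentiable one_ne_zero x)
      (fun x _ => hφ.smooth.differentiable (by simp) x)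
    · exact (hcs.mul hφ.smooth.continuous).integrable_of_hasCompactSupport hφ.compact.mul_left
    · exact (hGs.continuous.mul hφec).integrable_of_hasCompactSupport
        (hφ.compact.fderiv_apply ℝ e).mul_left
    · exact (hGs.continuous.mul hφ.smooth.continuous).integrable_of_hasCompactSupport
        hφ.compact.mul_left
  have hcm : ∀ n, AEStronglyMeasurable (conv (κ n) V) volume := fun n => by
    obtain ⟨δ, hδ⟩ := hκ n
    exact (hδ.contDiff_conv hV.locallyIntegrable).continuous.aestronglyMeasurable
  have happ : Continuous fun q : (ℂ →L[ℝ] ℂ) × ℂ => q.1 q.2 := by fun_prop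
  have hmeas : ∀ {a b : ℝ × ℝ → ℂ}, AEStronglyMeasurable a volume → AEStronglyMeasurable b volume →
      AEStronglyMeasurable (fun x => fderiv ℝ G (a x) (b x) * φ x) volume := fun {a b} ha hb =>
    (happ.comp_aestronglyMeasurable ((hGf.comp_aestronglyMeasurable ha).prodMk hb)).mul
      hφ.smooth.continuous.aestronglyMeasurable
  have hL : Tendsto (fun i => ∫ x, G (conv (κ (ns i)) V x) * fderiv ℝ φ x e) atTop
      (𝓝 (∫ x, G (V x) * fderiv ℝ φ x e)) := by
    refine tendsto_integral_of_dominated_convergence (fun x => B * ‖fderiv ℝ φ x e‖)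
      (fun i => (hG.continuous.comp_aestronglyMeasurable (hcm _)).mul hφec.aestronglyMeasurable)
      (hφei.norm.const_mul B) (fun i => Eventually.of_forall fun x => ?_) ?_
    · rw [norm_mul]
      exact mul_le_mul_of_nonneg_right (hB _) (norm_nonneg _)
    · filter_upwards [hae] with x hx
      exact ((hG.continuous.tendsto _).comp hx).mul_const _
  have hR1 : Tendsto (fun i => ∫ x, fderiv ℝ G (conv (κ (ns i)) V x) (h x) * φ x) atTop
      (𝓝 (∫ x, fderiv ℝ G (V x) (h x) * φ x)) := by
    refine tendsto_integral_of_dominated_convergence (fun x => C * M * ‖h x‖)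
      (fun i => hmeas (hcm _) hh.1) (hh.norm.const_mul _)
      (fun i => Eventually.of_forall fun x => ?_) ?_
    · rw [norm_mul]
      calc _ ≤ (C * ‖h x‖) * M := mul_le_mul (hGapp _ _) (hM x) (norm_nonneg _) (by positivity)
        _ = _ := by ring
    · filter_upwards [hae] with x hx
      have hGx : Continuous fun z => fderiv ℝ G z (h x) := hGf.clm_apply continuous_const
      exact ((hGx.tendsto _).comp hx).mul_const _
  have hi1 : ∀ n, Integrable (fun x => fderiv ℝ G (conv (κ n) V x) (h x) * φ x) := fun n => by
    refine (hh.norm.const_mul (C * M)).mono' (hmeas (hcm _) hh.1)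
      (Eventually.of_forall fun x => ?_)
    rw [norm_mul]
    calc _ ≤ (C * ‖h x‖) * M := mul_le_mul (hGapp _ _) (hM x) (norm_nonneg _) (by positivity)
      _ = _ := by ring
  have hbd2 : ∀ n x, ‖fderiv ℝ G (conv (κ n) V x) (conv (κ n) h x - h x) * φ x‖ ≤
      C * M * ‖conv (κ n) h x - h x‖ := fun n x => by
    rw [norm_mul]
    calc _ ≤ (C * ‖conv (κ n) h x - h x‖) * M :=
          mul_le_mul (hGapp _ _) (hM x) (norm_nonneg _) (by positivity)
      _ = _ := by ring
  have hi2 : ∀ n, Integrable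
      (fun x => fderiv ℝ G (conv (κ n) V x) (conv (κ n) h x - h x) * φ x) := fun n =>
    ((hκh n).1.norm.const_mul (C * M)).mono' (hmeas (hcm _) (hκh n).1.1)
      (Eventually.of_forall fun x => hbd2 n x)
  have hR2 : Tendsto (fun n => ∫ x, fderiv ℝ G (conv (κ n) V x) (conv (κ n) h x - h x) * φ x) atTop
      (𝓝 0) := by
    refine squeeze_zero_norm (a := fun n : ℕ => C * M * (1 / ((n : ℝ) + 1))) (fun n => ?_)
      (by simpa using hlim0.const_mul (C * M))
    refine (norm_integral_le_of_norm_le ((hκh n).1.norm.const_mul (C * M))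
      (Eventually.of_forall fun x => hbd2 n x)).trans ?_
    rw [integral_const_mul]
    have : 0 ≤ M := (norm_nonneg _).trans (hM 0)
    exact mul_le_mul_of_nonneg_left (hκh n).2 (by positivity)
  have hR := (hR1.add (hR2.comp hns.tendsto_atTop)).neg
  rw [add_zero] at hR
  refine tendsto_nhds_unique hL (hR.congr fun i => ?_)
  rw [hcl, Function.comp_apply, ← integral_add (hi1 _) (hi2 _)]
  congr 1
  refine integral_congr_ae (Eventually.of_forall fun x => ?_)
  simp only [map_sub]
  ring

theorem isOpen_halfPlane : IsOpen {x : ℝ × ℝ | 0 < x.1} := isOpen_lt continuous_const continuous_fst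

theorem ofReal_contDiff {f : ℝ × ℝ → ℝ} (hf : ContDiff ℝ (⊤ : ℕ∞) f) :
    ContDiff ℝ (⊤ : ℕ∞) fun x => (f x : ℂ) := Complex.ofRealCLM.contDiff.comp hf

theorem continuous_fderiv_apply {f : ℝ × ℝ → ℝ} (hf : ContDiff ℝ (⊤ : ℕ∞) f) (e : ℝ × ℝ) :
    Continuous fun x => fderiv ℝ f x e :=
  (hf.continuous_fderiv (by simp)).clm_apply continuous_const

theorem continuous_fderiv_apply' {f : ℝ × ℝ → ℂ} (hf : ContDiff ℝ (⊤ : ℕ∞) f) (e : ℝ × ℝ) :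
    Continuous fun x => fderiv ℝ f x e :=
  (hf.continuous_fderiv (by simp)).clm_apply continuous_const

theorem hasFDerivAt_ofReal_mul {f : ℝ × ℝ → ℝ} {ψ : ℝ × ℝ → ℂ} (hf : ContDiff ℝ (⊤ : ℕ∞) f)
    (hψ : ContDiff ℝ (⊤ : ℕ∞) ψ) (x e : ℝ × ℝ) :
    fderiv ℝ (fun x => (f x : ℂ) * ψ x) x e =
      (f x : ℂ) * fderiv ℝ ψ x e + (fderiv ℝ f x e : ℂ) * ψ x := by
  have h1 : HasFDerivAt (fun x => (f x : ℂ)) (Complex.ofRealCLM.comp (fderiv ℝ f x)) x :=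
    Complex.ofRealCLM.hasFDerivAt.comp x (hf.differentiable (by simp) x).hasFDerivAt
  have h2 : fderiv ℝ (fun x => (f x : ℂ) * ψ x) x = _ :=
    (h1.mul (hψ.differentiable (by simp) x).hasFDerivAt).fderiv
  rw [h2]
  simp [mul_comm]

theorem tsupport_mul_subset_inter {f g : ℝ × ℝ → ℂ} :
    (tsupport fun x => f x * g x) ⊆ tsupport f ∩ tsupport g :=
  subset_inter (closure_mono fun _ hx => left_ne_zero_of_mul hx)
    (closure_mono fun _ hx => right_ne_zero_of_mul hx)

theorem tsupport_ofReal {f : ℝ × ℝ → ℝ} : (tsupport fun x => (f x : ℂ)) = tsupport f := by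
  have : (Function.support fun x => (f x : ℂ)) = Function.support f := by ext; simp
  rw [tsupport, tsupport, this]

theorem tsupport_fderiv_ofReal_subset {f : ℝ × ℝ → ℝ} (e : ℝ × ℝ) :
    (tsupport fun x => (fderiv ℝ f x e : ℂ)) ⊆ tsupport f := by
  rw [tsupport_ofReal (f := fun x => fderiv ℝ f x e)]
  exact tsupport_fderiv_apply_subset ℝ e

/-- The product rule for weak derivatives.  The sets `O` and `A` may differ: the factor `f` can
be used to extend the integration by parts formula from `O` to `A`. -/
theorem IsWeakDerivIn.smooth_mul {D : Polygon} {O A : Set (ℝ × ℝ)} (hO : O ⊆ {x | 0 < x.1})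
    {e : ℝ × ℝ} {u g : ℝ × ℝ → ℂ} (hu : MemLp u 2 (wt D.ω 1)) (hg : MemLp g 2 (wt D.ω 1))
    (h : IsWeakDerivIn D.ω O e u g) {f : ℝ × ℝ → ℝ} (hf : ContDiff ℝ (⊤ : ℕ∞) f)
    (hA : tsupport f ∩ A ⊆ O) :
    IsWeakDerivIn D.ω A e (fun x => (f x : ℂ) * u x)
      (fun x => (f x : ℂ) * g x + (fderiv ℝ f x e : ℂ) * u x) := by
  intro ψ hψ
  have hsub : tsupport f ∩ tsupport ψ ⊆ O := (inter_subset_inter_right _ hψ.supp).trans hA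
  have key : ∀ a b : ℝ × ℝ → ℂ, Continuous a → Continuous b → tsupport a ⊆ tsupport f →
      tsupport b ⊆ tsupport ψ → Continuous (fun x => a x * b x) ∧
      HasCompactSupport (fun x => a x * b x) ∧ (tsupport fun x => a x * b x) ⊆ O := by
    intro a b ha hb hat hbt
    have h1 := (tsupport_mul_subset_inter (f := a) (g := b)).trans (inter_subset_inter hat hbt)
    exact ⟨ha.mul hb, hψ.compact.of_isClosed_subset (isClosed_tsupport _)
      (h1.trans inter_subset_right), h1.trans hsub⟩
  have hfc : Continuous fun x => (f x : ℂ) := (ofReal_contDiff hf).continuous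
  have hfe : Continuous fun x => (fderiv ℝ f x e : ℂ) :=
    Complex.continuous_ofReal.comp (continuous_fderiv_apply hf e)
  obtain ⟨k1, k2, k3⟩ := key _ _ hfc (continuous_fderiv_apply' hψ.smooth e) tsupport_ofReal.subset
    (tsupport_fderiv_apply_subset ℝ e)
  obtain ⟨l1, l2, l3⟩ := key _ _ hfe hψ.smooth.continuous (tsupport_fderiv_ofReal_subset e)
    subset_rfl
  obtain ⟨m1, m2, m3⟩ := key _ _ hfc hψ.smooth.continuous tsupport_ofReal.subset subset_rfl
  have i1 := integrableOn_mul_of_tsupport D hu k1 k2 (k3.trans hO)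
  have i2 := integrableOn_mul_of_tsupport D hu l1 l2 (l3.trans hO)
  have i3 := integrableOn_mul_of_tsupport D hg m1 m2 (m3.trans hO)
  have h1 := h _ ⟨(ofReal_contDiff hf).mul hψ.smooth, m2, m3⟩
  simp only [hasFDerivAt_ofReal_mul hf hψ.smooth, mul_add] at h1
  rw [integral_add i1 i2] at h1
  have h2 : ∫ x in D.ω, (f x : ℂ) * u x * fderiv ℝ ψ x e =
      ∫ x in D.ω, u x * ((f x : ℂ) * fderiv ℝ ψ x e) := by
    congr 1; ext x; ring
  have h3 : ∫ x in D.ω, ((f x : ℂ) * g x + (fderiv ℝ f x e : ℂ) * u x) * ψ x =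
      (∫ x in D.ω, g x * ((f x : ℂ) * ψ x)) + ∫ x in D.ω, u x * ((fderiv ℝ f x e : ℂ) * ψ x) := by
    rw [← integral_add i3 i2]
    congr 1; ext x; ring
  rw [h2, h3, eq_sub_of_add_eq h1]
  ring

theorem IsCutoff.integrable_indicator {D : Polygon} {f : ℝ × ℝ → ℂ} {u : ℝ × ℝ → ℂ}
    (hu : MemLp u 2 (wt D.ω 1)) (hf : Continuous f) (hc : HasCompactSupport f)
    (hs : tsupport f ⊆ {x | 0 < x.1}) : Integrable (D.ω.indicator fun x => f x * u x) := by
  rw [integrable_indicator_iff D.measurableSet]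
  exact (integrableOn_mul_of_tsupport D hu hf hc hs).congr
    (Eventually.of_forall fun x => mul_comm _ _)

/-- The chain rule for the weak derivatives of `IsWeakDerivIn`.  After localization with a cut-off
function, `u` and `g` extended by zero are integrable on the plane, which is the case of
`IsWeakDeriv.comp_univ`; the condition `G 0 = 0` makes `G ∘ u` compatible with this extension. -/
theorem IsWeakDerivIn.comp {D : Polygon} {O : Set (ℝ × ℝ)} (hOo : IsOpen O)
    (hO : O ⊆ {x | 0 < x.1}) {e : ℝ × ℝ} {u g : ℝ × ℝ → ℂ} (hu : MemLp u 2 (wt D.ω 1))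
    (hg : MemLp g 2 (wt D.ω 1)) (h : IsWeakDerivIn D.ω O e u g) {G : ℂ → ℂ} (hG : ContDiff ℝ 1 G)
    {B C : ℝ} (hB : ∀ z, ‖G z‖ ≤ B) (hC : ∀ z, ‖fderiv ℝ G z‖ ≤ C) (hG0 : G 0 = 0) :
    IsWeakDerivIn D.ω O e (fun x => G (u x)) (fun x => fderiv ℝ G (u x) (g x)) := by
  intro φ hφ
  obtain ⟨χ, hχ, hχ1⟩ := exists_isCutoff hOo hφ.compact.isCompact hφ.supp
  -- multiplication by `χ` extends the formula from `O` to the whole plane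
  have hw := h.smooth_mul hO hu hg hχ.smooth (A := univ) (by simpa using hχ.supp)
  set V := D.ω.indicator fun x => (χ x : ℂ) * u x with hVdef
  set k := D.ω.indicator fun x => (χ x : ℂ) * g x + (fderiv ℝ χ x e : ℂ) * u x with hkdef
  have hχc : HasCompactSupport fun x => (χ x : ℂ) := by
    rw [HasCompactSupport, tsupport_ofReal]; exact hχ.compact
  have hχs : (tsupport fun x => (χ x : ℂ)) ⊆ {x | 0 < x.1} := by
    rw [tsupport_ofReal]; exact hχ.supp.trans hO
  have hVi : Integrable V :=
    IsCutoff.integrable_indicator hu (ofReal_contDiff hχ.smooth).continuous hχc hχs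
  have hki : Integrable k := by
    have h1 := IsCutoff.integrable_indicator hg (ofReal_contDiff hχ.smooth).continuous hχc hχs
    have h2 := IsCutoff.integrable_indicator hu
      (Complex.continuous_ofReal.comp (continuous_fderiv_apply hχ.smooth e))
      (hχ.compact.of_isClosed_subset (isClosed_tsupport _) (tsupport_fderiv_ofReal_subset e))
      ((tsupport_fderiv_ofReal_subset e).trans (hχ.supp.trans hO))
    refine (h1.add h2).congr (Eventually.of_forall fun x => ?_)
    rw [hkdef, Pi.add_apply]
    by_cases hx : x ∈ D.ω <;> simp [hx]
  have hVk : IsWeakDeriv univ e V k := by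
    intro ψ hψ
    have h1 := hw ψ hψ
    rw [← integral_indicator D.measurableSet, ← integral_indicator D.measurableSet] at h1
    simp only [setIntegral_univ]
    refine Eq.trans ?_ (h1.trans ?_)
    · congr 1; ext x; by_cases hx : x ∈ D.ω <;> simp [hx, hVdef]
    · congr 2; ext x; by_cases hx : x ∈ D.ω <;> simp [hx, hkdef]
  have h2 := hVk.comp_univ hVi hki hG hB hC φ
    ⟨hφ.smooth, hφ.compact, subset_univ _⟩
  simp only [setIntegral_univ] at h2
  have hv : ∀ x ∈ tsupport φ, x ∈ D.ω → V x = u x ∧ k x = g x := by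
    intro x hx hxω
    have h3 := (hχ1 x hx).self_of_nhds
    have h4 : fderiv ℝ χ x = 0 := by
      rw [(hχ1 x hx).fderiv_eq]
      exact fderiv_const_apply _
    simp [hVdef, hkdef, hxω, h3, h4]
  rw [← integral_indicator D.measurableSet, ← integral_indicator D.measurableSet]
  refine Eq.trans ?_ (h2.trans ?_)
  · congr 1; ext x
    by_cases hx : x ∈ D.ω
    · by_cases hxφ : x ∈ tsupport φ
      · simp [hx, (hv x hxφ hx).1]
      · have : fderiv ℝ φ x e = 0 :=
          image_eq_zero_of_notMem_tsupport (f := fun x => fderiv ℝ φ x e)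
            fun hn => hxφ (tsupport_fderiv_apply_subset ℝ e hn)
        simp [hx, this]
    · simp [hx, hVdef, hG0]
  · congr 2; ext x
    by_cases hx : x ∈ D.ω
    · by_cases hxφ : x ∈ tsupport φ
      · simp [hx, (hv x hxφ hx).1, (hv x hxφ hx).2]
      · simp [hx, image_eq_zero_of_notMem_tsupport hxφ]
    · simp [hx, hkdef]

/-! ### Triples of functions and their pairing -/

/-- The bilinear pairing `∬ (w₀ u₀ + w₁ u₁ + w₂ u₂) r dr dz` of triples of functions. -/
def pairing (D : Polygon) (w u : Fin 3 → ℝ × ℝ → ℂ) : ℂ := ∫ x, ∑ i, w i x * u i x ∂(wt D.ω 1)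

/-- All three functions are in `L²_1(ω)`. -/
def MemL2 (D : Polygon) (u : Fin 3 → ℝ × ℝ → ℂ) : Prop := ∀ i, MemLp (u i) 2 (wt D.ω 1)

/-- The coordinate direction that belongs to the index `i` of a triple `(u, ∂_r u, ∂_z u)`. -/
def dir (i : Fin 2) : ℝ × ℝ := ![(1, 0), (0, 1)] i

/-- The triple is `(u, ∂_r u, ∂_z u)` with the weak derivatives of `IsWeakDerivIn`. -/
def IsGradIn (D : Polygon) (O : Set (ℝ × ℝ)) (u : Fin 3 → ℝ × ℝ → ℂ) : Prop :=
  ∀ i : Fin 2, IsWeakDerivIn D.ω O (dir i) (u 0) (u i.succ)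

/-- The triple `(φ, ∂_r φ, ∂_z φ)` of a smooth function. -/
def gradOf (φ : ℝ × ℝ → ℂ) : Fin 3 → ℝ × ℝ → ℂ :=
  Fin.cons φ fun i x => fderiv ℝ φ x (dir i)

/-- The triple `(f u, ∂_r (f u), ∂_z (f u))` computed by the product rule. -/
def mulGrad (f : ℝ × ℝ → ℝ) (u : Fin 3 → ℝ × ℝ → ℂ) : Fin 3 → ℝ × ℝ → ℂ :=
  Fin.cons (fun x => (f x : ℂ) * u 0 x)
    fun i x => (f x : ℂ) * u i.succ x + (fderiv ℝ f x (dir i) : ℂ) * u 0 x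

/-- The triple `(G(u), ∂_r G(u), ∂_z G(u))` computed by the chain rule. -/
def compGrad (G : ℂ → ℂ) (u : Fin 3 → ℝ × ℝ → ℂ) : Fin 3 → ℝ × ℝ → ℂ :=
  Fin.cons (fun x => G (u 0 x)) fun i x => fderiv ℝ G (u 0 x) (u i.succ x)

theorem MemL2.integrable_mul {D : Polygon} {w u : Fin 3 → ℝ × ℝ → ℂ} (hw : MemL2 D w)
    (hu : MemL2 D u) (i : Fin 3) : Integrable (fun x => w i x * u i x) (wt D.ω 1) :=
  (hw i).integrable_mul (hu i)

theorem pairing_eq_sum {D : Polygon} {w u : Fin 3 → ℝ × ℝ → ℂ} (hw : MemL2 D w)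
    (hu : MemL2 D u) : pairing D w u = ∑ i, ∫ x, w i x * u i x ∂(wt D.ω 1) :=
  integral_finsetSum _ fun i _ => hw.integrable_mul hu i

theorem pairing_congr {D : Polygon} {w u u' : Fin 3 → ℝ × ℝ → ℂ}
    (h : ∀ i, ∀ x ∈ D.ω, u i x = u' i x) : pairing D w u = pairing D w u' := by
  refine integral_congr_ae (ae_wt_of_forall_mem D 1 fun x hx => ?_)
  simp only [h _ x hx]

theorem pairing_eq_sum_volume {D : Polygon} {w u : Fin 3 → ℝ × ℝ → ℂ}
    (hi : ∀ i, Integrable (fun x => w i x * u i x) (wt D.ω 1)) :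
    pairing D w u = ∑ i, ∫ x, (D.ω.indicator fun x => (x.1 : ℂ) * w i x) x * u i x := by
  rw [pairing, integral_finsetSum _ fun i _ => hi i]
  refine Finset.sum_congr rfl fun i _ => ?_
  rw [integral_wt_one, ← integral_indicator D.measurableSet]
  congr 1; ext x
  by_cases hx : x ∈ D.ω <;> simp [hx, mul_assoc]

theorem integrable_of_continuous (D : Polygon) {E : Type*} [NormedAddCommGroup E] {f : ℝ × ℝ → E}
    (hf : Continuous f) : Integrable f (wt D.ω 1) := by
  have := isFiniteMeasure_wt_one D
  obtain ⟨C, hC⟩ := D.isBounded.isCompact_closure.exists_bound_of_continuousOn hf.continuousOn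
  exact Integrable.of_bound hf.aestronglyMeasurable C
    (ae_wt_of_forall_mem D 1 fun x hx => hC x (subset_closure hx))

theorem memLp_of_continuous (D : Polygon) {f : ℝ × ℝ → ℂ} (hf : Continuous f) :
    MemLp f 2 (wt D.ω 1) := by
  rw [memLp_two_iff_integrable_sq_norm hf.aestronglyMeasurable]
  exact integrable_of_continuous D (by fun_prop)

theorem memL2_gradOf (D : Polygon) {φ : ℝ × ℝ → ℂ} (hφ : ContDiff ℝ (⊤ : ℕ∞) φ) :
    MemL2 D (gradOf φ) := by
  intro i
  refine Fin.cases ?_ (fun j => ?_) i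
  · exact memLp_of_continuous D hφ.continuous
  · exact memLp_of_continuous D (continuous_fderiv_apply' hφ (dir j))

theorem memLp_continuous_mul (D : Polygon) {f u : ℝ × ℝ → ℂ} (hf : Continuous f)
    (hu : MemLp u 2 (wt D.ω 1)) : MemLp (fun x => f x * u x) 2 (wt D.ω 1) := by
  obtain ⟨C, hC⟩ := D.isBounded.isCompact_closure.exists_bound_of_continuousOn hf.continuousOn
  exact MemLp.continuous_mul hu hf fun x hx => hC x (subset_closure hx)

theorem MemL2.mulGrad {D : Polygon} {u : Fin 3 → ℝ × ℝ → ℂ} (hu : MemL2 D u) {f : ℝ × ℝ → ℝ}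
    (hf : ContDiff ℝ (⊤ : ℕ∞) f) : MemL2 D (mulGrad f u) := by
  intro i
  have h1 : ∀ i, MemLp (fun x => (f x : ℂ) * u i x) 2 (wt D.ω 1) := fun i =>
    memLp_continuous_mul D (ofReal_contDiff hf).continuous (hu i)
  refine Fin.cases ?_ (fun j => ?_) i
  · exact h1 0
  · exact (h1 j.succ).add (memLp_continuous_mul D
      (Complex.continuous_ofReal.comp (continuous_fderiv_apply hf (dir j))) (hu 0))

theorem IsGradIn.mulGrad {D : Polygon} {O : Set (ℝ × ℝ)} (hO : O ⊆ {x | 0 < x.1})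
    {u : Fin 3 → ℝ × ℝ → ℂ} (hu : MemL2 D u) (h : IsGradIn D O u) {f : ℝ × ℝ → ℝ}
    (hf : ContDiff ℝ (⊤ : ℕ∞) f) : IsGradIn D O (mulGrad f u) := fun i =>
  (h i).smooth_mul hO (hu 0) (hu i.succ) hf inter_subset_right

/-- If a triple pairs to zero with the gradients of a class of smooth functions, and if the
localization `f u` of a weak gradient triple can be mollified within this class, then the triple
pairs to zero with `f u`.  The kernels are supported in the half-plane `ℓ > 0`. -/
theorem pairing_mulGrad_eq_zero_of_mollify {D : Polygon} {O : Set (ℝ × ℝ)}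
    (hO : O ⊆ {x | 0 < x.1}) {w : Fin 3 → ℝ × ℝ → ℂ} (hw : MemL2 D w) {𝒟 : Set (ℝ × ℝ → ℂ)}
    (hw0 : ∀ φ ∈ 𝒟, pairing D w (gradOf φ) = 0) {f χ : ℝ × ℝ → ℝ} (hf : IsCutoff {x | 0 < x.1} f)
    (hχ : ∀ y ∈ tsupport f, χ =ᶠ[𝓝 y] 1)
    {ℓ : ℝ × ℝ →L[ℝ] ℝ} {v : ℝ × ℝ} (hv : 0 < ℓ v) {δ₀ : ℝ} (hδ₀ : 0 < δ₀)
    (hT : ∀ κ, IsMollifier κ δ₀ → (∀ s ∈ tsupport κ, 0 < ℓ s) → ∀ x ∈ D.ω,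
      IsTest O (fun y => ((κ (x - y) * χ y : ℝ) : ℂ)))
    (hD : ∀ κ, IsMollifier κ δ₀ → (∀ s ∈ tsupport κ, 0 < ℓ s) → ∀ φ : ℝ × ℝ → ℂ,
      ContDiff ℝ (⊤ : ℕ∞) φ → HasCompactSupport φ →
      (∀ x ∈ tsupport φ, ∃ s ∈ tsupport κ, ∃ y ∈ tsupport f ∩ closure D.ω, x = s + y) → φ ∈ 𝒟)
    {u : Fin 3 → ℝ × ℝ → ℂ} (hu : MemL2 D u) (h : IsGradIn D O u) :
    pairing D w (mulGrad f u) = 0 := by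
  have hm := hu.mulGrad hf.smooth
  have hg := h.mulGrad hO hu hf.smooth
  -- extension by zero; the weight `r` is moved to `w`, so that `W` and `U` are both in `L²`
  set U : Fin 3 → ℝ × ℝ → ℂ := fun i => D.ω.indicator (mulGrad f u i) with hUdef
  set W : Fin 3 → ℝ × ℝ → ℂ := fun i => D.ω.indicator fun x => (x.1 : ℂ) * w i x with hWdef
  have hW2 : ∀ i, MemLp (W i) 2 volume := fun i => memLp_two_indicator_fst_mul D (hw i)
  have hfc : HasCompactSupport fun x => (f x : ℂ) := by
    rw [HasCompactSupport, tsupport_ofReal]; exact hf.compact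
  have hfs : (tsupport fun x => (f x : ℂ)) ⊆ {x | 0 < x.1} := by
    rw [tsupport_ofReal]; exact hf.supp
  have hfec : ∀ e, HasCompactSupport fun x => (fderiv ℝ f x e : ℂ) := fun e =>
    hf.compact.of_isClosed_subset (isClosed_tsupport _) (tsupport_fderiv_ofReal_subset e)
  have hfes : ∀ e, (tsupport fun x => (fderiv ℝ f x e : ℂ)) ⊆ {x | 0 < x.1} := fun e =>
    (tsupport_fderiv_ofReal_subset e).trans hf.supp
  have hfcont := (ofReal_contDiff hf.smooth).continuous
  have hfecont : ∀ e, Continuous fun x => (fderiv ℝ f x e : ℂ) := fun e =>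
    Complex.continuous_ofReal.comp (continuous_fderiv_apply hf.smooth e)
  have hUs : ∀ i : Fin 2, U i.succ = (D.ω.indicator fun x => (f x : ℂ) * u i.succ x) +
      D.ω.indicator fun x => (fderiv ℝ f x (dir i) : ℂ) * u 0 x := by
    intro i
    ext x
    by_cases hx : x ∈ D.ω <;> simp [hUdef, hx, mulGrad]
  have hU2 : ∀ i, MemLp (U i) 2 volume := by
    intro i
    refine Fin.cases ?_ (fun j => ?_) i
    · exact memLp_two_indicator_of_tsupport D (hu 0) hfcont hfc hfs
    · rw [hUs]
      exact (memLp_two_indicator_of_tsupport D (hu j.succ) hfcont hfc hfs).add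
        (memLp_two_indicator_of_tsupport D (hu 0) (hfecont _) (hfec _) (hfes _))
  have hU1 : ∀ i, Integrable (U i) := by
    intro i
    refine Fin.cases ?_ (fun j => ?_) i
    · exact IsCutoff.integrable_indicator (hu 0) hfcont hfc hfs
    · rw [hUs]
      exact (IsCutoff.integrable_indicator (hu j.succ) hfcont hfc hfs).add
        (IsCutoff.integrable_indicator (hu 0) (hfecont _) (hfec _) (hfes _))
  have hUsupp : ∀ i y, U i y ≠ 0 → y ∈ tsupport f ∧ y ∈ D.ω := by
    intro i y hy
    have hyω : y ∈ D.ω := by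
      by_contra hn
      exact hy (by simp [hUdef, hn])
    refine ⟨?_, hyω⟩
    by_contra hn
    apply hy
    have h1 : f y = 0 := image_eq_zero_of_notMem_tsupport hn
    have h2 : ∀ e, fderiv ℝ f y e = 0 := fun e =>
      image_eq_zero_of_notMem_tsupport (f := fun x => fderiv ℝ f x e)
        fun hn' => hn (tsupport_fderiv_apply_subset ℝ e hn')
    refine Fin.cases ?_ (fun j => ?_) i <;> simp [hUdef, hyω, mulGrad, h1, h2]
  have hsum : pairing D w (mulGrad f u) = ∑ i, ∫ x, W i x * U i x := by
    rw [pairing_eq_sum_volume fun i => hw.integrable_mul hm i]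
    refine Finset.sum_congr rfl fun i _ => ?_
    congr 1; ext x
    by_cases hx : x ∈ D.ω <;> simp [hWdef, hUdef, hx]
  rw [← norm_eq_zero]
  refine le_antisymm (le_of_forall_pos_le_add fun ε hε => ?_) (norm_nonneg _)
  have hε3 : 0 < ε / 3 := by positivity
  choose δ hδ hδ' using fun i => exists_forall_norm_integral_mul_conv_sub_le (hW2 i) (hU2 i) hε3
  have hmin : 0 < min δ₀ (min (δ 0) (min (δ 1) (δ 2))) := by
    simp only [lt_min_iff]; exact ⟨hδ₀, hδ 0, hδ 1, hδ 2⟩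
  obtain ⟨κ, hκ, hκℓ⟩ := exists_isMollifier ℓ hv hmin
  have hκ' : ∀ ρ, min δ₀ (min (δ 0) (min (δ 1) (δ 2))) ≤ ρ → IsMollifier κ ρ := fun ρ hρ =>
    { hκ with supp := hκ.supp.trans (Metric.ball_subset_ball hρ) }
  have hκ0 : IsMollifier κ δ₀ := hκ' _ (min_le_left _ _)
  have hκi : ∀ i, IsMollifier κ (δ i) := fun i => hκ' _ (by fin_cases i <;> simp)
  -- the mollified function belongs to the class `𝒟`
  have hφ : ContDiff ℝ (⊤ : ℕ∞) (conv κ (U 0)) := hκ.contDiff_conv (hU1 0).locallyIntegrable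
  have hcomp : IsCompact (tsupport κ + tsupport f ∩ closure D.ω) :=
    hκ.compact.isCompact.add (hf.compact.isCompact.inter_right isClosed_closure)
  have hsub : tsupport (conv κ (U 0)) ⊆ tsupport κ + tsupport f ∩ closure D.ω := by
    refine closure_minimal ?_ hcomp.isClosed
    refine (support_convolution_subset _).trans (Set.add_subset_add subset_closure ?_)
    intro y hy
    exact ⟨(hUsupp 0 y hy).1, subset_closure (hUsupp 0 y hy).2⟩
  have hφc : HasCompactSupport (conv κ (U 0)) :=
    hcomp.of_isClosed_subset (isClosed_tsupport _) hsub
  have hφD : conv κ (U 0) ∈ 𝒟 := by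
    refine hD κ hκ0 hκℓ _ hφ hφc fun x hx => ?_
    obtain ⟨s, hs, y, hy, rfl⟩ := hsub hx
    exact ⟨s, hs, y, hy, rfl⟩
  -- at points of `ω`, the gradient of the mollification is the mollification of the weak gradient,
  -- because `y ↦ κ (x - y) χ y` is admissible in the integration by parts formula
  have hgrad : ∀ i, ∀ x ∈ D.ω, gradOf (conv κ (U 0)) i x = conv κ (U i) x := by
    intro i x hx
    refine Fin.cases rfl (fun j => ?_) i
    refine fderiv_conv_eq_conv hκ (hU1 0).locallyIntegrable (χ := χ) (fun y hy => ?_) ?_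
    · exact hχ y (hy.elim (fun hy => (hUsupp 0 y hy).1) fun hy => (hUsupp _ y hy).1)
    · have := hg j _ (hT κ hκ0 hκℓ x hx)
      rw [← integral_indicator D.measurableSet, ← integral_indicator D.measurableSet] at this
      refine Eq.trans ?_ (this.trans ?_)
      · congr 1; ext y; by_cases hy : y ∈ D.ω <;> simp [hy, hUdef]
      · congr 2; ext y; by_cases hy : y ∈ D.ω <;> simp [hy, hUdef]
  have h0 : ∑ i, ∫ x, W i x * conv κ (U i) x = 0 := by
    rw [← hw0 _ hφD, pairing_eq_sum_volume fun i => hw.integrable_mul (memL2_gradOf D hφ) i]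
    refine Finset.sum_congr rfl fun i _ => ?_
    congr 1; ext x
    by_cases hx : x ∈ D.ω
    · rw [hgrad i x hx]
    · simp [hWdef, hx]
  rw [hsum, ← norm_neg, ← zero_sub, ← h0, ← Finset.sum_sub_distrib, zero_add]
  calc _ ≤ ∑ i : Fin 3, ‖(∫ x, W i x * conv κ (U i) x) - ∫ x, W i x * U i x‖ := norm_sum_le _ _
    _ ≤ ∑ _i : Fin 3, ε / 3 := Finset.sum_le_sum fun i _ => hδ' i κ (hκi i)
    _ = ε := by simp; ring

/-! ### Cutting off the axis and the vertices -/

/-- The open half-plane `r > 0` without the vertices of the polygon. -/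
def offVerts (D : Polygon) : Set (ℝ × ℝ) := {x | 0 < x.1 ∧ ∀ i, x ≠ D.P i}

theorem isOpen_offVerts (D : Polygon) : IsOpen (offVerts D) := by
  have : offVerts D = {x | 0 < x.1} ∩ (range D.P)ᶜ := by
    ext x
    simp only [offVerts, mem_ofPred_eq, mem_inter_iff, mem_compl_iff, mem_range, not_exists]
    exact and_congr_right fun _ =>
      forall_congr' fun i => ⟨fun h h' => h h'.symm, fun h h' => h h'.symm⟩
  rw [this]
  exact isOpen_halfPlane.inter (finite_range D.P).isClosed.isOpen_compl

theorem offVerts_subset (D : Polygon) : offVerts D ⊆ {x | 0 < x.1} := fun _ h => h.1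

theorem vertex_notMem (D : Polygon) (i : Fin (D.m + 3)) : D.P i ∉ D.ω := by
  have h : D.P i ∈ frontier D.ω := by
    rw [D.frontier_eq]
    exact mem_iUnion.mpr ⟨i, left_mem_segment ℝ _ _⟩
  rw [D.isOpen.frontier_eq] at h
  exact h.2

theorem subset_offVerts (D : Polygon) : D.ω ⊆ offVerts D := fun x hx =>
  ⟨D.pos x hx, fun i h => vertex_notMem D i (h ▸ hx)⟩

/-- Cut-off functions of uniformly bounded Dirichlet energy that exhaust `ω`. -/
structure IsCutSeq (D : Polygon) (θ : ℕ → ℝ × ℝ → ℝ) : Prop where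
  smooth : ∀ n, ContDiff ℝ (⊤ : ℕ∞) (θ n)
  abs_le : ∀ n x, |θ n x| ≤ 1
  eventually_one : ∀ x ∈ D.ω, ∀ᶠ n in atTop, θ n =ᶠ[𝓝 x] 1
  energy : ∀ e, ∃ C, ∀ n, ∫ x, (fderiv ℝ (θ n) x e) ^ 2 ∂(wt D.ω 1) ≤ C

theorem IsCutSeq.mul {D : Polygon} {θ η : ℕ → ℝ × ℝ → ℝ} (hθ : IsCutSeq D θ)
    (hη : IsCutSeq D η) : IsCutSeq D (fun n => θ n * η n) where
  smooth n := (hθ.smooth n).mul (hη.smooth n)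
  abs_le n x := by
    rw [Pi.mul_apply, abs_mul]
    exact mul_le_one₀ (hθ.abs_le n x) (abs_nonneg _) (hη.abs_le n x)
  eventually_one x hx := by
    filter_upwards [hθ.eventually_one x hx, hη.eventually_one x hx] with n h1 h2
    filter_upwards [h1, h2] with y h3 h4
    simp [h3, h4]
  energy e := by
    obtain ⟨C, hC⟩ := hθ.energy e
    obtain ⟨C', hC'⟩ := hη.energy e
    refine ⟨2 * C + 2 * C', fun n => ?_⟩
    have i1 : Integrable (fun x => (fderiv ℝ (θ n) x e) ^ 2) (wt D.ω 1) :=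
      integrable_of_continuous D ((continuous_fderiv_apply (hθ.smooth n) e).pow 2)
    have i2 : Integrable (fun x => (fderiv ℝ (η n) x e) ^ 2) (wt D.ω 1) :=
      integrable_of_continuous D ((continuous_fderiv_apply (hη.smooth n) e).pow 2)
    calc ∫ x, (fderiv ℝ (θ n * η n) x e) ^ 2 ∂(wt D.ω 1)
        ≤ ∫ x, (2 * (fderiv ℝ (θ n) x e) ^ 2 + 2 * (fderiv ℝ (η n) x e) ^ 2) ∂(wt D.ω 1) := by
          refine integral_mono (integrable_of_continuous D ((continuous_fderiv_apply
            ((hθ.smooth n).mul (hη.smooth n)) e).pow 2)) ((i1.const_mul 2).add (i2.const_mul 2))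
            fun x => ?_
          have h1 : fderiv ℝ (θ n * η n) x = θ n x • fderiv ℝ (η n) x + η n x • fderiv ℝ (θ n) x :=
            (((hθ.smooth n).differentiable (by simp) x).hasFDerivAt.mul
              ((hη.smooth n).differentiable (by simp) x).hasFDerivAt).fderiv
          have h2 := sq_le_one_iff_abs_le_one (θ n x) |>.mpr (hθ.abs_le n x)
          have h3 := sq_le_one_iff_abs_le_one (η n x) |>.mpr (hη.abs_le n x)
          simp only [h1, add_apply, smul_apply, smul_eq_mul]
          generalize fderiv ℝ (θ n) x e = a at *
          generalize fderiv ℝ (η n) x e = b at *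
          have h4 : θ n x ^ 2 * b ^ 2 ≤ 1 * b ^ 2 := by gcongr
          have h5 : η n x ^ 2 * a ^ 2 ≤ 1 * a ^ 2 := by gcongr
          nlinarith [sq_nonneg (θ n x * b - η n x * a)]
      _ = 2 * (∫ x, (fderiv ℝ (θ n) x e) ^ 2 ∂(wt D.ω 1)) +
          2 * ∫ x, (fderiv ℝ (η n) x e) ^ 2 ∂(wt D.ω 1) := by
          rw [integral_add (i1.const_mul 2) (i2.const_mul 2), integral_const_mul,
            integral_const_mul]
      _ ≤ _ := by have := hC n; have := hC' n; linarith

theorem isCutSeq_one (D : Polygon) : IsCutSeq D (fun _ => 1) where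
  smooth n := contDiff_const
  abs_le n x := by simp
  eventually_one x hx := Eventually.of_forall fun _ => EventuallyEq.rfl
  energy e := ⟨0, fun n => by
    have : ∀ x, fderiv ℝ (1 : ℝ × ℝ → ℝ) x = 0 := fun x => fderiv_const_apply _
    simp [this]⟩

/-- A bound for the energy of functions whose gradients are of size `n + 1` on sets of measure
`(n + 1)⁻²`. -/
theorem integral_sq_le_of_subset {D : Polygon} {g : ℝ × ℝ → ℝ} {n : ℕ} {M C : ℝ} (hC : 0 ≤ C)
    {S : Set (ℝ × ℝ)}
    (hS : MeasurableSet S) (hg : ∀ x ∈ D.ω, |g x| ≤ (n + 1) * M) (hg0 : ∀ x ∈ D.ω, x ∉ S → g x = 0)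
    (hvol : wt D.ω 1 S ≤ ENNReal.ofReal (C / ((n : ℝ) + 1) ^ 2)) :
    ∫ x, g x ^ 2 ∂(wt D.ω 1) ≤ M ^ 2 * C := by
  have hn : (0 : ℝ) < n + 1 := by positivity
  have h1 : ∫ x, g x ^ 2 ∂(wt D.ω 1) ≤ ∫ x, S.indicator (fun _ => (((n : ℝ) + 1) * M) ^ 2) x
      ∂(wt D.ω 1) := by
    refine integral_mono_of_nonneg (Eventually.of_forall fun x => sq_nonneg _) ?_
      (ae_wt_of_forall_mem D 1 fun x hx => ?_)
    · have := isFiniteMeasure_wt_one D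
      exact (integrable_const _).indicator hS
    · by_cases hxS : x ∈ S
      · simp only [hxS, indicator_of_mem]
        exact sq_le_sq' (by linarith [(abs_le.mp (hg x hx)).1]) (abs_le.mp (hg x hx)).2
      · simp [hxS, hg0 x hx hxS]
  refine h1.trans ?_
  rw [integral_indicator_const _ hS, smul_eq_mul]
  have h2 : (wt D.ω 1).real S ≤ C / ((n : ℝ) + 1) ^ 2 :=
    ENNReal.toReal_le_of_le_ofReal (by positivity) hvol
  calc _ ≤ C / ((n : ℝ) + 1) ^ 2 * (((n : ℝ) + 1) * M) ^ 2 := by gcongr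
    _ = M ^ 2 * C := by field_simp

theorem wt_one_le {D : Polygon} {S : Set (ℝ × ℝ)} (hS : MeasurableSet S) {ρ : ℝ}
    (h : ∀ x ∈ S ∩ D.ω, x.1 ≤ ρ) {T : Set (ℝ × ℝ)} (hT : S ∩ D.ω ⊆ T) :
    wt D.ω 1 S ≤ ENNReal.ofReal ρ * volume T := by
  rw [wt, withDensity_apply _ hS, Measure.restrict_restrict hS]
  calc _ ≤ ∫⁻ _ in S ∩ D.ω, ENNReal.ofReal ρ := by
        refine setLIntegral_mono' (hS.inter D.measurableSet) fun x hx => ?_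
        rw [Real.rpow_one]
        exact ENNReal.ofReal_le_ofReal (h x hx)
    _ ≤ _ := by
        rw [setLIntegral_const]
        gcongr

/-- Cut-off functions of bounded energy that vanish near a point.  Rescalings of one bump function
suffice, since the Dirichlet integral is invariant under scaling in two dimensions. -/
theorem exists_isCutSeq_point (D : Polygon) {p : ℝ × ℝ} (hp : p ∉ D.ω) :
    ∃ θ, IsCutSeq D θ ∧ ∀ n, θ n =ᶠ[𝓝 p] 0 := by
  let b : ContDiffBump (0 : ℝ × ℝ) := ⟨1, 2, one_pos, one_lt_two⟩
  have hbs : ContDiff ℝ (⊤ : ℕ∞) b := b.contDiff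
  let θ : ℕ → ℝ × ℝ → ℝ := fun n x => 1 - b (((n : ℝ) + 1) • (x - p))
  have hd : ∀ n x, HasFDerivAt (θ n)
      (-((fderiv ℝ b (((n : ℝ) + 1) • (x - p))).comp
        (((n : ℝ) + 1) • ContinuousLinearMap.id ℝ (ℝ × ℝ)))) x := by
    intro n x
    have h1 : HasFDerivAt (fun x : ℝ × ℝ => ((n : ℝ) + 1) • (x - p))
        (((n : ℝ) + 1) • ContinuousLinearMap.id ℝ (ℝ × ℝ)) x :=
      ((hasFDerivAt_id x).sub_const p).const_smul ((n : ℝ) + 1)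
    have h2 : HasFDerivAt b (fderiv ℝ b (((n : ℝ) + 1) • (x - p))) (((n : ℝ) + 1) • (x - p)) :=
      (hbs.differentiable (by simp) _).hasFDerivAt
    exact (h2.comp x h1).const_sub 1
  have hb0 : ∀ y : ℝ × ℝ, 2 < ‖y‖ → b =ᶠ[𝓝 y] 0 := by
    intro y hy
    rw [← notMem_tsupport_iff_eventuallyEq, b.tsupport_eq]
    simpa [b] using hy
  refine ⟨θ, ⟨fun n => ?_, fun n x => ?_, fun x hx => ?_, fun e => ?_⟩, fun n => ?_⟩
  · exact contDiff_const.sub (hbs.comp ((contDiff_id.sub contDiff_const).const_smul _))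
  · have h1 : 0 ≤ b (((n : ℝ) + 1) • (x - p)) := b.nonneg
    have h2 : b (((n : ℝ) + 1) • (x - p)) ≤ 1 := b.le_one
    rw [abs_le]; constructor <;> simp only [θ] <;> linarith
  · have hxp : 0 < ‖x - p‖ := by
      rw [norm_pos_iff, sub_ne_zero]; rintro rfl; exact hp hx
    obtain ⟨N, hN⟩ := exists_nat_gt (2 / ‖x - p‖)
    filter_upwards [eventually_ge_atTop N] with n hn
    have h1 : 2 < ‖((n : ℝ) + 1) • (x - p)‖ := by
      rw [norm_smul, Real.norm_of_nonneg (by positivity)]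
      rw [div_lt_iff₀ hxp] at hN
      have : (N : ℝ) ≤ n := by exact_mod_cast hn
      nlinarith
    have h2 : ContinuousAt (fun y : ℝ × ℝ => ((n : ℝ) + 1) • (y - p)) x := by fun_prop
    filter_upwards [h2.eventually (hb0 _ h1)] with y hy
    simp [θ, hy]
  · obtain ⟨M, hM⟩ := (b.hasCompactSupport.fderiv_apply ℝ e).exists_bound_of_continuous
      (continuous_fderiv_apply hbs e)
    obtain ⟨R, hR⟩ := D.isBounded.exists_norm_le
    have hR0 : 0 ≤ R := by
      obtain ⟨x, hx⟩ := D.isConnected.nonempty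
      exact (norm_nonneg x).trans (hR x hx)
    refine ⟨M ^ 2 * (R * 16), fun n => ?_⟩
    have hn : (0 : ℝ) < n + 1 := by positivity
    refine integral_sq_le_of_subset (n := n) (S := Metric.closedBall p (2 / (n + 1)))
      (by positivity) Metric.isClosed_closedBall.measurableSet (fun x hx => ?_)
      (fun x hx hxS => ?_) ?_
    · rw [(hd n x).fderiv]
      simp only [neg_apply, ContinuousLinearMap.comp_smul,
        ContinuousLinearMap.comp_id, smul_apply, smul_eq_mul, abs_neg, abs_mul,
        abs_of_pos hn]
      exact mul_le_mul_of_nonneg_left (hM _) hn.le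
    · have h1 : b =ᶠ[𝓝 (((n : ℝ) + 1) • (x - p))] 0 := by
        refine hb0 _ ?_
        rw [Metric.mem_closedBall, not_le, dist_eq_norm, div_lt_iff₀ hn] at hxS
        rw [norm_smul, Real.norm_of_nonneg hn.le]
        linarith
      rw [(hd n x).fderiv, h1.fderiv_eq]
      simp
    · refine (wt_one_le Metric.isClosed_closedBall.measurableSet (ρ := R) (fun x hx => ?_)
        inter_subset_left).trans_eq ?_
      · exact ((le_abs_self _).trans (norm_fst_le x)).trans (hR x hx.2)
      · rw [← closedBall_prod_same, Measure.volume_eq_prod, Measure.prod_prod,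
          Real.volume_closedBall, Real.volume_closedBall, ← ENNReal.ofReal_mul (by positivity),
          ← ENNReal.ofReal_mul (by positivity)]
        congr 1
        field_simp
        norm_num
  · have h2 : ContinuousAt (fun y : ℝ × ℝ => ((n : ℝ) + 1) • (y - p)) p := by fun_prop
    have h3 : b =ᶠ[𝓝 (((n : ℝ) + 1) • (p - p))] 1 := by
      rw [sub_self, smul_zero]; exact b.eventuallyEq_one
    filter_upwards [h2.eventually h3] with y hy
    simp [θ, hy]

/-- Cut-off functions `η_n(r)` that vanish near the axis `r = 0`, with the scaling bound for their
derivatives. -/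
theorem exists_axis_cutoff : ∃ η : ℕ → ℝ → ℝ, ∃ M : ℝ, (∀ n, ContDiff ℝ (⊤ : ℕ∞) (η n)) ∧
    (∀ n r, 0 ≤ η n r ∧ η n r ≤ 1) ∧ (∀ (n : ℕ) (r : ℝ), 2 / ((n : ℝ) + 1) < r → η n =ᶠ[𝓝 r] 1) ∧
    (∀ (n : ℕ) (r : ℝ), |r| < 1 / ((n : ℝ) + 1) → η n r = 0) ∧
    (∀ n r, |deriv (η n) r| ≤ (n + 1) * M) := by
  let b : ContDiffBump (0 : ℝ) := ⟨1, 2, one_pos, one_lt_two⟩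
  have hbs : ContDiff ℝ (⊤ : ℕ∞) b := b.contDiff
  obtain ⟨M, hM⟩ := (b.hasCompactSupport.deriv).exists_bound_of_continuous
      (hbs.continuous_deriv (by simp))
  refine ⟨fun n r => 1 - b (((n : ℝ) + 1) * r), M, fun n => ?_, fun n r => ?_, fun n r hr => ?_,
    fun n r hr => ?_, fun n r => ?_⟩
  · exact contDiff_const.sub (hbs.comp (contDiff_const.mul contDiff_id))
  · have h1 : 0 ≤ b (((n : ℝ) + 1) * r) := b.nonneg
    have h2 : b (((n : ℝ) + 1) * r) ≤ 1 := b.le_one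
    constructor <;> linarith
  · have h1 : b =ᶠ[𝓝 (((n : ℝ) + 1) * r)] 0 := by
      rw [← notMem_tsupport_iff_eventuallyEq, b.tsupport_eq]
      rw [div_lt_iff₀ (by positivity)] at hr
      simp only [Metric.mem_closedBall, dist_zero_right, b, not_le, Real.norm_eq_abs]
      exact (by linarith : 2 < ((n : ℝ) + 1) * r).trans_le (le_abs_self _)
    have h2 : ContinuousAt (fun y : ℝ => ((n : ℝ) + 1) * y) r := by fun_prop
    filter_upwards [h2.eventually h1] with y hy
    simp [hy]
  · have h1 : b (((n : ℝ) + 1) * r) = 1 := by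
      refine b.one_of_mem_closedBall ?_
      rw [lt_div_iff₀ (by positivity)] at hr
      simp only [Metric.mem_closedBall, dist_zero_right, b, Real.norm_eq_abs, abs_mul]
      rw [abs_of_pos (by positivity)]
      linarith
    simp [h1]
  · have h1 : HasDerivAt (fun r => 1 - b (((n : ℝ) + 1) * r))
        (-(deriv b (((n : ℝ) + 1) * r) * ((n : ℝ) + 1))) r := by
      have h2 : HasDerivAt (fun r : ℝ => ((n : ℝ) + 1) * r) ((n : ℝ) + 1) r := by
        simpa using (hasDerivAt_id r).const_mul ((n : ℝ) + 1)
      exact (HasDerivAt.comp r (hbs.differentiable (by simp) _).hasDerivAt h2).const_sub 1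
    rw [h1.deriv, abs_neg, abs_mul, abs_of_pos (by positivity : (0 : ℝ) < n + 1), mul_comm]
    exact mul_le_mul_of_nonneg_left (hM _) (by positivity)

theorem fderiv_comp_fst {η : ℝ → ℝ} (hη : ContDiff ℝ (⊤ : ℕ∞) η) (x e : ℝ × ℝ) :
    fderiv ℝ (fun x : ℝ × ℝ => η x.1) x e = deriv η x.1 * e.1 := by
  have h : HasFDerivAt (fun x : ℝ × ℝ => η x.1)
      (deriv η x.1 • ContinuousLinearMap.fst ℝ ℝ ℝ) x :=
    (hη.differentiable (by simp) x.1).hasDerivAt.comp_hasFDerivAt x hasFDerivAt_fst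
  rw [h.fderiv]
  simp

/-- The axis can be cut off with bounded energy: the gradients are of size `n` on a strip whose area
is of order `1 / n`, where the weight `r` is of order `1 / n`. -/
theorem exists_isCutSeq_axis (D : Polygon) :
    ∃ θ, IsCutSeq D θ ∧ ∀ n x, x.1 = 0 → θ n =ᶠ[𝓝 x] 0 := by
  obtain ⟨η, M, hs, h01, h1, h0, hM⟩ := exists_axis_cutoff
  have hlim : ∀ r : ℝ, 0 < r → ∀ᶠ n : ℕ in atTop, 2 / ((n : ℝ) + 1) < r := by
    intro r hr
    have : Tendsto (fun n : ℕ => 2 * (1 / ((n : ℝ) + 1))) atTop (𝓝 (2 * 0)) :=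
      tendsto_one_div_add_atTop_nhds_zero_nat.const_mul 2
    rw [mul_zero] at this
    filter_upwards [this.eventually (gt_mem_nhds hr)] with n hn
    rwa [mul_one_div] at hn
  refine ⟨fun n x => η n x.1, ⟨fun n => (hs n).comp contDiff_fst, fun n x => ?_, fun x hx => ?_,
    fun e => ?_⟩, fun n x hx => ?_⟩
  · rw [abs_of_nonneg (h01 n _).1]; exact (h01 n _).2
  · filter_upwards [hlim x.1 (D.pos x hx)] with n hn
    exact continuousAt_fst.eventually (h1 n x.1 hn)
  · obtain ⟨R, hR⟩ := D.isBounded.exists_norm_le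
    have hR0 : 0 ≤ R := by
      obtain ⟨x, hx⟩ := D.isConnected.nonempty
      exact (norm_nonneg x).trans (hR x hx)
    refine ⟨(M * |e.1|) ^ 2 * (8 * R), fun n => ?_⟩
    have hn : (0 : ℝ) < n + 1 := by positivity
    have hSm : MeasurableSet {x : ℝ × ℝ | x.1 ≤ 2 / ((n : ℝ) + 1)} :=
      (isClosed_le continuous_fst continuous_const).measurableSet
    refine integral_sq_le_of_subset (n := n) (S := {x : ℝ × ℝ | x.1 ≤ 2 / ((n : ℝ) + 1)})
      (by positivity) hSm (fun x hx => ?_) (fun x hx hxS => ?_) ?_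
    · rw [fderiv_comp_fst (hs n), abs_mul, ← mul_assoc]
      exact mul_le_mul_of_nonneg_right (hM n _) (abs_nonneg _)
    · rw [fderiv_comp_fst (hs n), (h1 n x.1 (by simpa using hxS)).deriv_eq]
      have : deriv (1 : ℝ → ℝ) x.1 = 0 := deriv_const _ _
      rw [this, zero_mul]
    · refine (wt_one_le hSm (ρ := 2 / ((n : ℝ) + 1)) (fun x hx => hx.1)
        (T := Icc 0 (2 / ((n : ℝ) + 1)) ×ˢ Icc (-R) R) ?_).trans_eq ?_
      · intro x hx
        have := abs_le.mp ((norm_snd_le x).trans (hR x hx.2))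
        exact ⟨⟨(D.pos x hx.2).le, hx.1⟩, this⟩
      · rw [Measure.volume_eq_prod, Measure.prod_prod, Real.volume_Icc,
          Real.volume_Icc, ← ENNReal.ofReal_mul (by rw [sub_zero]; positivity),
          ← ENNReal.ofReal_mul (by positivity)]
        congr 1
        field_simp
        ring
  · have h3 : ∀ᶠ y : ℝ × ℝ in 𝓝 x, |y.1| < 1 / ((n : ℝ) + 1) := by
      have hc : Continuous fun y : ℝ × ℝ => |y.1| := by fun_prop
      refine hc.continuousAt.eventually_lt continuousAt_const ?_
      rw [hx, abs_zero]; positivity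
    filter_upwards [h3] with y hy
    exact h0 n _ hy

theorem exists_isCutSeq (D : Polygon) :
    ∃ θ, IsCutSeq D θ ∧ ∀ n, tsupport (θ n) ∩ closure D.ω ⊆ offVerts D := by
  choose θ hθ hθ0 using fun i => exists_isCutSeq_point D (vertex_notMem D i)
  obtain ⟨η, hη, hη0⟩ := exists_isCutSeq_axis D
  have hprod : ∀ s : Finset (Fin (D.m + 3)), IsCutSeq D (fun n => ∏ i ∈ s, θ i n) := by
    intro s
    induction s using Finset.induction_on with
    | empty => simpa using isCutSeq_one D
    | insert i s hi ih => simpa only [Finset.prod_insert hi] using (hθ i).mul ih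
  refine ⟨_, hη.mul (hprod Finset.univ), fun n x hx => ?_⟩
  have hx0 : 0 ≤ x.1 := by
    have : closure D.ω ⊆ {x : ℝ × ℝ | 0 ≤ x.1} :=
      closure_minimal (fun y hy => (D.pos y hy).le) (isClosed_le continuous_const continuous_fst)
    exact this hx.2
  have hne := hx.1
  rw [← not_not (a := x ∈ tsupport _), notMem_tsupport_iff_eventuallyEq] at hne
  refine ⟨lt_of_le_of_ne hx0 fun h => hne ?_, fun i h => hne ?_⟩
  · filter_upwards [hη0 n x h.symm] with y hy
    simp [hy]
  · subst h
    filter_upwards [hθ0 i n] with y hy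
    simp only [Pi.mul_apply, Finset.prod_apply, Pi.zero_apply, mul_eq_zero]
    exact Or.inr (Finset.prod_eq_zero (Finset.mem_univ i) hy)

/-! ### Reduction of the density statement to a local one -/

theorem fderiv_add_sub_mul {f g : ℝ × ℝ → ℝ} (hf : ContDiff ℝ (⊤ : ℕ∞) f)
    (hg : ContDiff ℝ (⊤ : ℕ∞) g) (x e : ℝ × ℝ) :
    fderiv ℝ (f + g - f * g) x e = fderiv ℝ f x e + fderiv ℝ g x e -
      (f x * fderiv ℝ g x e + g x * fderiv ℝ f x e) := by
  have h1 := (hf.differentiable (by simp) x).hasFDerivAt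
  have h2 := (hg.differentiable (by simp) x).hasFDerivAt
  rw [((h1.add h2).sub (h1.mul h2)).fderiv]
  simp

/-- From local cut-off functions to one for a compact set: if `f` and `g` are admissible, so is
`f + g - f g`, which equals `1` wherever `f` or `g` does. -/
theorem exists_cutoff_pairing_eq_zero {D : Polygon} {O : Set (ℝ × ℝ)} (hO : O ⊆ {x | 0 < x.1})
    {w : Fin 3 → ℝ × ℝ → ℂ} (hw : MemL2 D w)
    (hloc : ∀ x ∈ offVerts D, ∃ f, IsCutoff {x | 0 < x.1} f ∧ f =ᶠ[𝓝 x] 1 ∧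
      ∀ u, MemL2 D u → IsGradIn D O u → pairing D w (mulGrad f u) = 0)
    {K : Set (ℝ × ℝ)} (hK : IsCompact K) (hKO : K ⊆ offVerts D) :
    ∃ f, IsCutoff {x | 0 < x.1} f ∧ (∀ x ∈ K, f =ᶠ[𝓝 x] 1) ∧
      ∀ u, MemL2 D u → IsGradIn D O u → pairing D w (mulGrad f u) = 0 := by
  refine hK.induction_on (p := fun s => ∃ f, IsCutoff {x | 0 < x.1} f ∧ (∀ x ∈ s, f =ᶠ[𝓝 x] 1) ∧
      ∀ u, MemL2 D u → IsGradIn D O u → pairing D w (mulGrad f u) = 0) ?_ ?_ ?_ ?_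
  · refine ⟨0, ⟨contDiff_const, HasCompactSupport.zero, by simp,
      fun _ => le_rfl, fun _ => zero_le_one⟩, by simp, fun u _ _ => ?_⟩
    have h0 : ∀ x e, fderiv ℝ (0 : ℝ × ℝ → ℝ) x e = 0 := fun x e => by simp
    have : ∀ i, ∀ x ∈ D.ω, mulGrad 0 u i x = (fun _ _ => 0 : Fin 3 → ℝ × ℝ → ℂ) i x := by
      intro i x _
      refine Fin.cases ?_ (fun j => ?_) i <;> simp [mulGrad]
    rw [pairing_congr this]
    simp [pairing]
  · rintro s t hst ⟨f, hf, hf1, h⟩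
    exact ⟨f, hf, fun x hx => hf1 x (hst hx), h⟩
  · rintro s t ⟨f, hf, hf1, hf0⟩ ⟨g, hg, hg1, hg0⟩
    refine ⟨_, hf.add_sub_mul hg, ?_, fun u hu h => ?_⟩
    · rintro x (hx | hx)
      · filter_upwards [hf1 x hx] with y hy
        simp [hy]
      · filter_upwards [hg1 x hx] with y hy
        simp [hy]
    · have hgu := hu.mulGrad hg.smooth
      have e1 := hf0 u hu h
      have e2 := hg0 u hu h
      have e3 := hf0 _ hgu (h.mulGrad hO hu hg.smooth)
      have hfu := hu.mulGrad hf.smooth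
      have hfgu := hgu.mulGrad hf.smooth
      rw [pairing_eq_sum hw hfu] at e1
      rw [pairing_eq_sum hw hgu] at e2
      rw [pairing_eq_sum hw hfgu] at e3
      rw [pairing_eq_sum hw (hu.mulGrad (hf.add_sub_mul hg).smooth)]
      have : ∀ i, ∫ x, w i x * mulGrad (f + g - f * g) u i x ∂(wt D.ω 1) =
          (∫ x, w i x * mulGrad f u i x ∂(wt D.ω 1)) +
          (∫ x, w i x * mulGrad g u i x ∂(wt D.ω 1)) -
          ∫ x, w i x * mulGrad f (mulGrad g u) i x ∂(wt D.ω 1) := by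
        intro i
        rw [← integral_add (hw.integrable_mul hfu i) (hw.integrable_mul hgu i),
          ← integral_sub (f := fun x => w i x * mulGrad f u i x + w i x * mulGrad g u i x)
            ((hw.integrable_mul hfu i).add (hw.integrable_mul hgu i)) (hw.integrable_mul hfgu i)]
        congr 1; ext x
        refine Fin.cases ?_ (fun j => ?_) i
        · simp [mulGrad]; ring
        · simp only [mulGrad, Fin.cons_succ, Fin.cons_zero, fderiv_add_sub_mul hf.smooth hg.smooth]
          simp only [Pi.sub_apply, Pi.add_apply, Pi.mul_apply]
          push_cast
          ring
      simp only [this, Finset.sum_add_distrib, Finset.sum_sub_distrib, e1, e2, e3]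
      simp
  · intro x hx
    obtain ⟨f, hf, hf1, hf0⟩ := hloc x (hKO hx)
    obtain ⟨V, hV, hVO, hxV⟩ := eventually_nhds_iff.mp hf1
    exact ⟨V, mem_nhdsWithin_of_mem_nhds (hVO.mem_nhds hxV), f, hf, fun y hy =>
      eventually_nhds_iff.mpr ⟨V, hV, hVO, hy⟩, hf0⟩

theorem fderiv_eq_zero_of_eventuallyEq_one {f : ℝ × ℝ → ℝ} {x : ℝ × ℝ} (h : f =ᶠ[𝓝 x] 1) :
    fderiv ℝ f x = 0 := by
  rw [h.fderiv_eq]; exact fderiv_const_apply _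

theorem pairing_mulGrad_eq_zero_of_tsupport {D : Polygon} {O : Set (ℝ × ℝ)}
    (hO : O ⊆ {x | 0 < x.1}) {w : Fin 3 → ℝ × ℝ → ℂ} (hw : MemL2 D w)
    (hloc : ∀ x ∈ offVerts D, ∃ f, IsCutoff {x | 0 < x.1} f ∧ f =ᶠ[𝓝 x] 1 ∧
      ∀ u, MemL2 D u → IsGradIn D O u → pairing D w (mulGrad f u) = 0)
    {θ : ℝ × ℝ → ℝ} (hθ : ContDiff ℝ (⊤ : ℕ∞) θ) (hθs : tsupport θ ∩ closure D.ω ⊆ offVerts D)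
    {u : Fin 3 → ℝ × ℝ → ℂ} (hu : MemL2 D u) (h : IsGradIn D O u) :
    pairing D w (mulGrad θ u) = 0 := by
  have hK : IsCompact (tsupport θ ∩ closure D.ω) :=
    D.isBounded.isCompact_closure.inter_left (isClosed_tsupport θ)
  obtain ⟨f, -, hf1, hf0⟩ := exists_cutoff_pairing_eq_zero hO hw hloc hK hθs
  rw [← hf0 _ (hu.mulGrad hθ) (h.mulGrad hO hu hθ)]
  refine pairing_congr fun i x hx => ?_
  by_cases hxθ : x ∈ tsupport θ
  · have h1 := hf1 x ⟨hxθ, subset_closure hx⟩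
    have h2 := fderiv_eq_zero_of_eventuallyEq_one h1
    refine Fin.cases ?_ (fun j => ?_) i <;> simp [mulGrad, h1.self_of_nhds, h2]
  · have h1 : θ x = 0 := image_eq_zero_of_notMem_tsupport hxθ
    have h2 : ∀ e, fderiv ℝ θ x e = 0 := fun e =>
      image_eq_zero_of_notMem_tsupport (f := fun x => fderiv ℝ θ x e)
        fun hn' => hxθ (tsupport_fderiv_apply_subset ℝ e hn')
    refine Fin.cases ?_ (fun j => ?_) i <;> simp [mulGrad, h1, h2]

/-- The commutator terms of the cut-off vanish in the limit when tested against a fixed `L²_1`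
function: the energy stays bounded while the supports shrink to a null set. -/
theorem IsCutSeq.tendsto_integral_fderiv {D : Polygon} {θ : ℕ → ℝ × ℝ → ℝ} (hθ : IsCutSeq D θ)
    {w u : ℝ × ℝ → ℂ} (hw : MemLp w 2 (wt D.ω 1)) {B : ℝ} (hB : ∀ x, ‖u x‖ ≤ B) (e : ℝ × ℝ) :
    Tendsto (fun n => ∫ x, w x * ((fderiv ℝ (θ n) x e : ℂ) * u x) ∂(wt D.ω 1)) atTop (𝓝 0) := by
  obtain ⟨C, hC⟩ := hθ.energy e
  have hC0 : 0 ≤ C := (integral_nonneg fun x => sq_nonneg _).trans (hC 0)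
  have hB0 : 0 ≤ B := (norm_nonneg _).trans (hB 0)
  let S : ℕ → Set (ℝ × ℝ) := fun n => {x | fderiv ℝ (θ n) x e ≠ 0}
  have hS : ∀ n, MeasurableSet (S n) := fun n =>
    (isOpen_ne.preimage (continuous_fderiv_apply (hθ.smooth n) e)).measurableSet
  have hw2 : Integrable (fun x => ‖w x‖ ^ 2) (wt D.ω 1) :=
    (memLp_two_iff_integrable_sq_norm hw.1).mp hw
  have hlim : Tendsto (fun n => ∫ x, (S n).indicator (fun x => ‖w x‖ ^ 2) x ∂(wt D.ω 1)) atTop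
      (𝓝 0) := by
    have := tendsto_integral_of_dominated_convergence (μ := wt D.ω 1)
      (F := fun n => (S n).indicator fun x => ‖w x‖ ^ 2) (f := fun _ => (0 : ℝ))
      (fun x => ‖w x‖ ^ 2) (fun n => (hw2.indicator (hS n)).1) hw2
      (fun n => Eventually.of_forall fun x => ?_) ?_
    · simpa using this
    · refine (norm_indicator_le_norm_self _ _).trans_eq ?_
      simp
    · refine ae_wt_of_forall_mem D 1 fun x hx => ?_
      refine tendsto_const_nhds.congr' ?_
      filter_upwards [hθ.eventually_one x hx] with n hn
      have : x ∉ S n := by simp [S, fderiv_eq_zero_of_eventuallyEq_one hn]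
      simp [this]
  rw [Metric.tendsto_atTop]
  intro ε hε
  -- the parameter `t` in Young's inequality `|w| |∂θ| ≤ t |∂θ|² + |w|² / t` makes the energy small;
  -- the remaining term is integrated over the shrinking sets where `∂θ` does not vanish
  obtain ⟨t, ht, htε⟩ : ∃ t > 0, B * (t * C) < ε / 2 := by
    refine ⟨ε / (2 * (B * C + 1)), by positivity, ?_⟩
    have : 0 ≤ B * C := by positivity
    rw [show B * (ε / (2 * (B * C + 1)) * C) = (ε / 2) * ((B * C) / (B * C + 1)) by
      field_simp]
    have h1 : B * C / (B * C + 1) < 1 := by rw [div_lt_one (by positivity)]; linarith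
    nlinarith
  have hlim' := hlim.const_mul (B * t⁻¹)
  rw [mul_zero] at hlim'
  have h2 := hlim'.eventually (gt_mem_nhds (half_pos hε))
  obtain ⟨N, hN⟩ := eventually_atTop.mp h2
  refine ⟨N, fun n hn => ?_⟩
  rw [dist_zero_right]
  have i1 : Integrable (fun x => (fderiv ℝ (θ n) x e) ^ 2) (wt D.ω 1) :=
    integrable_of_continuous D ((continuous_fderiv_apply (hθ.smooth n) e).pow 2)
  have i2 := hw2.indicator (hS n)
  calc ‖∫ x, w x * ((fderiv ℝ (θ n) x e : ℂ) * u x) ∂(wt D.ω 1)‖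
      ≤ ∫ x, (B * (t * (fderiv ℝ (θ n) x e) ^ 2) +
          B * t⁻¹ * (S n).indicator (fun x => ‖w x‖ ^ 2) x) ∂(wt D.ω 1) := by
        refine norm_integral_le_of_norm_le (((i1.const_mul t).const_mul B).add
          (i2.const_mul _)) (Eventually.of_forall fun x => ?_)
        rw [norm_mul, norm_mul, Complex.norm_real, Real.norm_eq_abs]
        by_cases hx : x ∈ S n
        · rw [indicator_of_mem hx, mul_assoc B, ← mul_add]
          have h3 : ‖w x‖ * |fderiv ℝ (θ n) x e| ≤
              t * fderiv ℝ (θ n) x e ^ 2 + t⁻¹ * ‖w x‖ ^ 2 := by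
            rw [← sq_abs (fderiv ℝ (θ n) x e)]
            generalize |fderiv ℝ (θ n) x e| = d
            have h4 : 0 ≤ (t * d - ‖w x‖ / 2) ^ 2 + 3 / 4 * ‖w x‖ ^ 2 := by positivity
            have h5 : t * (t * d ^ 2 + t⁻¹ * ‖w x‖ ^ 2 - ‖w x‖ * d) =
              (t * d - ‖w x‖ / 2) ^ 2 + 3 / 4 * ‖w x‖ ^ 2 := by field_simp; ring
            rw [← h5] at h4
            linarith [nonneg_of_mul_nonneg_right h4 ht]
          calc _ = (‖w x‖ * |fderiv ℝ (θ n) x e|) * ‖u x‖ := by ring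
            _ ≤ (‖w x‖ * |fderiv ℝ (θ n) x e|) * B := by gcongr; exact hB x
            _ ≤ _ := by rw [mul_comm]; gcongr
        · have : fderiv ℝ (θ n) x e = 0 := by simpa [S] using hx
          simp [this, hx]
    _ = B * (t * ∫ x, (fderiv ℝ (θ n) x e) ^ 2 ∂(wt D.ω 1)) +
          B * t⁻¹ * ∫ x, (S n).indicator (fun x => ‖w x‖ ^ 2) x ∂(wt D.ω 1) := by
        rw [integral_add ((i1.const_mul t).const_mul B) (i2.const_mul _), integral_const_mul,
          integral_const_mul, integral_const_mul]
    _ < ε := by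
        have h3 : B * (t * ∫ x, (fderiv ℝ (θ n) x e) ^ 2 ∂(wt D.ω 1)) ≤ B * (t * C) := by
          have := hC n
          gcongr
        have h4 := hN n hn
        linarith

theorem pairing_eq_zero_of_bounded {D : Polygon} {O : Set (ℝ × ℝ)}
    (hO : O ⊆ {x | 0 < x.1}) {w : Fin 3 → ℝ × ℝ → ℂ} (hw : MemL2 D w)
    (hloc : ∀ x ∈ offVerts D, ∃ f, IsCutoff {x | 0 < x.1} f ∧ f =ᶠ[𝓝 x] 1 ∧
      ∀ u, MemL2 D u → IsGradIn D O u → pairing D w (mulGrad f u) = 0)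
    {u : Fin 3 → ℝ × ℝ → ℂ} (hu : MemL2 D u) (h : IsGradIn D O u) {B : ℝ}
    (hB : ∀ x, ‖u 0 x‖ ≤ B) : pairing D w u = 0 := by
  obtain ⟨θ, hθ, hθs⟩ := exists_isCutSeq D
  have hz : ∀ n, pairing D w (mulGrad (θ n) u) = 0 := fun n =>
    pairing_mulGrad_eq_zero_of_tsupport hO hw hloc (hθ.smooth n) (hθs n) hu h
  have hi : Integrable (fun x => ∑ i, w i x * u i x) (wt D.ω 1) :=
    integrable_finsetSum _ fun i _ => hw.integrable_mul hu i
  have h1 : Tendsto (fun n => ∫ x, (θ n x : ℂ) * ∑ i, w i x * u i x ∂(wt D.ω 1)) atTop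
      (𝓝 (pairing D w u)) := by
    refine tendsto_integral_of_dominated_convergence (fun x => ‖∑ i, w i x * u i x‖)
      (fun n => (ofReal_contDiff (hθ.smooth n)).continuous.aestronglyMeasurable.mul hi.1) hi.norm
      (fun n => Eventually.of_forall fun x => ?_) (ae_wt_of_forall_mem D 1 fun x hx => ?_)
    · rw [norm_mul, Complex.norm_real, Real.norm_eq_abs]
      exact mul_le_of_le_one_left (norm_nonneg _) (hθ.abs_le n x)
    · refine tendsto_const_nhds.congr' ?_
      filter_upwards [hθ.eventually_one x hx] with n hn
      simp [hn.self_of_nhds]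
  have h2 : ∀ j : Fin 2, Tendsto (fun n => ∫ x, w j.succ x *
      ((fderiv ℝ (θ n) x (dir j) : ℂ) * u 0 x) ∂(wt D.ω 1)) atTop (𝓝 0) := fun j =>
    hθ.tendsto_integral_fderiv (hw j.succ) hB (dir j)
  have h3 := h1.add (tendsto_finsetSum Finset.univ fun j _ => h2 j)
  simp only [Finset.sum_const_zero, add_zero] at h3
  refine tendsto_nhds_unique h3 (tendsto_const_nhds.congr fun n => ?_)
  rw [← hz n]
  have hi1 : Integrable (fun x => (θ n x : ℂ) * ∑ i, w i x * u i x) (wt D.ω 1) := by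
    refine hi.norm.mono' ((ofReal_contDiff (hθ.smooth n)).continuous.aestronglyMeasurable.mul hi.1)
      (Eventually.of_forall fun x => ?_)
    rw [norm_mul, Complex.norm_real, Real.norm_eq_abs]
    exact mul_le_of_le_one_left (norm_nonneg _) (hθ.abs_le n x)
  have hi2 : ∀ j : Fin 2, Integrable (fun x => w j.succ x *
      ((fderiv ℝ (θ n) x (dir j) : ℂ) * u 0 x)) (wt D.ω 1) := fun j =>
    (hw j.succ).integrable_mul (memLp_continuous_mul D
      (Complex.continuous_ofReal.comp (continuous_fderiv_apply (hθ.smooth n) (dir j))) (hu 0))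
  rw [← integral_finsetSum _ fun j _ => hi2 j, ← integral_add hi1
    (integrable_finsetSum _ fun j _ => hi2 j), pairing]
  congr 1; ext x
  simp only [Fin.sum_univ_succ, mulGrad, Fin.cons_zero, Fin.cons_succ]
  simp
  ring

/-- Truncations of the complex plane: smooth bounded maps with uniformly bounded derivative that
are the identity on larger and larger balls. -/
theorem exists_truncation : ∃ G : ℕ → ℂ → ℂ, ∃ C : ℝ, (∀ n, ContDiff ℝ 1 (G n)) ∧
    (∀ n, ∃ B, ∀ z, ‖G n z‖ ≤ B) ∧ (∀ n z, ‖fderiv ℝ (G n) z‖ ≤ C) ∧ (∀ n, G n 0 = 0) ∧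
    (∀ n z, ‖G n z‖ ≤ ‖z‖) ∧ ∀ z, ∀ᶠ n in atTop, G n =ᶠ[𝓝 z] id := by
  let b : ContDiffBump (0 : ℂ) := ⟨1, 2, one_pos, one_lt_two⟩
  let F : ℂ → ℂ := fun z => b z • z
  have hF : ContDiff ℝ 1 F := b.contDiff.smul contDiff_id
  have hFc : HasCompactSupport F := b.hasCompactSupport.smul_right
  obtain ⟨B, hB⟩ := hFc.exists_bound_of_continuous hF.continuous
  obtain ⟨C, hC⟩ := (hFc.fderiv ℝ).exists_bound_of_continuous (hF.continuous_fderiv one_ne_zero)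
  have hn : ∀ n : ℕ, (0 : ℝ) < n + 1 := fun n => by positivity
  refine ⟨fun n z => ((n : ℝ) + 1) • F (((n : ℝ) + 1)⁻¹ • z), C, fun n => ?_, fun n => ?_,
    fun n z => ?_, fun n => ?_, fun n z => ?_, fun z => ?_⟩
  · exact (hF.comp (contDiff_id.const_smul _)).const_smul _
  · refine ⟨((n : ℝ) + 1) * B, fun z => ?_⟩
    rw [norm_smul, Real.norm_of_nonneg (hn n).le]
    exact mul_le_mul_of_nonneg_left (hB _) (hn n).le
  · have h1 : HasFDerivAt (fun z : ℂ => ((n : ℝ) + 1)⁻¹ • z)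
        (((n : ℝ) + 1)⁻¹ • ContinuousLinearMap.id ℝ ℂ) z :=
      (hasFDerivAt_id (𝕜 := ℝ) z).const_smul (((n : ℝ) + 1)⁻¹)
    have h2 := ((hF.differentiable one_ne_zero (((n : ℝ) + 1)⁻¹ • z)).hasFDerivAt.comp z
      h1).const_smul ((n : ℝ) + 1)
    have h3 : fderiv ℝ (fun z => ((n : ℝ) + 1) • F (((n : ℝ) + 1)⁻¹ • z)) z =
        fderiv ℝ F (((n : ℝ) + 1)⁻¹ • z) := by
      refine Eq.trans h2.fderiv ?_
      rw [ContinuousLinearMap.comp_smul, ContinuousLinearMap.comp_id, smul_smul,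
        mul_inv_cancel₀ (hn n).ne', one_smul]
    rw [h3]
    exact hC _
  · simp [F]
  · have h1 : ‖F (((n : ℝ) + 1)⁻¹ • z)‖ ≤ ‖((n : ℝ) + 1)⁻¹ • z‖ := by
      change ‖b (((n : ℝ) + 1)⁻¹ • z) • (((n : ℝ) + 1)⁻¹ • z)‖ ≤ _
      rw [norm_smul (b _), Real.norm_of_nonneg b.nonneg]
      exact mul_le_of_le_one_left (norm_nonneg _) b.le_one
    rw [norm_smul, Real.norm_of_nonneg (hn n).le]
    rw [norm_smul _ z, Real.norm_of_nonneg (inv_nonneg.mpr (hn n).le)] at h1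
    calc _ ≤ ((n : ℝ) + 1) * (((n : ℝ) + 1)⁻¹ * ‖z‖) := mul_le_mul_of_nonneg_left h1 (hn n).le
      _ = ‖z‖ := by field_simp
  · obtain ⟨N, hN⟩ := exists_nat_gt ‖z‖
    filter_upwards [eventually_ge_atTop N] with n hnN
    have h1 : ‖z‖ < (n : ℝ) + 1 := by
      have : (N : ℝ) ≤ n := by exact_mod_cast hnN
      linarith
    filter_upwards [continuous_norm.continuousAt.eventually_lt continuousAt_const h1] with y hy
    have h2 : b (((n : ℝ) + 1)⁻¹ • y) = 1 := by
      refine b.one_of_mem_closedBall ?_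
      rw [mem_closedBall_zero_iff, norm_smul, Real.norm_of_nonneg (inv_nonneg.mpr (hn n).le)]
      change _ ≤ (1 : ℝ)
      rw [inv_mul_le_iff₀ (hn n), mul_one]
      exact hy.le
    simp only [F, h2, one_smul, id]
    rw [smul_smul, mul_inv_cancel₀ (hn n).ne', one_smul]

/-- If a triple `w` pairs to zero with all localizations of weak gradient triples, then it pairs
to zero with all weak gradient triples.  First `u` is truncated, so that it becomes bounded; then
the axis and the vertices are cut off by functions of bounded energy, which works for bounded `u`
by `IsCutSeq.tendsto_integral_fderiv`. -/
theorem pairing_eq_zero_of_local {D : Polygon} {O : Set (ℝ × ℝ)} (hOo : IsOpen O)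
    (hO : O ⊆ {x | 0 < x.1}) {w : Fin 3 → ℝ × ℝ → ℂ} (hw : MemL2 D w)
    (hloc : ∀ x ∈ offVerts D, ∃ f, IsCutoff {x | 0 < x.1} f ∧ f =ᶠ[𝓝 x] 1 ∧
      ∀ u, MemL2 D u → IsGradIn D O u → pairing D w (mulGrad f u) = 0)
    {u : Fin 3 → ℝ × ℝ → ℂ} (hu : MemL2 D u) (h : IsGradIn D O u) : pairing D w u = 0 := by
  obtain ⟨G, C, hG, hGB, hGC, hG0, hGle, hGev⟩ := exists_truncation
  have hC0 : 0 ≤ C := (norm_nonneg _).trans (hGC 0 0)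
  have hbd : ∀ n i x, ‖compGrad (G n) u i x‖ ≤ (1 + C) * ‖u i x‖ := by
    intro n i x
    refine Fin.cases ?_ (fun j => ?_) i
    · have := hGle n (u 0 x)
      simp only [compGrad, Fin.cons_zero]
      nlinarith [norm_nonneg (u 0 x)]
    · simp only [compGrad, Fin.cons_succ]
      refine ((fderiv ℝ (G n) (u 0 x)).le_opNorm _).trans ?_
      gcongr
      linarith [hGC n (u 0 x)]
  have hmem : ∀ n, MemL2 D (compGrad (G n) u) := by
    intro n i
    refine MemLp.of_le_mul (c := 1 + C) (hu i) ?_ (Eventually.of_forall fun x => hbd n i x)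
    refine Fin.cases ?_ (fun j => ?_) i
    · exact (hG n).continuous.comp_aestronglyMeasurable (hu 0).1
    · have happ : Continuous fun q : (ℂ →L[ℝ] ℂ) × ℂ => q.1 q.2 := by fun_prop
      exact happ.comp_aestronglyMeasurable ((((hG n).continuous_fderiv
        one_ne_zero).comp_aestronglyMeasurable (hu 0).1).prodMk (hu j.succ).1)
  have hz : ∀ n, pairing D w (compGrad (G n) u) = 0 := by
    intro n
    obtain ⟨B, hB⟩ := hGB n
    exact pairing_eq_zero_of_bounded hO hw hloc (hmem n)
      (fun i => (h i).comp hOo hO (hu 0) (hu i.succ) (hG n) hB (hGC n) (hG0 n))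
      (B := B) (fun x => hB _)
  have hlim : ∀ i, Tendsto (fun n => ∫ x, w i x * compGrad (G n) u i x ∂(wt D.ω 1)) atTop
      (𝓝 (∫ x, w i x * u i x ∂(wt D.ω 1))) := by
    intro i
    refine tendsto_integral_of_dominated_convergence (fun x => (1 + C) * ‖w i x * u i x‖)
      (fun n => (hw i).1.mul (hmem n i).1) ((hw.integrable_mul hu i).norm.const_mul _)
      (fun n => Eventually.of_forall fun x => ?_) (Eventually.of_forall fun x => ?_)
    · rw [norm_mul, norm_mul, mul_left_comm]
      exact mul_le_mul_of_nonneg_left (hbd n i x) (norm_nonneg _)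
    · refine tendsto_const_nhds.congr' ?_
      filter_upwards [hGev (u 0 x)] with n hn
      congr 1
      refine Fin.cases ?_ (fun j => ?_) i
      · simp [compGrad, hn.self_of_nhds]
      · simp only [compGrad, Fin.cons_succ]
        rw [hn.fderiv_eq]
        simp
  rw [pairing_eq_sum hw hu]
  refine tendsto_nhds_unique (tendsto_finsetSum _ fun i _ => hlim i)
    (tendsto_const_nhds.congr fun n => ?_)
  rw [← hz n, pairing_eq_sum hw (hmem n)]

/-! ### Geometry of the polygon near its sides -/

theorem _root_.IsPreconnected.inter_frontier_nonempty_of_isOpen {X : Type*} [TopologicalSpace X]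
    {t s : Set X} (ht : IsPreconnected t) (hs : IsOpen s) (h1 : ∃ x ∈ t, x ∈ s)
    (h2 : ∃ x ∈ t, x ∉ s) : ∃ x ∈ t, x ∈ frontier s := by
  by_contra! hn
  obtain ⟨x, hxt, hxs⟩ := h1
  obtain ⟨y, hyt, hys⟩ := h2
  have hc : ∀ z ∈ t, z ∉ s → z ∈ (closure s)ᶜ := fun z hz hzs hzc =>
    hn z hz (hs.frontier_eq ▸ ⟨hzc, hzs⟩)
  obtain ⟨z, -, hz1, hz2⟩ := ht s (closure s)ᶜ hs isClosed_closure.isOpen_compl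
    (fun z hz => or_iff_not_imp_left.mpr (hc z hz)) ⟨x, hxt, hxs⟩ ⟨y, hyt, hc y hyt hys⟩
  exact hz2 (subset_closure hz1)

namespace Polygon

variable (D : Polygon)

/-- The side `[P i, P (i + 1)]`. -/
def side (i : Fin (D.m + 3)) : Set (ℝ × ℝ) := segment ℝ (D.P i) (D.P (i + 1))

/-- The vector from `P i` to `P (i + 1)`. -/
def vec (i : Fin (D.m + 3)) : ℝ × ℝ := D.P (i + 1) - D.P i

/-- The linear function `y ↦ det (vec i, y)`; it is positive on vectors that point to the left of
the side `i`. -/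
def left (i : Fin (D.m + 3)) : ℝ × ℝ →L[ℝ] ℝ :=
  (D.vec i).1 • ContinuousLinearMap.snd ℝ ℝ ℝ - (D.vec i).2 • ContinuousLinearMap.fst ℝ ℝ ℝ

/-- The linear function that gives the coordinate along the side `i`, equal to `1` on `vec i`. -/
def along (i : Fin (D.m + 3)) : ℝ × ℝ →L[ℝ] ℝ :=
  ((D.vec i).1 ^ 2 + (D.vec i).2 ^ 2)⁻¹ •
    ((D.vec i).1 • ContinuousLinearMap.fst ℝ ℝ ℝ + (D.vec i).2 • ContinuousLinearMap.snd ℝ ℝ ℝ)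

variable {D}

theorem left_apply (i : Fin (D.m + 3)) (y : ℝ × ℝ) :
    D.left i y = (D.vec i).1 * y.2 - (D.vec i).2 * y.1 := by
  simp [left]

theorem along_apply (i : Fin (D.m + 3)) (y : ℝ × ℝ) :
    D.along i y = ((D.vec i).1 ^ 2 + (D.vec i).2 ^ 2)⁻¹ *
      ((D.vec i).1 * y.1 + (D.vec i).2 * y.2) := by
  simp [along]
  ring

theorem add_one_ne (i : Fin (D.m + 3)) : i + 1 ≠ i := by
  intro h
  simp at h

theorem vec_ne_zero (i : Fin (D.m + 3)) : D.vec i ≠ 0 :=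
  sub_ne_zero.mpr fun h => add_one_ne i (D.injective_P h)

theorem sq_vec_pos (i : Fin (D.m + 3)) : 0 < (D.vec i).1 ^ 2 + (D.vec i).2 ^ 2 := by
  by_contra h
  have h1 : (D.vec i).1 = 0 := by nlinarith [sq_nonneg (D.vec i).1, sq_nonneg (D.vec i).2]
  have h2 : (D.vec i).2 = 0 := by nlinarith [sq_nonneg (D.vec i).1, sq_nonneg (D.vec i).2]
  exact vec_ne_zero i (Prod.ext h1 h2)

theorem left_vec (i : Fin (D.m + 3)) : D.left i (D.vec i) = 0 := by
  rw [left_apply]; ring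

theorem along_vec (i : Fin (D.m + 3)) : D.along i (D.vec i) = 1 := by
  rw [along_apply]
  have := (sq_vec_pos i).ne'
  field_simp

theorem left_rotLeft_pos (i : Fin (D.m + 3)) : 0 < D.left i (rotLeft (D.vec i)) := by
  rw [left_apply]
  have := sq_vec_pos i
  simp only [rotLeft]
  nlinarith

/-- A vector with vanishing `left` coordinate is parallel to the side. -/
theorem eq_smul_vec_of_left_eq_zero {i : Fin (D.m + 3)} {y : ℝ × ℝ} (h : D.left i y = 0) :
    y = D.along i y • D.vec i := by
  rw [left_apply] at h
  have h0 := (sq_vec_pos i).ne'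
  rw [along_apply]
  refine Prod.ext ?_ ?_
  · simp only [Prod.smul_fst, smul_eq_mul]
    field_simp
    linear_combination (D.vec i).2 * (-h)
  · simp only [Prod.smul_snd, smul_eq_mul]
    field_simp
    linear_combination (D.vec i).1 * h

theorem mem_side_iff {i : Fin (D.m + 3)} {x : ℝ × ℝ} :
    x ∈ D.side i ↔ ∃ t ∈ Icc (0 : ℝ) 1, x = D.P i + t • D.vec i := by
  rw [side, segment_eq_image']
  simp only [mem_image, vec, eq_comm]

theorem mem_openSide_iff {i : Fin (D.m + 3)} {x : ℝ × ℝ} :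
    x ∈ openSegment ℝ (D.P i) (D.P (i + 1)) ↔ ∃ t ∈ Ioo (0 : ℝ) 1, x = D.P i + t • D.vec i := by
  rw [openSegment_eq_image']
  simp only [mem_image, vec, eq_comm]

theorem left_sub_of_mem_side {i : Fin (D.m + 3)} {x : ℝ × ℝ} (h : x ∈ D.side i) :
    D.left i (x - D.P i) = 0 := by
  obtain ⟨t, -, rfl⟩ := mem_side_iff.mp h
  simp [left_vec]

theorem isCompact_side (i : Fin (D.m + 3)) : IsCompact (D.side i) := by
  rw [side, segment_eq_image']
  exact isCompact_Icc.image (by fun_prop)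

theorem side_subset_frontier (i : Fin (D.m + 3)) : D.side i ⊆ frontier D.ω := by
  rw [D.frontier_eq]; exact subset_iUnion (fun i => segment ℝ (D.P i) (D.P (i + 1))) i

theorem notMem_of_mem_side {i : Fin (D.m + 3)} {x : ℝ × ℝ} (h : x ∈ D.side i) : x ∉ D.ω := by
  have h := side_subset_frontier i h
  rw [D.isOpen.frontier_eq] at h
  exact h.2

theorem fst_eq_zero_of_mem_side_zero {x : ℝ × ℝ} (h : x ∈ D.side 0) : x.1 = 0 := by
  obtain ⟨t, -, rfl⟩ := mem_side_iff.mp h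
  simp [vec, D.axis_zero, D.axis_one]

theorem fst_vertex_nonneg (i : Fin (D.m + 3)) : 0 ≤ (D.P i).1 := by
  by_cases h0 : i = 0
  · rw [h0, D.axis_zero]
  by_cases h1 : i = 1
  · rw [h1, D.axis_one]
  exact (D.off_axis i h0 h1).le

theorem fst_pos_of_mem_openSide {i : Fin (D.m + 3)} (hi : i ≠ 0) {x : ℝ × ℝ}
    (h : x ∈ openSegment ℝ (D.P i) (D.P (i + 1))) : 0 < x.1 := by
  obtain ⟨t, ht, rfl⟩ := mem_openSide_iff.mp h
  have e : (D.P i + t • D.vec i).1 = (1 - t) * (D.P i).1 + t * (D.P (i + 1)).1 := by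
    simp [vec]; ring
  rw [e]
  have h1 := fst_vertex_nonneg i
  have h2 := fst_vertex_nonneg (i + 1)
  have h3 := ht.1
  have h4 : 0 < 1 - t := by linarith [ht.2]
  by_cases hi1 : i = 1
  · have h5 : 0 < (D.P (i + 1)).1 := by
      refine D.off_axis _ ?_ ?_
      · rw [hi1]
        intro h
        have := congrArg Fin.val h
        simp only [Fin.val_add, Fin.val_one, Fin.val_zero] at this
        rw [Nat.mod_eq_of_lt (by omega)] at this
        omega
      · rw [hi1]; simp
    positivity
  · have h5 := D.off_axis i hi hi1
    positivity

theorem openSide_subset (i : Fin (D.m + 3)) :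
    openSegment ℝ (D.P i) (D.P (i + 1)) ⊆ D.side i := openSegment_subset_segment _ _ _

theorem ne_vertex_of_mem_openSide {i : Fin (D.m + 3)} {x : ℝ × ℝ}
    (h : x ∈ openSegment ℝ (D.P i) (D.P (i + 1))) : x ≠ D.P i ∧ x ≠ D.P (i + 1) := by
  obtain ⟨t, ht, rfl⟩ := mem_openSide_iff.mp h
  have hv := vec_ne_zero i
  constructor
  · simp [hv, ht.1.ne']
  · have : D.P (i + 1) = D.P i + D.vec i := by simp [vec]
    rw [this, Ne, add_right_inj]
    intro h'
    have h2 : (t - 1) • D.vec i = 0 := by rw [sub_smul, h', one_smul, sub_self]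
    rcases smul_eq_zero.mp h2 with h3 | h3
    · linarith [ht.2]
    · exact hv h3

theorem notMem_side_of_mem_openSide {i j : Fin (D.m + 3)} (hij : i ≠ j) {x : ℝ × ℝ}
    (h : x ∈ openSegment ℝ (D.P i) (D.P (i + 1))) : x ∉ D.side j := by
  intro hj
  have := (D.simple i j hij ⟨openSide_subset i h, hj⟩).1
  have h2 := ne_vertex_of_mem_openSide h
  rcases this with h3 | h3
  · exact h2.1 h3
  · exact h2.2 h3

theorem exists_mem_openSide {x : ℝ × ℝ} (hx : x ∈ frontier D.ω) (hx' : x ∈ offVerts D) :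
    ∃ i, i ≠ 0 ∧ x ∈ openSegment ℝ (D.P i) (D.P (i + 1)) := by
  rw [D.frontier_eq] at hx
  obtain ⟨i, hi⟩ := mem_iUnion.mp hx
  refine ⟨i, ?_, ?_⟩
  · rintro rfl
    exact hx'.1.ne' (fst_eq_zero_of_mem_side_zero hi)
  · exact mem_openSegment_of_ne_left_right (hx'.2 i).symm (hx'.2 (i + 1)).symm hi

/-- A ball around a point of `γ_b` in which `ω` is the left half of the ball, cut along
the side `i`, and which meets no other side. -/
structure IsSideBall (D : Polygon) (i : Fin (D.m + 3)) (x₀ : ℝ × ℝ) (ρ : ℝ) : Prop where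
  ne_zero : i ≠ 0
  pos : 0 < ρ
  fst_pos : ∀ x ∈ Metric.ball x₀ ρ, 0 < x.1
  mem_iff : ∀ x ∈ Metric.ball x₀ ρ, x ∈ D.ω ↔ 0 < D.left i (x - D.P i)
  mem_openSide : ∀ x ∈ Metric.ball x₀ ρ, D.left i (x - D.P i) = 0 →
    x ∈ openSegment ℝ (D.P i) (D.P (i + 1))
  notMem_side : ∀ j, j ≠ i → ∀ x ∈ Metric.ball x₀ ρ, x ∉ D.side j

/-- In a small ball around a point of an open side, each of the two half balls is connected and
meets no boundary point; `left_side` says which one belongs to `ω`. -/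
theorem exists_isSideBall {i : Fin (D.m + 3)} (hi : i ≠ 0) {x₀ : ℝ × ℝ}
    (h : x₀ ∈ openSegment ℝ (D.P i) (D.P (i + 1))) : ∃ ρ, IsSideBall D i x₀ ρ := by
  have hO : IsOpen ({x : ℝ × ℝ | 0 < x.1} ∩ (⋃ j ∈ Finset.univ.erase i, D.side j)ᶜ ∩
      {x | D.along i (x - D.P i) ∈ Ioo (0 : ℝ) 1}) := by
    refine (isOpen_halfPlane.inter ?_).inter (isOpen_Ioo.preimage (by fun_prop))
    exact ((Finset.univ.erase i).isCompact_biUnion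
      fun j _ => isCompact_side j).isClosed.isOpen_compl
  obtain ⟨ρ, hρ, hρO⟩ := Metric.isOpen_iff.mp hO x₀ (by
    refine ⟨⟨fst_pos_of_mem_openSide hi h, ?_⟩, ?_⟩
    · simp only [mem_compl_iff, mem_iUnion, not_exists]
      intro j hj
      exact notMem_side_of_mem_openSide (Finset.ne_of_mem_erase hj).symm h
    · obtain ⟨t, ht, rfl⟩ := mem_openSide_iff.mp h
      simpa [along_vec] using ht)
  have hother : ∀ j, j ≠ i → ∀ x ∈ Metric.ball x₀ ρ, x ∉ D.side j := by
    intro j hj x hx hxj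
    refine (hρO hx).1.2 ?_
    simp only [mem_iUnion]
    exact ⟨j, Finset.mem_erase.mpr ⟨hj, Finset.mem_univ _⟩, hxj⟩
  have hopen : ∀ x ∈ Metric.ball x₀ ρ, D.left i (x - D.P i) = 0 →
      x ∈ openSegment ℝ (D.P i) (D.P (i + 1)) := by
    intro x hx hl
    refine mem_openSide_iff.mpr ⟨_, (hρO hx).2, ?_⟩
    rw [← eq_smul_vec_of_left_eq_zero hl]
    simp
  have hfr : ∀ x ∈ Metric.ball x₀ ρ, x ∈ frontier D.ω → D.left i (x - D.P i) = 0 := by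
    intro x hx hxf
    rw [D.frontier_eq] at hxf
    obtain ⟨j, hj⟩ := mem_iUnion.mp hxf
    by_cases hji : j = i
    · subst hji; exact left_sub_of_mem_side hj
    · exact absurd hj (hother j hji x hx)
  have hl0 := left_sub_of_mem_side (openSide_subset i h)
  have hball : ∀ᶠ ε in 𝓝[>] (0 : ℝ), x₀ + ε • rotLeft (D.vec i) ∈ Metric.ball x₀ ρ ∧
      x₀ - ε • rotLeft (D.vec i) ∈ Metric.ball x₀ ρ := by
    refine nhdsWithin_le_nhds ?_
    have c1 : ContinuousAt (fun ε : ℝ => x₀ + ε • rotLeft (D.vec i)) 0 := by fun_prop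
    have c2 : ContinuousAt (fun ε : ℝ => x₀ - ε • rotLeft (D.vec i)) 0 := by fun_prop
    exact (c1.eventually (Metric.isOpen_ball.mem_nhds (by simpa using hρ))).and
      (c2.eventually (Metric.isOpen_ball.mem_nhds (by simpa using hρ)))
  obtain ⟨ε, ⟨hε1, hε2⟩, hb1, hb2, hε⟩ :=
    ((D.left_side i x₀ h).and (hball.and self_mem_nhdsWithin) |>.mono
      fun ε h => (⟨h.1, h.2.1.1, h.2.1.2, h.2.2⟩ : _ ∧ _ ∧ _ ∧ _)).exists
  have hε : (0 : ℝ) < ε := hε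
  have hcomp : ∀ y : ℝ × ℝ, D.left i (x₀ + y - D.P i) = D.left i y := by
    intro y
    rw [add_sub_right_comm, map_add, hl0, zero_add]
  have hrot := left_rotLeft_pos i
  have hpre : ∀ s : Set ℝ, Convex ℝ s →
      IsPreconnected (Metric.ball x₀ ρ ∩ {x | D.left i (x - D.P i) ∈ s}) := by
    intro s hs
    refine ((convex_ball x₀ ρ).inter ?_).isPreconnected
    have h1 : Convex ℝ (D.left i ⁻¹' s) := hs.linear_preimage (D.left i : ℝ × ℝ →ₗ[ℝ] ℝ)
    simpa [sub_eq_add_neg, preimage] using h1.translate_preimage_left (-D.P i)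
  refine ⟨ρ, hi, hρ, fun x hx => (hρO hx).1.1, fun x hx => ⟨fun hxω => ?_, fun hl => ?_⟩,
    hopen, hother⟩
  · by_contra hl
    rcases (not_lt.mp hl).lt_or_eq with hl | hl
    · have := (hpre (Iio 0) (convex_Iio 0)).inter_frontier_nonempty_of_isOpen D.isOpen
        ⟨x, ⟨hx, hl⟩, hxω⟩ ⟨x₀ - ε • rotLeft (D.vec i), ⟨hb2, ?_⟩, hε2⟩
      · obtain ⟨y, ⟨hy1, hy2⟩, hy3⟩ := this
        exact (ne_of_lt (show D.left i (y - D.P i) < 0 from hy2)) (hfr y hy1 hy3)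
      · change D.left i (x₀ - ε • rotLeft (D.vec i) - D.P i) < 0
        rw [sub_eq_add_neg x₀, hcomp, map_neg, map_smul, smul_eq_mul]
        nlinarith
    · exact notMem_of_mem_side (openSide_subset i (hopen x hx hl)) hxω
  · by_contra hxω
    have := (hpre (Ioi 0) (convex_Ioi 0)).inter_frontier_nonempty_of_isOpen D.isOpen
      ⟨x₀ + ε • rotLeft (D.vec i), ⟨hb1, ?_⟩, hε1⟩ ⟨x, ⟨hx, hl⟩, hxω⟩
    · obtain ⟨y, ⟨hy1, hy2⟩, hy3⟩ := this
      exact (ne_of_gt (show 0 < D.left i (y - D.P i) from hy2)) (hfr y hy1 hy3)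
    · change 0 < D.left i (x₀ + ε • rotLeft (D.vec i) - D.P i)
      rw [hcomp, map_smul, smul_eq_mul]
      positivity

end Polygon

/-! ### Density of smooth functions and of test functions -/

/-- A smooth function supported in `ω` or in a ball that `ω` meets in a half ball. -/
structure IsLocalSmooth (D : Polygon) (φ : ℝ × ℝ → ℂ) : Prop where
  smooth : ContDiff ℝ (⊤ : ℕ∞) φ
  compact : HasCompactSupport φ
  supp : tsupport φ ⊆ D.ω ∨ ∃ i x₀ ρ, D.IsSideBall i x₀ ρ ∧ tsupport φ ⊆ Metric.ball x₀ ρ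

theorem isTest_mollifier_mul_cutoff {κ χ : ℝ × ℝ → ℝ} {δ : ℝ} {V O : Set (ℝ × ℝ)}
    (hκ : IsMollifier κ δ) (hχ : IsCutoff V χ) {x : ℝ × ℝ}
    (h : ∀ y ∈ tsupport χ, x - y ∈ tsupport κ → y ∈ O) :
    IsTest O (fun y => ((κ (x - y) * χ y : ℝ) : ℂ)) := by
  have hsub : (tsupport fun y => κ (x - y) * χ y) ⊆ {y | x - y ∈ tsupport κ} ∩ tsupport χ := by
    refine closure_minimal (fun y hy => ⟨?_, ?_⟩)
      (((isClosed_tsupport κ).preimage (by fun_prop)).inter (isClosed_tsupport χ))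
    · exact subset_closure (left_ne_zero_of_mul hy)
    · exact subset_closure (right_ne_zero_of_mul hy)
  refine ⟨ofReal_contDiff ((hκ.smooth.comp (contDiff_const.sub contDiff_id)).mul hχ.smooth), ?_, ?_⟩
  · rw [HasCompactSupport, tsupport_ofReal (f := fun y => κ (x - y) * χ y)]
    exact hχ.compact.of_isClosed_subset (isClosed_tsupport _) (hsub.trans inter_subset_right)
  · rw [tsupport_ofReal (f := fun y => κ (x - y) * χ y)]
    exact fun y hy => h y (hsub hy).2 (hsub hy).1

theorem Polygon.IsSideBall.subset_offVerts {D : Polygon} {i : Fin (D.m + 3)} {x₀ : ℝ × ℝ} {ρ : ℝ}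
    (h : D.IsSideBall i x₀ ρ) : Metric.ball x₀ ρ ⊆ offVerts D := by
  refine fun x hx => ⟨h.fst_pos x hx, fun j hj => ?_⟩
  by_cases hji : j = i
  · subst hji
    exact (Polygon.ne_vertex_of_mem_openSide (h.mem_openSide x hx (by rw [hj]; simp))).1 hj
  · exact h.notMem_side j hji x hx (hj ▸ left_mem_segment ℝ _ _)

/-- Localization near points that are not on the boundary of `ω`. -/
theorem exists_cutoff_of_notMem_frontier {D : Polygon} {O : Set (ℝ × ℝ)} (hω : D.ω ⊆ O)
    (hO : O ⊆ {x | 0 < x.1}) {w : Fin 3 → ℝ × ℝ → ℂ} (hw : MemL2 D w)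
    (hw0 : ∀ φ, IsTest D.ω φ → pairing D w (gradOf φ) = 0) {x : ℝ × ℝ} (hx0 : 0 < x.1)
    (hx : x ∉ frontier D.ω) : ∃ f, IsCutoff {x | 0 < x.1} f ∧ f =ᶠ[𝓝 x] 1 ∧
      ∀ u, MemL2 D u → IsGradIn D O u → pairing D w (mulGrad f u) = 0 := by
  by_cases hxc : x ∈ closure D.ω
  · have hxω : x ∈ D.ω := by
      by_contra hn
      exact hx (D.isOpen.frontier_eq ▸ ⟨hxc, hn⟩)
    obtain ⟨ρ, hρ, hρω⟩ := Metric.isOpen_iff.mp D.isOpen x hxω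
    obtain ⟨f, hf, hf1⟩ := exists_isCutoff_nhds (Metric.isOpen_ball (x := x) (ε := ρ / 2))
      (Metric.mem_ball_self (by positivity))
    obtain ⟨χ, hχ, hχ1⟩ := exists_isCutoff D.isOpen hf.compact.isCompact
      (hf.supp.trans ((Metric.ball_subset_ball (by linarith)).trans hρω))
    have hf' : IsCutoff {x | 0 < x.1} f := { hf with
      supp := hf.supp.trans ((Metric.ball_subset_ball (by linarith)).trans
        (hρω.trans fun y hy => D.pos y hy)) }
    refine ⟨f, hf', hf1, fun u hu h => ?_⟩
    refine pairing_mulGrad_eq_zero_of_mollify (𝒟 := {φ | IsTest D.ω φ}) hO hw hw0 hf' hχ1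
      (ℓ := ContinuousLinearMap.fst ℝ ℝ ℝ) (v := (1, 0)) (by simp) (δ₀ := ρ / 2) (by positivity)
      (fun κ hκ _ y _ => isTest_mollifier_mul_cutoff hκ hχ fun z hz _ => hω (hχ.supp hz))
      (fun κ hκ _ φ hφ hφc hφs => ⟨hφ, hφc, fun y hy => ?_⟩) hu h
    obtain ⟨s, hs, z, hz, rfl⟩ := hφs y hy
    refine hρω ?_
    have h1 := mem_ball_zero_iff.mp (hκ.supp hs)
    have h2 := mem_ball_iff_norm.mp (hf.supp hz.1)
    rw [mem_ball_iff_norm, add_sub_assoc]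
    exact (norm_add_le _ _).trans_lt (by linarith)
  · obtain ⟨f, hf, hf1⟩ := exists_isCutoff_nhds
      (isOpen_halfPlane.inter isClosed_closure.isOpen_compl) ⟨hx0, hxc⟩
    refine ⟨f, { hf with supp := hf.supp.trans inter_subset_left }, hf1, fun u _ _ => ?_⟩
    have : ∀ i, ∀ x ∈ D.ω, mulGrad f u i x = (fun _ _ => 0 : Fin 3 → ℝ × ℝ → ℂ) i x := by
      intro i x hx
      have hxf : x ∉ tsupport f := fun hn => (hf.supp hn).2 (subset_closure hx)
      have h1 : f x = 0 := image_eq_zero_of_notMem_tsupport hxf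
      have h2 : ∀ e, fderiv ℝ f x e = 0 := fun e =>
        image_eq_zero_of_notMem_tsupport (f := fun x => fderiv ℝ f x e)
          fun hn' => hxf (tsupport_fderiv_apply_subset ℝ e hn')
      refine Fin.cases ?_ (fun j => ?_) i <;> simp [mulGrad, h1, h2]
    rw [pairing_congr this]
    simp [pairing]

/-- Functions that are smooth up to the boundary are dense among the functions with a weak
gradient in `ω`: a triple that pairs to zero with the former pairs to zero with the latter.  Near a
side the mollifying kernel is supported so that only values inside `ω` enter. -/
theorem pairing_eq_zero_of_isLocalSmooth {D : Polygon} {w : Fin 3 → ℝ × ℝ → ℂ} (hw : MemL2 D w)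
    (hw0 : ∀ φ, IsLocalSmooth D φ → pairing D w (gradOf φ) = 0) {u : Fin 3 → ℝ × ℝ → ℂ}
    (hu : MemL2 D u) (h : IsGradIn D D.ω u) : pairing D w u = 0 := by
  have hO : D.ω ⊆ {x | 0 < x.1} := fun y hy => D.pos y hy
  refine pairing_eq_zero_of_local D.isOpen hO hw (fun x hx => ?_) hu h
  by_cases hxf : x ∈ frontier D.ω
  swap
  · exact exists_cutoff_of_notMem_frontier subset_rfl hO hw
      (fun φ hφ => hw0 φ ⟨hφ.smooth, hφ.compact, Or.inl hφ.supp⟩) hx.1 hxf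
  obtain ⟨i, hi, hxi⟩ := Polygon.exists_mem_openSide hxf hx
  obtain ⟨ρ, hb⟩ := Polygon.exists_isSideBall hi hxi
  have hρ := hb.pos
  obtain ⟨f, hf, hf1⟩ := exists_isCutoff_nhds (Metric.isOpen_ball (x := x) (ε := ρ / 3))
    (Metric.mem_ball_self (by positivity))
  obtain ⟨χ, hχ, hχ1⟩ := exists_isCutoff (Metric.isOpen_ball (x := x) (ε := ρ / 2))
    hf.compact.isCompact (hf.supp.trans (Metric.ball_subset_ball (by linarith)))
  have hf' : IsCutoff {x | 0 < x.1} f := { hf with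
    supp := hf.supp.trans ((Metric.ball_subset_ball (by linarith)).trans hb.fst_pos) }
  refine ⟨f, hf', hf1, fun u hu h => ?_⟩
  refine pairing_mulGrad_eq_zero_of_mollify (𝒟 := {φ | IsLocalSmooth D φ}) hO hw hw0 hf' hχ1
    -- the kernel is supported to the right of the side, so that `x - y` in its support and `x ∈ ω`
    -- force `y ∈ ω`
    (ℓ := -D.left i) (v := -rotLeft (D.vec i))
    (by simpa using Polygon.left_rotLeft_pos i) (δ₀ := ρ / 3) (by positivity)
    (fun κ hκ hκℓ y hy => isTest_mollifier_mul_cutoff hκ hχ fun z hz hyz => ?_)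
    (fun κ hκ _ φ hφ hφc hφs => ⟨hφ, hφc, Or.inr ⟨i, x, ρ, hb, fun y hy => ?_⟩⟩) hu h
  · have h1 := mem_ball_zero_iff.mp (hκ.supp hyz)
    have h2 := mem_ball_iff_norm.mp (hχ.supp hz)
    have h3 : y ∈ Metric.ball x ρ := by
      rw [mem_ball_iff_norm, show y - x = (y - z) + (z - x) by abel]
      exact (norm_add_le _ _).trans_lt (by linarith)
    have h4 := hκℓ _ hyz
    have h5 := (hb.mem_iff y h3).mp hy
    rw [hb.mem_iff z (Metric.ball_subset_ball (by linarith) (hχ.supp hz))]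
    rw [neg_apply, map_sub] at h4
    rw [map_sub] at h5 ⊢
    linarith
  · obtain ⟨s, hs, z, hz, rfl⟩ := hφs y hy
    have h1 := mem_ball_zero_iff.mp (hκ.supp hs)
    have h2 := mem_ball_iff_norm.mp (hf.supp hz.1)
    rw [mem_ball_iff_norm, add_sub_assoc]
    exact (norm_add_le _ _).trans_lt (by linarith)

/-- Test functions are dense among the functions whose extension by zero has a weak gradient
across `γ_b`.  Near a side the mollifying kernel shifts the support into `ω`. -/
theorem pairing_eq_zero_of_isTest {D : Polygon} {w : Fin 3 → ℝ × ℝ → ℂ} (hw : MemL2 D w)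
    (hw0 : ∀ φ, IsTest D.ω φ → pairing D w (gradOf φ) = 0) {u : Fin 3 → ℝ × ℝ → ℂ}
    (hu : MemL2 D u) (h : IsGradIn D (offVerts D) u) : pairing D w u = 0 := by
  have hO := offVerts_subset D
  refine pairing_eq_zero_of_local (isOpen_offVerts D) hO hw (fun x hx => ?_) hu h
  by_cases hxf : x ∈ frontier D.ω
  swap
  · exact exists_cutoff_of_notMem_frontier (subset_offVerts D) hO hw hw0 hx.1 hxf
  obtain ⟨i, hi, hxi⟩ := Polygon.exists_mem_openSide hxf hx
  obtain ⟨ρ, hb⟩ := Polygon.exists_isSideBall hi hxi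
  have hρ := hb.pos
  obtain ⟨f, hf, hf1⟩ := exists_isCutoff_nhds (Metric.isOpen_ball (x := x) (ε := ρ / 3))
    (Metric.mem_ball_self (by positivity))
  obtain ⟨χ, hχ, hχ1⟩ := exists_isCutoff (Metric.isOpen_ball (x := x) (ε := ρ))
    hf.compact.isCompact (hf.supp.trans (Metric.ball_subset_ball (by linarith)))
  have hf' : IsCutoff {x | 0 < x.1} f := { hf with
    supp := hf.supp.trans ((Metric.ball_subset_ball (by linarith)).trans hb.fst_pos) }
  refine ⟨f, hf', hf1, fun u hu h => ?_⟩
  refine pairing_mulGrad_eq_zero_of_mollify (𝒟 := {φ | IsTest D.ω φ}) hO hw hw0 hf' hχ1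
    -- the kernel is supported to the left of the side, so that it moves the support into `ω`
    (ℓ := D.left i) (v := rotLeft (D.vec i))
    (Polygon.left_rotLeft_pos i) (δ₀ := ρ / 3) (by positivity)
    (fun κ hκ hκℓ y hy => isTest_mollifier_mul_cutoff hκ hχ fun z hz _ =>
      hb.subset_offVerts (hχ.supp hz))
    (fun κ hκ hκℓ φ hφ hφc hφs => ⟨hφ, hφc, fun y hy => ?_⟩) hu h
  obtain ⟨s, hs, z, hz, rfl⟩ := hφs y hy
  have h1 := mem_ball_zero_iff.mp (hκ.supp hs)
  have h2 := mem_ball_iff_norm.mp (hf.supp hz.1)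
  have h3 : z ∈ Metric.ball x ρ := mem_ball_iff_norm.mpr (by linarith)
  have h4 : s + z ∈ Metric.ball x ρ := by
    rw [mem_ball_iff_norm, add_sub_assoc]
    exact (norm_add_le _ _).trans_lt (by linarith)
  -- `z` is in the closure of `ω`, hence on the left of the side or on it
  have h5 : 0 ≤ D.left i (z - D.P i) := by
    have h6 : z ∈ closure (Metric.ball x ρ ∩ D.ω) :=
      Metric.isOpen_ball.inter_closure ⟨h3, hz.2⟩
    have h7 : closure (Metric.ball x ρ ∩ D.ω) ⊆ {z | 0 ≤ D.left i (z - D.P i)} :=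
      closure_minimal (fun y hy => ((hb.mem_iff y hy.1).mp hy.2).le)
        (isClosed_le continuous_const (by fun_prop))
    exact h7 h6
  rw [hb.mem_iff _ h4, add_sub_assoc, map_add]
  linarith [hκℓ s hs]

/-! ### The divergence theorem near a side -/

/-- The linear map `(t, s) ↦ t p + s q`. -/
def planeMap (p q : ℝ × ℝ) : ℝ × ℝ →L[ℝ] ℝ × ℝ :=
  (ContinuousLinearMap.fst ℝ ℝ ℝ).smulRight p + (ContinuousLinearMap.snd ℝ ℝ ℝ).smulRight q

theorem planeMap_apply (p q y : ℝ × ℝ) : planeMap p q y = y.1 • p + y.2 • q := rfl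

theorem det_planeMap (p q : ℝ × ℝ) : (planeMap p q).det = p.1 * q.2 - p.2 * q.1 := by
  rw [ContinuousLinearMap.det, ← LinearMap.det_toMatrix (Module.Basis.finTwoProd ℝ),
    Matrix.det_fin_two]
  simp [LinearMap.toMatrix_apply, planeMap_apply]
  ring

theorem injective_planeMap {p q : ℝ × ℝ} (h : p.1 * q.2 - p.2 * q.1 ≠ 0) :
    Function.Injective (planeMap p q) := by
  have : (planeMap p q : ℝ × ℝ →ₗ[ℝ] ℝ × ℝ).det ≠ 0 := by
    rw [← ContinuousLinearMap.det, det_planeMap]; exact h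
  exact ((planeMap p q : ℝ × ℝ →ₗ[ℝ] ℝ × ℝ).equivOfDetNeZero this).injective

theorem surjective_planeMap {p q : ℝ × ℝ} (h : p.1 * q.2 - p.2 * q.1 ≠ 0) :
    Function.Surjective (planeMap p q) := by
  have : (planeMap p q : ℝ × ℝ →ₗ[ℝ] ℝ × ℝ).det ≠ 0 := by
    rw [← ContinuousLinearMap.det, det_planeMap]; exact h
  exact ((planeMap p q : ℝ × ℝ →ₗ[ℝ] ℝ × ℝ).equivOfDetNeZero this).surjective

/-- Integration of a directional derivative over the half-plane to the left of the line through
`A` with direction `d`. -/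
theorem integral_fderiv_leftHalfPlane {A d : ℝ × ℝ} (hd : 0 < d.1 ^ 2 + d.2 ^ 2)
    {g : ℝ × ℝ → ℂ} (hg : ContDiff ℝ (⊤ : ℕ∞) g) (hc : HasCompactSupport g) (e : ℝ × ℝ) :
    ∫ x in {x | 0 < d.1 * (x.2 - A.2) - d.2 * (x.1 - A.1)}, fderiv ℝ g x e =
      ((d.2 * e.1 - d.1 * e.2 : ℝ) : ℂ) * ∫ t : ℝ, g (A + t • d) := by
  set L := planeMap d (rotLeft d) with hL
  have hdet : d.1 * (rotLeft d).2 - d.2 * (rotLeft d).1 = d.1 ^ 2 + d.2 ^ 2 := by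
    simp only [rotLeft]; ring
  have hdet' : d.1 * (rotLeft d).2 - d.2 * (rotLeft d).1 ≠ 0 := by rw [hdet]; exact hd.ne'
  have himg : (fun y => A + L y) '' (univ ×ˢ Ioi (0 : ℝ)) =
      {x | 0 < d.1 * (x.2 - A.2) - d.2 * (x.1 - A.1)} := by
    have key : ∀ y : ℝ × ℝ, d.1 * ((A + L y).2 - A.2) - d.2 * ((A + L y).1 - A.1) =
        (d.1 ^ 2 + d.2 ^ 2) * y.2 := by
      intro y; simp [hL, planeMap_apply, rotLeft]; ring
    ext x
    constructor
    · rintro ⟨y, hy, rfl⟩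
      rw [mem_ofPred_eq, key]
      exact mul_pos hd hy.2
    · intro hx
      obtain ⟨y, hy⟩ := surjective_planeMap hdet' (x - A)
      have hxy : A + L y = x := by rw [hL, hy]; abel
      refine ⟨y, ⟨mem_univ _, ?_⟩, hxy⟩
      rw [mem_ofPred_eq, ← hxy, key] at hx
      exact pos_of_mul_pos_right hx hd.le
  have hder : ∀ y, HasFDerivAt (fun y => A + L y) L y := fun y => L.hasFDerivAt.const_add A
  have hinj : Function.Injective fun y => A + L y :=
    (add_right_injective A).comp (injective_planeMap hdet')
  rw [← himg, integral_image_eq_integral_abs_det_fderiv_smul volume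
    (MeasurableSet.univ.prod measurableSet_Ioi) (fun y _ => (hder y).hasFDerivWithinAt)
    hinj.injOn]
  set G : ℝ × ℝ → ℂ := fun y => g (A + L y) with hG
  have hGs : ContDiff ℝ (⊤ : ℕ∞) G := hg.comp (contDiff_const.add L.contDiff)
  have hemb : Topology.IsClosedEmbedding fun y => A + L y := by
    refine (Homeomorph.addLeft A).isClosedEmbedding.comp ?_
    exact (LinearMap.isClosedEmbedding_of_injective (f := (L : ℝ × ℝ →ₗ[ℝ] ℝ × ℝ))
      (LinearMap.ker_eq_bot.mpr (injective_planeMap hdet')))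
  have hGc : HasCompactSupport G := hc.comp_isClosedEmbedding hemb
  have hGd : ∀ y v, fderiv ℝ G y v = fderiv ℝ g (A + L y) (L v) := by
    intro y v
    have h1 : HasFDerivAt g (fderiv ℝ g (A + L y)) (A + L y) :=
      (hg.differentiable (by simp) _).hasFDerivAt
    have h2 : HasFDerivAt G ((fderiv ℝ g (A + L y)).comp L) y := h1.comp y (hder y)
    rw [h2.fderiv]
    rfl
  have hGi : ∀ v, Integrable (fun y => fderiv ℝ G y v) := fun v =>
    (continuous_fderiv_apply' hGs v).integrable_of_hasCompactSupport
      (hGc.fderiv_apply (𝕜 := ℝ) v)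
  -- the components of `e` along `d` and along the normal `rotLeft d`
  set α := (d.1 * e.1 + d.2 * e.2) / (d.1 ^ 2 + d.2 ^ 2) with hα
  set β := (d.1 * e.2 - d.2 * e.1) / (d.1 ^ 2 + d.2 ^ 2) with hβ
  have he : L (α, β) = e := by
    rw [hL, planeMap_apply]
    refine Prod.ext ?_ ?_
    · simp only [rotLeft, Prod.fst_add, Prod.smul_fst, smul_eq_mul, hα, hβ]
      field_simp
      ring
    · simp only [rotLeft, Prod.snd_add, Prod.smul_snd, smul_eq_mul, hα, hβ]
      field_simp
      ring
  have hint : ∀ y, |L.det| • fderiv ℝ g (A + L y) e = ((d.1 ^ 2 + d.2 ^ 2 : ℝ) : ℂ) *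
      ((α : ℂ) * fderiv ℝ G y (1, 0) + (β : ℂ) * fderiv ℝ G y (0, 1)) := by
    intro y
    have h1 : ((α, β) : ℝ × ℝ) = α • (1, 0) + β • (0, 1) := by simp
    rw [hL, det_planeMap, hdet, abs_of_pos hd, ← hL, Complex.real_smul]
    congr 1
    conv_lhs => rw [← he]
    rw [← hGd, h1, map_add, map_smul, map_smul, Complex.real_smul, Complex.real_smul]
  simp_rw [hint]
  have hi : ∀ (c : ℂ) v, IntegrableOn (fun y => c * fderiv ℝ G y v) (univ ×ˢ Ioi (0 : ℝ)) :=
    fun c v => ((hGi v).const_mul c).integrableOn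
  rw [integral_const_mul, integral_add (hi _ _) (hi _ _), integral_const_mul, integral_const_mul]
  have hcomp1 : ∀ s : ℝ, HasCompactSupport fun t : ℝ => G (t, s) := fun s =>
    hGc.comp_isClosedEmbedding
      (Isometry.isClosedEmbedding (Isometry.of_dist_eq fun a b => by simp [Prod.dist_eq]))
  have hcomp2 : ∀ t : ℝ, HasCompactSupport fun s : ℝ => G (t, s) := fun t =>
    hGc.comp_isClosedEmbedding
      (Isometry.isClosedEmbedding (Isometry.of_dist_eq fun a b => by simp [Prod.dist_eq]))
  have hd1 : ∀ t s : ℝ, HasDerivAt (fun t => G (t, s)) (fderiv ℝ G (t, s) (1, 0)) t := by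
    intro t s
    have h1 : HasFDerivAt G (fderiv ℝ G (t, s)) (t, s) :=
      (hGs.differentiable (by simp) _).hasFDerivAt
    exact HasFDerivAt.comp_hasDerivAt (l := G) (f := fun t => (t, s)) t h1
      ((hasDerivAt_id t).prodMk (hasDerivAt_const t s))
  have hd2 : ∀ t s : ℝ, HasDerivAt (fun s => G (t, s)) (fderiv ℝ G (t, s) (0, 1)) s := by
    intro t s
    have h1 : HasFDerivAt G (fderiv ℝ G (t, s)) (t, s) :=
      (hGs.differentiable (by simp) _).hasFDerivAt
    exact HasFDerivAt.comp_hasDerivAt (l := G) (f := fun s => (t, s)) s h1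
      ((hasDerivAt_const s t).prodMk (hasDerivAt_id s))
  have hs1 : ∀ s : ℝ, ContDiff ℝ (⊤ : ℕ∞) fun t => G (t, s) := fun s =>
    hGs.comp (contDiff_id.prodMk contDiff_const)
  have hs2 : ∀ t : ℝ, ContDiff ℝ (⊤ : ℕ∞) fun s => G (t, s) := fun t =>
    hGs.comp (contDiff_const.prodMk contDiff_id)
  -- the tangential derivative integrates to zero, the normal one to a boundary term
  have hI1 : ∫ y in univ ×ˢ Ioi (0 : ℝ), fderiv ℝ G y (1, 0) = 0 := by
    rw [Measure.volume_eq_prod, ← Measure.prod_restrict, ← integral_prod_swap, integral_prod]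
    · refine integral_eq_zero_of_ae (Eventually.of_forall fun s => ?_)
      simp only [Prod.swap_prod_mk, Measure.restrict_univ, Pi.zero_apply]
      refine integral_eq_zero_of_hasDerivAt_of_integrable (f := fun t => G (t, s))
        (fun t => hd1 t s) ?_ ((hs1 s).continuous.integrable_of_hasCompactSupport (hcomp1 s))
      refine (((hs1 s).continuous_deriv (by simp)).integrable_of_hasCompactSupport
        (hcomp1 s).deriv).congr (Eventually.of_forall fun t => ?_)
      exact (hd1 t s).deriv
    · refine Integrable.swap (f := fun z => fderiv ℝ G z (1, 0)) ?_
      rw [Measure.prod_restrict, ← Measure.volume_eq_prod]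
      exact (hGi (1, 0)).integrableOn
  have hI2 : ∫ y in univ ×ˢ Ioi (0 : ℝ), fderiv ℝ G y (0, 1) = -∫ t : ℝ, G (t, 0) := by
    rw [Measure.volume_eq_prod, setIntegral_prod _ (by
      rw [← Measure.volume_eq_prod]; exact (hGi (0, 1)).integrableOn), Measure.restrict_univ,
      ← integral_neg]
    refine integral_congr_ae (Eventually.of_forall fun t => ?_)
    have h1 := (hcomp2 t).integral_Ioi_deriv_eq ((hs2 t).of_le (by simp)) 0
    change ∫ s in Ioi (0 : ℝ), fderiv ℝ G (t, s) (0, 1) = -G (t, 0)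
    rw [← h1]
    exact integral_congr_ae (Eventually.of_forall fun s => (hd2 t s).deriv.symm)
  rw [hI1, hI2]
  have hG0 : ∀ t : ℝ, G (t, 0) = g (A + t • d) := fun t => by
    simp [hG, hL, planeMap_apply]
  simp_rw [hG0]
  have hb : (d.2 * e.1 - d.1 * e.2) = -((d.1 ^ 2 + d.2 ^ 2) * β) := by
    rw [hβ]; field_simp; ring
  rw [hb]
  push_cast
  ring

theorem integral_fderiv_apply_eq_zero {g : ℝ × ℝ → ℂ} (hg : ContDiff ℝ (⊤ : ℕ∞) g)
    (hc : HasCompactSupport g) (e : ℝ × ℝ) : ∫ x, fderiv ℝ g x e = 0 := by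
  have h1 : Integrable (fun x => fderiv ℝ g x e) :=
    (continuous_fderiv_apply' hg e).integrable_of_hasCompactSupport (hc.fderiv_apply (𝕜 := ℝ) e)
  have h2 : Integrable g := hg.continuous.integrable_of_hasCompactSupport hc
  have h := integral_bilinear_hasLineDerivAt_right_eq_neg_left_of_integrable (μ := volume)
    (f := fun _ : ℝ × ℝ => (1 : ℂ)) (f' := fun _ => 0) (g := g) (g' := fun x => fderiv ℝ g x e)
    (v := e) (B := ContinuousLinearMap.mul ℝ ℂ) (by simp) (by simpa using h1) (by simpa using h2)
    (fun x _ => by simpa using (hasFDerivAt_const (1 : ℂ) x).hasLineDerivAt e)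
    (fun x _ => (hg.differentiable (by simp) x).hasFDerivAt.hasLineDerivAt e)
  simpa using h

theorem measurableEmbedding_lineMap (D : Polygon) (i : Fin (D.m + 3)) :
    MeasurableEmbedding fun t : ℝ => AffineMap.lineMap (D.P i) (D.P (i + 1)) t := by
  refine Continuous.measurableEmbedding (by fun_prop) ?_
  exact AffineMap.lineMap_injective ℝ fun h => Polygon.add_one_ne i (D.injective_P h.symm)

theorem integral_sideMeasure {E : Type*} [NormedAddCommGroup E] [NormedSpace ℝ E] (D : Polygon)
    (i : Fin (D.m + 3)) (f : ℝ × ℝ → E) : ∫ x, f x ∂(sideMeasure D i) =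
      euclLength (D.vec i) • ∫ t in Icc (0 : ℝ) 1, f (D.P i + t • D.vec i) := by
  rw [sideMeasure, integral_smul_measure, (measurableEmbedding_lineMap D i).integral_map,
    ENNReal.toReal_ofReal (by exact Real.sqrt_nonneg _)]
  simp only [AffineMap.lineMap_apply_module', Polygon.vec, add_comm]

theorem ae_sideMeasure_mem (D : Polygon) (i : Fin (D.m + 3)) :
    ∀ᵐ x ∂(sideMeasure D i), x ∈ D.side i := by
  refine Measure.ae_smul_measure ?_ _
  rw [(measurableEmbedding_lineMap D i).ae_map_iff]
  filter_upwards [ae_restrict_mem measurableSet_Icc] with t ht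
  refine Polygon.mem_side_iff.mpr ⟨t, ht, ?_⟩
  simp only [AffineMap.lineMap_apply_module', Polygon.vec, add_comm]

theorem isFiniteMeasure_sideMeasure (D : Polygon) (i : Fin (D.m + 3)) :
    IsFiniteMeasure (sideMeasure D i) := by
  have : IsFiniteMeasure (Measure.map (fun t : ℝ => AffineMap.lineMap (D.P i) (D.P (i + 1)) t)
      (volume.restrict (Icc (0 : ℝ) 1))) := inferInstance
  exact Measure.smul_finite _ ENNReal.ofReal_ne_top

theorem exists_bound_side {D : Polygon} {i : Fin (D.m + 3)} {E : Type*} [NormedAddCommGroup E]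
    {f : ℝ × ℝ → E} (hf : Continuous f) : ∃ C, ∀ᵐ x ∂(sideMeasure D i), ‖f x‖ ≤ C := by
  obtain ⟨C, hC⟩ := (Polygon.isCompact_side i).exists_bound_of_continuousOn hf.continuousOn
  exact ⟨C, (ae_sideMeasure_mem D i).mono fun x hx => hC x hx⟩

theorem integrable_sideMeasure {D : Polygon} {i : Fin (D.m + 3)} {E : Type*}
    [NormedAddCommGroup E] [SecondCountableTopologyEither (ℝ × ℝ) E] {f : ℝ × ℝ → E}
    (hf : Continuous f) : Integrable f (sideMeasure D i) := by
  have := isFiniteMeasure_sideMeasure D i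
  obtain ⟨C, hC⟩ := exists_bound_side (D := D) (i := i) hf
  exact Integrable.of_bound hf.aestronglyMeasurable C hC

theorem euclLength_pos {D : Polygon} (i : Fin (D.m + 3)) : 0 < euclLength (D.vec i) :=
  Real.sqrt_pos.mpr (Polygon.sq_vec_pos i)

theorem IsLocalSmooth.mul {D : Polygon} {φ ψ : ℝ × ℝ → ℂ} (h : IsLocalSmooth D φ)
    (hψ : ContDiff ℝ (⊤ : ℕ∞) ψ) : IsLocalSmooth D fun x => φ x * ψ x := by
  have hs : tsupport (fun x => φ x * ψ x) ⊆ tsupport φ := tsupport_mul_subset_left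
  refine ⟨h.smooth.mul hψ, h.compact.mul_right, ?_⟩
  rcases h.supp with h1 | ⟨i, x₀, ρ, hb, h1⟩
  · exact Or.inl (hs.trans h1)
  · exact Or.inr ⟨i, x₀, ρ, hb, hs.trans h1⟩

/-- The divergence theorem, one component at a time, for functions supported in `ω` or near an
interior point of a side. -/
theorem IsLocalSmooth.integral_fderiv {D : Polygon} {φ : ℝ × ℝ → ℂ} (h : IsLocalSmooth D φ)
    (e : ℝ × ℝ) : ∫ x in D.ω, fderiv ℝ φ x e = ∑ i ∈ sidesB D,
      ((((normal D i).1 * e.1 + (normal D i).2 * e.2 : ℝ)) : ℂ) * ∫ x, φ x ∂(sideMeasure D i) := by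
  have hside : ∀ j, (∀ x ∈ D.side j, φ x = 0) → ∫ x, φ x ∂(sideMeasure D j) = 0 := by
    intro j hj
    rw [integral_sideMeasure, setIntegral_congr_fun (g := fun _ => 0) measurableSet_Icc
      fun t ht => hj _ (Polygon.mem_side_iff.mpr ⟨t, ht, rfl⟩)]
    simp
  have hsub := tsupport_fderiv_apply_subset (f := φ) ℝ e
  rcases h.supp with hs | ⟨i, x₀, ρ, hb, hs⟩
  · rw [setIntegral_eq_integral_of_forall_compl_eq_zero,
      integral_fderiv_apply_eq_zero h.smooth h.compact]
    · refine (Finset.sum_eq_zero fun i _ => ?_).symm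
      rw [hside i, mul_zero]
      exact fun x hx => image_eq_zero_of_notMem_tsupport fun hn =>
        Polygon.notMem_of_mem_side hx (hs hn)
    · exact fun x hx => image_eq_zero_of_notMem_tsupport (f := fun x => fderiv ℝ φ x e)
        fun hn => hx (hs (hsub hn))
  · rw [sidesB, Finset.sum_eq_single_of_mem i
      (Finset.mem_erase.mpr ⟨hb.ne_zero, Finset.mem_univ _⟩)]
    · have h1 : ∫ x in D.ω, fderiv ℝ φ x e = ∫ x in {x | 0 < (D.vec i).1 * (x.2 - (D.P i).2) -
          (D.vec i).2 * (x.1 - (D.P i).1)}, fderiv ℝ φ x e := by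
        have hms : MeasurableSet {x : ℝ × ℝ | 0 < (D.vec i).1 * (x.2 - (D.P i).2) -
            (D.vec i).2 * (x.1 - (D.P i).1)} :=
          (isOpen_lt continuous_const (by fun_prop)).measurableSet
        rw [← integral_indicator D.measurableSet, ← integral_indicator hms]
        congr 1
        ext x
        by_cases hx : x ∈ Metric.ball x₀ ρ
        · have := hb.mem_iff x hx
          rw [Polygon.left_apply, Prod.fst_sub, Prod.snd_sub] at this
          by_cases hxω : x ∈ D.ω
          · rw [indicator_of_mem hxω, indicator_of_mem]
            exact this.mp hxω
          · rw [indicator_of_notMem hxω, indicator_of_notMem]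
            exact fun hn => hxω (this.mpr hn)
        · have h0 : fderiv ℝ φ x e = 0 :=
            image_eq_zero_of_notMem_tsupport (f := fun x => fderiv ℝ φ x e)
              fun hn => hx (hs (hsub hn))
          simp only [indicator, h0, ite_self]
      rw [h1, integral_fderiv_leftHalfPlane (Polygon.sq_vec_pos i) h.smooth h.compact,
        integral_sideMeasure, Complex.real_smul,
        ← setIntegral_eq_integral_of_forall_compl_eq_zero (s := Icc (0 : ℝ) 1)]
      · rw [← mul_assoc, ← Complex.ofReal_mul]
        congr 2
        have hL := (euclLength_pos i).ne'
        simp only [normal, rotLeft, Polygon.vec, Prod.fst_neg, Prod.snd_neg, neg_smul,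
          Prod.smul_fst, Prod.smul_snd, smul_eq_mul] at hL ⊢
        field_simp
        ring
      · intro t ht
        by_contra hne
        have hmem := hs (subset_closure hne)
        obtain ⟨t', ht', he⟩ := Polygon.mem_openSide_iff.mp
          (hb.mem_openSide _ hmem (by simp [Polygon.left_vec]))
        have : t = t' := smul_left_injective ℝ (Polygon.vec_ne_zero i) (add_left_cancel he)
        exact ht (this ▸ Ioo_subset_Icc_self ht')
    · intro j _ hji
      rw [hside j, mul_zero]
      exact fun x hx => image_eq_zero_of_notMem_tsupport fun hn =>
        hb.notMem_side j hji x (hs hn) hx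

/-! ### Thin triangles on the sides -/

/-- The parametrization of the triangle with base `[A, A + d]` and apex `a` by the segments from
`A + t d` to `a`. -/
def triPoint (A d a : ℝ × ℝ) (y : ℝ × ℝ) : ℝ × ℝ := A + ((1 - y.2) * y.1) • d + y.2 • (a - A)

theorem continuous_triPoint (A d a : ℝ × ℝ) : Continuous (triPoint A d a) := by
  unfold triPoint; fun_prop

theorem fst_triPoint (A d a y : ℝ × ℝ) :
    (triPoint A d a y).1 = (1 - y.2) * (A.1 + y.1 * d.1) + y.2 * a.1 := by
  simp [triPoint]; ring

namespace Polygon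

variable {D : Polygon}

theorem left_triPoint (i : Fin (D.m + 3)) (a y : ℝ × ℝ) :
    D.left i (triPoint (D.P i) (D.vec i) a y - D.P i) = y.2 * D.left i (a - D.P i) := by
  rw [triPoint, add_assoc, add_sub_cancel_left, map_add, map_smul, map_smul, left_vec]
  simp

theorem fst_side_pos {i : Fin (D.m + 3)} (hi : i ≠ 0) {t : ℝ} (ht : t ∈ Ioo (0 : ℝ) 1) :
    0 < (D.P i).1 + t * (D.vec i).1 := by
  simpa using fst_pos_of_mem_openSide hi (mem_openSide_iff.mpr ⟨t, ht, rfl⟩)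

/-- A triangle on the side `i` lies in `ω` as soon as it meets no other side: it is connected, it
meets `ω` near the base, and it does not meet the boundary. -/
theorem triPoint_mem {i : Fin (D.m + 3)} (hi : i ≠ 0) {a : ℝ × ℝ}
    (ha : 0 < D.left i (a - D.P i))
    (h : ∀ j, j ≠ i → ∀ y ∈ Ioo (0 : ℝ) 1 ×ˢ Ioo (0 : ℝ) 1,
      triPoint (D.P i) (D.vec i) a y ∉ D.side j) {y : ℝ × ℝ}
    (hy : y ∈ Ioo (0 : ℝ) 1 ×ˢ Ioo (0 : ℝ) 1) : triPoint (D.P i) (D.vec i) a y ∈ D.ω := by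
  set F := triPoint (D.P i) (D.vec i) a with hF
  have hcF : Continuous F := continuous_triPoint _ _ _
  have hm : F (1 / 2, 0) ∈ openSegment ℝ (D.P i) (D.P (i + 1)) :=
    mem_openSide_iff.mpr ⟨1 / 2, by norm_num, by simp [hF, triPoint]⟩
  obtain ⟨ρ, hb⟩ := exists_isSideBall hi hm
  have hev : ∀ᶠ s in 𝓝[>] (0 : ℝ), F (1 / 2, s) ∈ Metric.ball (F (1 / 2, 0)) ρ := by
    have hc : ContinuousAt (fun s : ℝ => F (1 / 2, s)) 0 := by fun_prop
    exact nhdsWithin_le_nhds (hc.eventually (Metric.ball_mem_nhds _ hb.pos))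
  obtain ⟨s, hs, hs0, hs1⟩ := (hev.and (Ioo_mem_nhdsGT (zero_lt_one' ℝ))).exists
  have hsω : F (1 / 2, s) ∈ D.ω := by
    rw [hb.mem_iff _ hs, hF, left_triPoint]
    exact mul_pos hs0 ha
  by_contra hn
  have hpre : IsPreconnected (F '' (Ioo (0 : ℝ) 1 ×ˢ Ioo (0 : ℝ) 1)) :=
    (isPreconnected_Ioo.prod isPreconnected_Ioo).image _ hcF.continuousOn
  obtain ⟨x, ⟨y', hy', rfl⟩, hx⟩ := hpre.inter_frontier_nonempty_of_isOpen D.isOpen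
    ⟨_, ⟨(1 / 2, s), ⟨by norm_num, hs0, hs1⟩, rfl⟩, hsω⟩ ⟨_, ⟨y, hy, rfl⟩, hn⟩
  rw [D.frontier_eq] at hx
  obtain ⟨j, hj⟩ := mem_iUnion.mp hx
  by_cases hji : j = i
  · subst hji
    have h1 := left_sub_of_mem_side hj
    rw [hF, left_triPoint] at h1
    exact (mul_pos hy'.2.1 ha).ne' h1
  · exact h j hji y' hy' hj

theorem triPoint_apex (i : Fin (D.m + 3)) (κ δ : ℝ) (w y : ℝ × ℝ) :
    triPoint (D.P i) (D.vec i) (D.P i + κ • D.vec i + δ • w) y =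
      D.P i + ((1 - y.2) * y.1 + y.2 * κ) • D.vec i + (y.2 * δ) • w := by
  rw [triPoint]
  module

/-- If the apex tends to a point of the base other than the end `E`, then the triangle finally
avoids any given segment that starts at `E`. -/
theorem eventually_notMem_segment {m ℓ : ℝ × ℝ →L[ℝ] ℝ} {E R w : ℝ × ℝ} {k : ℝ} (hk : 0 < k)
    (hw : 0 < ℓ w) : ∀ᶠ δ in 𝓝[>] (0 : ℝ), ∀ s > 0, ∀ x, ℓ (x - E) = s * δ * ℓ w →
      s * k + s * δ * m w ≤ m (x - E) → x ∉ segment ℝ E R := by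
  have h1 : ∀ᶠ δ in 𝓝[>] (0 : ℝ), δ * (ℓ w * m (R - E)) < (k + δ * m w) * ℓ (R - E) ∨
      ℓ (R - E) ≤ 0 := by
    rcases le_or_gt (ℓ (R - E)) 0 with h | h
    · exact Eventually.of_forall fun _ => Or.inr h
    · have hc : ContinuousAt
          (fun δ : ℝ => (k + δ * m w) * ℓ (R - E) - δ * (ℓ w * m (R - E))) 0 := by
        fun_prop
      have := hc.eventually (lt_mem_nhds (a := 0) (by simpa using mul_pos hk h))
      exact nhdsWithin_le_nhds (this.mono fun δ hδ => Or.inl (by linarith))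
  filter_upwards [h1, self_mem_nhdsWithin] with δ hδ hδ0 s hs x hl hm hx
  have hδ0 : 0 < δ := hδ0
  rw [segment_eq_image'] at hx
  obtain ⟨τ, ⟨hτ0, -⟩, rfl⟩ := hx
  simp only [add_sub_cancel_left, map_smul, smul_eq_mul] at hl hm
  have hpos : 0 < s * δ * ℓ w := by positivity
  have hle : 0 < ℓ (R - E) := by
    by_contra hn
    nlinarith [mul_nonneg hτ0 (neg_nonneg.mpr (not_lt.mp hn))]
  rcases hδ with hδ | hδ
  · have h2 : s * ((k + δ * m w) * ℓ (R - E)) ≤ s * (δ * (ℓ w * m (R - E))) := by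
      calc s * ((k + δ * m w) * ℓ (R - E)) = (s * k + s * δ * m w) * ℓ (R - E) := by ring
        _ ≤ (τ * m (R - E)) * ℓ (R - E) := by gcongr
        _ = (τ * ℓ (R - E)) * m (R - E) := by ring
        _ = s * (δ * (ℓ w * m (R - E))) := by rw [hl]; ring
    exact absurd (lt_of_mul_lt_mul_left (h2.trans_lt (mul_lt_mul_of_pos_left hδ hs)) hs.le)
      (lt_irrefl _)
  · linarith

theorem eventually_triPoint_notMem_of_disjoint {i j : Fin (D.m + 3)} {κ : ℝ} {w : ℝ × ℝ}
    (hκ : κ ∈ Icc (0 : ℝ) 1) (h : Disjoint (D.side i) (D.side j)) :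
    ∀ᶠ δ in 𝓝[>] (0 : ℝ), ∀ y ∈ Ioo (0 : ℝ) 1 ×ˢ Ioo (0 : ℝ) 1,
      triPoint (D.P i) (D.vec i) (D.P i + κ • D.vec i + δ • w) y ∉ D.side j := by
  obtain ⟨ρ, hρ, hd⟩ := h.exists_thickenings (isCompact_side i) (isCompact_side j).isClosed
  have hc : ContinuousAt (fun δ : ℝ => |δ| * ‖w‖) 0 := by fun_prop
  filter_upwards [nhdsWithin_le_nhds
    (hc.eventually (eventually_lt_nhds (b := ρ) (by simpa using hρ)))]
    with δ hδ y hy hx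
  refine Set.disjoint_left.mp hd ?_ (Metric.self_subset_thickening hρ _ hx)
  rw [triPoint_apex, Metric.mem_thickening_iff]
  refine ⟨D.P i + ((1 - y.2) * y.1 + y.2 * κ) • D.vec i, mem_side_iff.mpr ⟨_, ⟨?_, ?_⟩, rfl⟩, ?_⟩
  · have h1 := hy.1.1; have h2 := hy.2.1; have h3 := hy.2.2; have h4 := hκ.1
    have : 0 < 1 - y.2 := by linarith
    positivity
  · have h1 := hy.1.2; have h2 := hy.2.1; have h3 := hy.2.2; have h4 := hκ.2
    nlinarith
  · rw [dist_eq_norm, add_sub_cancel_left, norm_smul, Real.norm_eq_abs, abs_mul, abs_of_pos hy.2.1]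
    refine lt_of_le_of_lt ?_ hδ
    rw [mul_assoc]
    exact mul_le_of_le_one_left (by positivity) hy.2.2.le

/-- The thin triangles with base `i` and apex near the point with parameter `κ` of the base finally
avoid each other side `j`.  A neighbouring side of `γ_b` starts at an end of the base from which the
apex stays away; the side on the axis is avoided since the triangle lies in `r > 0`. -/
theorem eventually_triPoint_notMem {i j : Fin (D.m + 3)} (hi : i ≠ 0) (hij : j ≠ i) {κ : ℝ}
    {w : ℝ × ℝ} (hκ : κ ∈ Icc (0 : ℝ) 1) (hκ0 : κ = 0 → i = 1) (hκ1 : κ = 1 → i + 1 = 0)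
    (hw : 0 < D.left i w) (ha : ∀ᶠ δ in 𝓝[>] (0 : ℝ), 0 ≤ (D.P i + κ • D.vec i + δ • w).1) :
    ∀ᶠ δ in 𝓝[>] (0 : ℝ), ∀ y ∈ Ioo (0 : ℝ) 1 ×ˢ Ioo (0 : ℝ) 1,
      triPoint (D.P i) (D.vec i) (D.P i + κ • D.vec i + δ • w) y ∉ D.side j := by
  by_cases hj0 : j = 0
  · filter_upwards [ha] with δ hδ y hy hx
    rw [hj0] at hx
    have h1 := fst_eq_zero_of_mem_side_zero hx
    rw [fst_triPoint] at h1
    have h2 := mul_pos (sub_pos.mpr hy.2.2) (fst_side_pos hi hy.1)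
    have h3 := mul_nonneg hy.2.1.le hδ
    linarith
  by_cases hd : Disjoint (D.side i) (D.side j)
  · exact eventually_triPoint_notMem_of_disjoint hκ hd
  have hstart : ∀ R, 0 < κ → ∀ᶠ δ in 𝓝[>] (0 : ℝ), ∀ y ∈ Ioo (0 : ℝ) 1 ×ˢ Ioo (0 : ℝ) 1,
      triPoint (D.P i) (D.vec i) (D.P i + κ • D.vec i + δ • w) y ∉ segment ℝ (D.P i) R := by
    intro R hk
    filter_upwards [eventually_notMem_segment (m := D.along i) (E := D.P i) (R := R) hk hw]
      with δ hδ y hy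
    refine hδ y.2 hy.2.1 _ ?_ ?_
    · rw [triPoint_apex, add_assoc, add_sub_cancel_left, map_add, map_smul, map_smul, left_vec]
      simp
    · rw [triPoint_apex, add_assoc, add_sub_cancel_left, map_add, map_smul, map_smul, along_vec]
      simp only [smul_eq_mul, mul_one]
      have := mul_pos (sub_pos.mpr hy.2.2) hy.1.1
      linarith
  have hend : ∀ R, κ < 1 → ∀ᶠ δ in 𝓝[>] (0 : ℝ), ∀ y ∈ Ioo (0 : ℝ) 1 ×ˢ Ioo (0 : ℝ) 1,
      triPoint (D.P i) (D.vec i) (D.P i + κ • D.vec i + δ • w) y ∉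
        segment ℝ (D.P (i + 1)) R := by
    intro R hk
    filter_upwards [eventually_notMem_segment (m := -D.along i) (E := D.P (i + 1)) (R := R)
      (sub_pos.mpr hk) hw] with δ hδ y hy
    have e : triPoint (D.P i) (D.vec i) (D.P i + κ • D.vec i + δ • w) y - D.P (i + 1) =
        ((1 - y.2) * y.1 + y.2 * κ - 1) • D.vec i + (y.2 * δ) • w := by
      rw [triPoint_apex, vec]; module
    refine hδ y.2 hy.2.1 _ ?_ ?_
    · rw [e, map_add, map_smul, map_smul, left_vec]
      simp
    · rw [e, neg_apply, neg_apply, map_add, map_smul, map_smul, along_vec]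
      simp only [smul_eq_mul, mul_one]
      have := mul_pos (sub_pos.mpr hy.2.2) (sub_pos.mpr hy.1.2)
      linarith
  obtain ⟨x, hxi, hxj⟩ := Set.not_disjoint_iff.mp hd
  obtain ⟨h1, h2⟩ := D.simple i j hij.symm ⟨hxi, hxj⟩
  have hκ0' : κ ≠ 0 → 0 < κ := fun h => lt_of_le_of_ne hκ.1 (Ne.symm h)
  have hκ1' : κ ≠ 1 → κ < 1 := fun h => lt_of_le_of_ne hκ.2 h
  rcases h1 with h1 | h1 <;> rcases h2 with h2 | h2
  · exact absurd (D.injective_P (h2.symm.trans h1)) hij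
  · have he : j + 1 = i := D.injective_P (h2.symm.trans h1)
    have hκ' : 0 < κ := hκ0' fun h => hj0 (by
      have := hκ0 h
      rw [← he] at this
      simpa using this)
    rw [side, segment_symm, he]
    exact hstart _ hκ'
  · have he : j = i + 1 := D.injective_P (h2.symm.trans h1)
    have hκ' : κ < 1 := hκ1' fun h => hj0 (he.trans (hκ1 h))
    rw [side, he]
    exact hend _ hκ'
  · exact absurd (add_right_cancel (D.injective_P (h2.symm.trans h1))) hij

/-- Since `ω` lies to the left of the side on the axis and in `r > 0`, this side points
downwards. -/
theorem axis_lt : (D.P 1).2 < (D.P 0).2 := by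
  obtain ⟨x, hx⟩ : (openSegment ℝ (D.P 0) (D.P (0 + 1))).Nonempty :=
    ⟨_, mem_openSide_iff.mpr ⟨1 / 2, by norm_num, rfl⟩⟩
  obtain ⟨ε, ⟨h1, -⟩, h2⟩ := ((D.left_side 0 x hx).and self_mem_nhdsWithin).exists
  have h2 : 0 < ε := h2
  have h3 := D.pos _ h1
  have h4 := fst_eq_zero_of_mem_side_zero (openSide_subset 0 hx)
  simp only [rotLeft, zero_add, Prod.fst_add, Prod.smul_fst, h4, smul_eq_mul, Prod.snd_sub] at h3
  have := pos_of_mul_pos_right h3 h2.le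
  linarith

theorem one_add_one_ne_zero : (1 : Fin (D.m + 3)) + 1 ≠ 0 := by
  intro h
  have := congrArg Fin.val h
  simp only [Fin.val_add, Fin.val_one, Fin.val_zero] at this
  rw [Nat.mod_eq_of_lt (by omega)] at this
  omega

/-- On each side of `γ_b` there is a triangle inside `ω`; its apex is on the axis if the side ends
there, and is off the axis otherwise. -/
theorem exists_triangle {i : Fin (D.m + 3)} (hi : i ≠ 0) : ∃ a : ℝ × ℝ,
    0 < D.left i (a - D.P i) ∧ 0 ≤ a.1 ∧
    (∃ C, 0 ≤ C ∧ ∀ t ∈ Ioo (0 : ℝ) 1, a.1 ≤ C * ((D.P i).1 + t * (D.vec i).1)) ∧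
    ∀ y ∈ Ioo (0 : ℝ) 1 ×ˢ Ioo (0 : ℝ) 1, triPoint (D.P i) (D.vec i) a y ∈ D.ω := by
  obtain ⟨κ, w, hκ, hκ0, hκ1, hw, ha⟩ : ∃ (κ : ℝ) (w : ℝ × ℝ), κ ∈ Icc (0 : ℝ) 1 ∧
      (κ = 0 → i = 1) ∧ (κ = 1 → i + 1 = 0) ∧ 0 < D.left i w ∧
      ∀ᶠ δ in 𝓝[>] (0 : ℝ), 0 ≤ (D.P i + κ • D.vec i + δ • w).1 ∧
        ∃ C, 0 ≤ C ∧ ∀ t ∈ Ioo (0 : ℝ) 1,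
          (D.P i + κ • D.vec i + δ • w).1 ≤ C * ((D.P i).1 + t * (D.vec i).1) := by
    have hlt := D.axis_lt
    -- the sides `1` and `m + 2` end on the axis, and the apex is then on `γ_a`; in the other
    -- cases it is near the middle of the side
    by_cases h1 : i = 1
    · subst h1
      have hp : 0 < (D.P (1 + 1)).1 := D.off_axis _ one_add_one_ne_zero (by simp)
      refine ⟨0, D.P 0 - D.P 1, by simp, fun _ => rfl, by simp, ?_,
        Eventually.of_forall fun δ => ⟨?_, 0, le_rfl, fun t _ => ?_⟩⟩
      · rw [left_apply]
        simp only [vec, Prod.fst_sub, Prod.snd_sub, D.axis_zero, D.axis_one]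
        nlinarith
      · simp [D.axis_zero, D.axis_one]
      · simp [D.axis_zero, D.axis_one]
    by_cases h2 : i + 1 = 0
    · have hp : 0 < (D.P i).1 := D.off_axis _ hi h1
      refine ⟨1, D.P 1 - D.P 0, by simp, by simp, fun _ => h2, ?_,
        Eventually.of_forall fun δ => ⟨?_, 0, le_rfl, fun t _ => ?_⟩⟩
      · rw [left_apply]
        simp only [vec, h2, Prod.fst_sub, Prod.snd_sub, D.axis_zero, D.axis_one]
        nlinarith
      · simp [vec, h2, D.axis_zero, D.axis_one]
      · simp [vec, h2, D.axis_zero, D.axis_one]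
    · have hp : 0 < (D.P i).1 := D.off_axis _ hi h1
      have hq : 0 < (D.P (i + 1)).1 := D.off_axis _ h2 (by simpa using hi)
      refine ⟨1 / 2, rotLeft (D.vec i), by norm_num, by norm_num, by norm_num,
        left_rotLeft_pos i, ?_⟩
      have hc : ContinuousAt (fun δ : ℝ =>
          (D.P i + (1 / 2 : ℝ) • D.vec i + δ • rotLeft (D.vec i)).1) 0 := by fun_prop
      have hev := hc.eventually (lt_mem_nhds (a := 0) (by
        simp only [zero_smul, add_zero, Prod.fst_add, Prod.smul_fst, vec, Prod.fst_sub,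
          smul_eq_mul]
        linarith))
      refine nhdsWithin_le_nhds (hev.mono fun δ hδ => ⟨hδ.le, ?_⟩)
      set α := (D.P i + (1 / 2 : ℝ) • D.vec i + δ • rotLeft (D.vec i)).1
      have hmin := lt_min hp hq
      refine ⟨α / min (D.P i).1 (D.P (i + 1)).1, by positivity, fun t ht => ?_⟩
      rw [div_mul_eq_mul_div, le_div_iff₀ hmin]
      refine mul_le_mul_of_nonneg_left ?_ hδ.le
      have e : (D.P i).1 + t * (D.vec i).1 = (1 - t) * (D.P i).1 + t * (D.P (i + 1)).1 := by
        simp only [vec, Prod.fst_sub]; ring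
      rw [e]
      have h3 := mul_le_mul_of_nonneg_left (min_le_left (D.P i).1 (D.P (i + 1)).1)
        (sub_nonneg.mpr ht.2.le)
      have h4 := mul_le_mul_of_nonneg_left (min_le_right (D.P i).1 (D.P (i + 1)).1) ht.1.le
      linarith
  have hav : ∀ᶠ δ in 𝓝[>] (0 : ℝ), ∀ j, j ≠ i → ∀ y ∈ Ioo (0 : ℝ) 1 ×ˢ Ioo (0 : ℝ) 1,
      triPoint (D.P i) (D.vec i) (D.P i + κ • D.vec i + δ • w) y ∉ D.side j := by
    refine eventually_all.mpr fun j => ?_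
    by_cases hj : j = i
    · exact Eventually.of_forall fun _ h => absurd hj h
    · exact (eventually_triPoint_notMem hi hj hκ hκ0 hκ1 hw (ha.mono fun _ h => h.1)).mono
        fun _ h _ => h
  obtain ⟨δ, ⟨h1, h2⟩, h3, h4⟩ := (ha.and (hav.and self_mem_nhdsWithin)).exists
  have h4 : 0 < δ := h4
  have hl : 0 < D.left i (D.P i + κ • D.vec i + δ • w - D.P i) := by
    rw [add_assoc, add_sub_cancel_left, map_add, map_smul, map_smul, left_vec]
    simpa using mul_pos h4 hw
  exact ⟨_, hl, h1, h2, fun y hy => triPoint_mem hi hl h3 hy⟩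

end Polygon

/-! ### The trace inequality -/

/-- The density `|φ|² + |∇φ|²` of the squared norm of `H¹_1(ω)`. -/
def energy (φ : ℝ × ℝ → ℂ) (x : ℝ × ℝ) : ℝ :=
  ‖φ x‖ ^ 2 + ‖fderiv ℝ φ x (1, 0)‖ ^ 2 + ‖fderiv ℝ φ x (0, 1)‖ ^ 2

theorem energy_nonneg (φ : ℝ × ℝ → ℂ) (x : ℝ × ℝ) : 0 ≤ energy φ x := by
  unfold energy; positivity

theorem continuous_energy {φ : ℝ × ℝ → ℂ} (hφ : ContDiff ℝ (⊤ : ℕ∞) φ) :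
    Continuous (energy φ) := by
  have h1 := continuous_fderiv_apply' hφ (1, 0)
  have h2 := continuous_fderiv_apply' hφ (0, 1)
  have h3 := hφ.continuous
  unfold energy
  fun_prop

/-- The value at the base point of a segment to the apex of a triangle is controlled by the
energy on this segment.  The weight `1 - s` is the Jacobian of the parametrization, up to a
constant factor. -/
theorem mul_norm_sq_le_integral {A d a : ℝ × ℝ} {t C M : ℝ} (hC0 : 0 ≤ C) (ha : 0 ≤ a.1)
    (hr : 0 ≤ A.1 + t * d.1) (hC : a.1 ≤ C * (A.1 + t * d.1))
    (hM1 : |a.1 - (A.1 + t * d.1)| ≤ M) (hM2 : |a.2 - (A.2 + t * d.2)| ≤ M)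
    {φ : ℝ × ℝ → ℂ} (hφ : ContDiff ℝ (⊤ : ℕ∞) φ) :
    (A.1 + t * d.1) * ‖φ (A + t • d)‖ ^ 2 ≤ (C + 4 + 2 * M ^ 2) *
      ∫ s in (0 : ℝ)..1,
        (1 - s) * ((triPoint A d a (t, s)).1 * energy φ (triPoint A d a (t, s))) := by
  set v : ℝ × ℝ := a - (A + t • d) with hv
  have hv1 : v.1 = a.1 - (A.1 + t * d.1) := by simp [hv]
  have hv2 : v.2 = a.2 - (A.2 + t * d.2) := by simp [hv]
  set X : ℝ → ℝ × ℝ := fun s => triPoint A d a (t, s) with hX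
  have hXe : X = fun s => (A + t • d) + s • v := by
    funext s; simp only [hX, triPoint, hv]; module
  have hXd : ∀ s, HasDerivAt X v s := by
    intro s
    rw [hXe]
    simpa using ((hasDerivAt_id s).smul_const v).const_add (A + t • d)
  have hXc : Continuous X := (continuous_triPoint A d a).comp (by fun_prop)
  have hX1 : ∀ s, HasDerivAt (fun s => (X s).1) v.1 s := fun s => (hXd s).fst
  have hφd : ∀ s, HasDerivAt (fun s => φ (X s)) (fderiv ℝ φ (X s) v) s := fun s =>
    (hφ.differentiable (by simp) (X s)).hasFDerivAt.comp_hasDerivAt s (hXd s)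
  -- the derivative of `s ↦ (1 - s)² |φ|² r` along the segment; this function vanishes at the apex,
  -- and the factor `(1 - s)²` leaves the Jacobian `1 - s` in its derivative
  set h' : ℝ → ℝ := fun s => (2 * (1 - s) * (-1)) * (‖φ (X s)‖ ^ 2 * (X s).1) +
    (1 - s) ^ 2 * (2 * inner ℝ (φ (X s)) (fderiv ℝ φ (X s) v) * (X s).1 + ‖φ (X s)‖ ^ 2 * v.1)
    with hh'
  have hd : ∀ s, HasDerivAt (fun s => (1 - s) ^ 2 * (‖φ (X s)‖ ^ 2 * (X s).1)) (h' s) s := by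
    intro s
    have h1 : HasDerivAt (fun s : ℝ => (1 - s) ^ 2) (2 * (1 - s) * (-1)) s := by
      refine (((hasDerivAt_id s).const_sub 1).pow 2).congr_deriv ?_
      simp
    exact h1.mul ((hφd s).norm_sq.mul (hX1 s))
  have hcφ : Continuous fun s => φ (X s) := hφ.continuous.comp hXc
  have hcd : Continuous fun s => fderiv ℝ φ (X s) v := (continuous_fderiv_apply' hφ v).comp hXc
  have hc' : Continuous h' := by
    have := hcφ.inner (𝕜 := ℝ) hcd
    simp only [hh']
    fun_prop
  have hcE : Continuous fun s => (1 - s) * ((X s).1 * energy φ (X s)) := by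
    have := (continuous_energy hφ).comp hXc
    simp only [Function.comp_def] at this
    fun_prop
  have hfund := intervalIntegral.integral_eq_sub_of_hasDerivAt (a := 0) (b := 1)
    (fun s _ => hd s) (hc'.intervalIntegrable 0 1)
  have hX0 : X 0 = A + t • d := by simp [hXe]
  have h0 : (A.1 + t * d.1) * ‖φ (A + t • d)‖ ^ 2 = ∫ s in (0 : ℝ)..1, -h' s := by
    rw [intervalIntegral.integral_neg, hfund, hX0]
    simp
    ring
  rw [h0, ← intervalIntegral.integral_const_mul]
  refine intervalIntegral.integral_mono_on zero_le_one (hc'.neg.intervalIntegrable 0 1)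
    ((hcE.const_mul _).intervalIntegrable 0 1) fun s hs => ?_
  have hs1 : 0 ≤ 1 - s := by linarith [hs.2]
  have hs1' : 1 - s ≤ 1 := by linarith [hs.1]
  have hρ : (X s).1 = (1 - s) * (A.1 + t * d.1) + s * a.1 := fst_triPoint A d a (t, s)
  have hρ1 : (1 - s) * (A.1 + t * d.1) ≤ (X s).1 := by
    rw [hρ]; linarith [mul_nonneg hs.1 ha]
  have hρ0 : 0 ≤ (X s).1 := (mul_nonneg hs1 hr).trans hρ1
  have hM0 : 0 ≤ M := (abs_nonneg _).trans hM1
  -- `hC` bounds the derivative of the weight `r` along the segment by a multiple of `r / (1 - s)`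
  have hvr : (1 - s) * |v.1| ≤ (C + 1) * (X s).1 := by
    have h1 : |v.1| ≤ (C + 1) * (A.1 + t * d.1) := by
      rw [hv1]
      refine (abs_sub _ _).trans ?_
      rw [abs_of_nonneg ha, abs_of_nonneg hr]
      linarith
    calc (1 - s) * |v.1| ≤ (1 - s) * ((C + 1) * (A.1 + t * d.1)) := by gcongr
      _ = (C + 1) * ((1 - s) * (A.1 + t * d.1)) := by ring
      _ ≤ (C + 1) * (X s).1 := by gcongr
  set N := ‖φ (X s)‖ with hN
  set p := ‖fderiv ℝ φ (X s) (1, 0)‖ with hp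
  set q := ‖fderiv ℝ φ (X s) (0, 1)‖ with hq
  have hN0 : 0 ≤ N := norm_nonneg _
  have hp0 : 0 ≤ p := norm_nonneg _
  have hq0 : 0 ≤ q := norm_nonneg _
  have hDv : ‖fderiv ℝ φ (X s) v‖ ≤ M * (p + q) := by
    have e : v = v.1 • (1, 0) + v.2 • (0, 1) := by simp
    rw [e, map_add, map_smul, map_smul]
    refine (norm_add_le _ _).trans ?_
    rw [norm_smul, norm_smul, Real.norm_eq_abs, Real.norm_eq_abs, mul_add]
    have h1 : |v.1| ≤ M := hv1 ▸ hM1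
    have h2 : |v.2| ≤ M := hv2 ▸ hM2
    gcongr
  have hin : -(2 * inner ℝ (φ (X s)) (fderiv ℝ φ (X s) v)) ≤
      N ^ 2 + 2 * M ^ 2 * (p ^ 2 + q ^ 2) := by
    have h1 : -inner ℝ (φ (X s)) (fderiv ℝ φ (X s) v) ≤ N * (M * (p + q)) := by
      refine (neg_le_abs _).trans ((abs_real_inner_le_norm _ _).trans ?_)
      gcongr
    nlinarith [sq_nonneg (N - M * (p + q)), mul_nonneg (sq_nonneg M) (sq_nonneg (p - q))]
  have hE : energy φ (X s) = N ^ 2 + p ^ 2 + q ^ 2 := rfl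
  change -h' s ≤ (C + 4 + 2 * M ^ 2) * ((1 - s) * ((X s).1 * energy φ (X s)))
  rw [hE]
  set ρ := (X s).1 with hρdef
  set I := inner ℝ (φ (X s)) (fderiv ℝ φ (X s) v) with hI
  have e1 : -h' s = (1 - s) * (2 * (N ^ 2 * ρ) + (1 - s) * (-(2 * I)) * ρ -
      N ^ 2 * ((1 - s) * v.1)) := by
    simp only [hh']; ring
  rw [e1, mul_left_comm (C + 4 + 2 * M ^ 2) (1 - s)]
  refine mul_le_mul_of_nonneg_left ?_ hs1
  have h2 : (1 - s) * (-(2 * I)) * ρ ≤ (N ^ 2 + 2 * M ^ 2 * (p ^ 2 + q ^ 2)) * ρ := by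
    refine mul_le_mul_of_nonneg_right ?_ hρ0
    calc (1 - s) * (-(2 * I)) ≤ (1 - s) * (N ^ 2 + 2 * M ^ 2 * (p ^ 2 + q ^ 2)) := by gcongr
      _ ≤ 1 * (N ^ 2 + 2 * M ^ 2 * (p ^ 2 + q ^ 2)) := by gcongr
      _ = _ := one_mul _
  have h3 : -(N ^ 2 * ((1 - s) * v.1)) ≤ N ^ 2 * ((C + 1) * ρ) := by
    rw [← mul_neg, ← mul_neg]
    refine mul_le_mul_of_nonneg_left (le_trans ?_ hvr) (sq_nonneg N)
    exact mul_le_mul_of_nonneg_left (neg_le_abs _) hs1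
  have h4 : 0 ≤ (C + 4) * ρ * (p ^ 2 + q ^ 2) + 2 * M ^ 2 * (N ^ 2 * ρ) := by
    positivity
  linarith

/-- The trace inequality on one side, by integration of `mul_norm_sq_le_integral` over the side and
the change of variables `triPoint`. -/
theorem exists_side_bound (D : Polygon) {i : Fin (D.m + 3)} (hi : i ≠ 0) : ∃ C, 0 ≤ C ∧
    ∀ φ : ℝ × ℝ → ℂ, ContDiff ℝ (⊤ : ℕ∞) φ →
      ∫ t in Icc (0 : ℝ) 1, ((D.P i).1 + t * (D.vec i).1) * ‖φ (D.P i + t • D.vec i)‖ ^ 2 ≤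
        C * ∫ x in D.ω, x.1 * energy φ x := by
  obtain ⟨a, hΔ, ha, ⟨C, hC, hCa⟩, htri⟩ := Polygon.exists_triangle hi
  set A := D.P i
  set d := D.vec i
  have hdet : d.1 * (a - A).2 - d.2 * (a - A).1 = D.left i (a - A) := (Polygon.left_apply i _).symm
  set Δ := D.left i (a - A)
  set M := ‖a - A‖ + ‖d‖
  set K := C + 4 + 2 * M ^ 2 with hK
  have hK0 : 0 ≤ K := by positivity
  refine ⟨K * Δ⁻¹, by positivity, fun φ hφ => ?_⟩
  set Q : Set (ℝ × ℝ) := Ioo (0 : ℝ) 1 ×ˢ Ioo (0 : ℝ) 1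
  set F := triPoint A d a
  have hF : Continuous F := continuous_triPoint A d a
  have hQm : MeasurableSet Q := measurableSet_Ioo.prod measurableSet_Ioo
  have hcE : Continuous fun x : ℝ × ℝ => x.1 * energy φ x :=
    continuous_fst.mul (continuous_energy hφ)
  have hcG : Continuous fun y : ℝ × ℝ => (1 - y.2) * ((F y).1 * energy φ (F y)) :=
    (continuous_const.sub continuous_snd).mul (hcE.comp hF)
  have hGi : IntegrableOn (fun y : ℝ × ℝ => (1 - y.2) * ((F y).1 * energy φ (F y))) Q :=
    (hcG.continuousOn.integrableOn_compact (isCompact_Icc.prod isCompact_Icc)).mono_set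
      (Set.prod_mono Ioo_subset_Icc_self Ioo_subset_Icc_self)
  have hder : ∀ y, HasFDerivAt F (planeMap ((1 - y.2) • d) (a - (A + y.1 • d))) y := by
    intro y
    have h1 : HasFDerivAt (fun y : ℝ × ℝ => (1 - y.2) * y.1)
        ((1 - y.2) • ContinuousLinearMap.fst ℝ ℝ ℝ + y.1 • -ContinuousLinearMap.snd ℝ ℝ ℝ) y :=
      (hasFDerivAt_snd.const_sub 1).mul hasFDerivAt_fst
    have h2 := ((h1.smul_const d).const_add A).add
      ((hasFDerivAt_snd (𝕜 := ℝ) (p := y)).smul_const (a - A))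
    refine h2.congr_fderiv ?_
    ext <;> simp [planeMap_apply] <;> ring
  -- the collapsed edge `s = 1` is not in the open square `Q`
  have hinj : InjOn F Q := by
    intro y hy y' hy' h
    have h1 : planeMap d (a - A) ((1 - y.2) * y.1, y.2) =
        planeMap d (a - A) ((1 - y'.2) * y'.1, y'.2) := by
      have : A + planeMap d (a - A) ((1 - y.2) * y.1, y.2) =
          A + planeMap d (a - A) ((1 - y'.2) * y'.1, y'.2) := by
        rw [planeMap_apply, planeMap_apply, ← add_assoc, ← add_assoc]; exact h
      exact add_left_cancel this
    have h2 : ((1 - y.2) * y.1, y.2) = ((1 - y'.2) * y'.1, y'.2) :=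
      injective_planeMap (by rw [hdet]; exact hΔ.ne') h1
    have h3 : y.2 = y'.2 := (Prod.ext_iff.mp h2).2
    have h4 : (1 - y.2) * y.1 = (1 - y'.2) * y'.1 := (Prod.ext_iff.mp h2).1
    rw [← h3] at h4
    exact Prod.ext (mul_left_cancel₀ (by linarith [hy.2.2] : (1 - y.2) ≠ 0) h4) h3
  have hcv := integral_image_eq_integral_abs_det_fderiv_smul volume hQm
    (fun y _ => (hder y).hasFDerivWithinAt) hinj fun x => x.1 * energy φ x
  have hcv' : ∫ y in Q, (1 - y.2) * ((F y).1 * energy φ (F y)) =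
      Δ⁻¹ * ∫ x in F '' Q, x.1 * energy φ x := by
    rw [hcv, ← integral_const_mul]
    refine setIntegral_congr_fun hQm fun y hy => ?_
    have h1 : (planeMap ((1 - y.2) • d) (a - (A + y.1 • d))).det = (1 - y.2) * Δ := by
      rw [det_planeMap, ← hdet]
      simp
      ring
    have h2 : 0 < 1 - y.2 := by linarith [hy.2.2]
    simp only [h1, smul_eq_mul]
    rw [abs_of_pos (mul_pos h2 hΔ)]
    field_simp
  have hle : ∫ x in F '' Q, x.1 * energy φ x ≤ ∫ x in D.ω, x.1 * energy φ x := by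
    refine setIntegral_mono_set ?_ ?_ (Eventually.of_forall ?_)
    · obtain ⟨R, hR⟩ := D.isBounded.subset_closedBall 0
      exact (hcE.continuousOn.integrableOn_compact (isCompact_closedBall 0 R)).mono_set hR
    · filter_upwards [ae_restrict_mem D.measurableSet] with x hx
      exact mul_nonneg (D.pos x hx).le (energy_nonneg φ x)
    · rintro x ⟨y, hy, rfl⟩
      exact htri y hy
  have hb : ∀ t ∈ Ioo (0 : ℝ) 1, (A.1 + t * d.1) * ‖φ (A + t • d)‖ ^ 2 ≤
      K * ∫ s in Ioo (0 : ℝ) 1, (1 - s) * ((F (t, s)).1 * energy φ (F (t, s))) := by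
    intro t ht
    have hv : ‖a - (A + t • d)‖ ≤ M := by
      rw [← sub_sub]
      refine (norm_sub_le _ _).trans ?_
      rw [norm_smul, Real.norm_eq_abs, abs_of_pos ht.1]
      exact add_le_add_right (mul_le_of_le_one_left (norm_nonneg _) ht.2.le) _
    have h1 := mul_norm_sq_le_integral (M := M) hC ha (Polygon.fst_side_pos hi ht).le (hCa t ht)
      (by simpa using (norm_fst_le _).trans hv) (by simpa using (norm_snd_le _).trans hv) hφ
    rwa [intervalIntegral.integral_of_le zero_le_one, integral_Ioc_eq_integral_Ioo] at h1
  rw [integral_Icc_eq_integral_Ioc, integral_Ioc_eq_integral_Ioo, mul_assoc]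
  have hGi' : Integrable (fun y : ℝ × ℝ => (1 - y.2) * ((F y).1 * energy φ (F y)))
      ((volume.restrict (Ioo (0 : ℝ) 1)).prod (volume.restrict (Ioo (0 : ℝ) 1))) := by
    rw [Measure.prod_restrict, ← Measure.volume_eq_prod]; exact hGi
  calc ∫ t in Ioo (0 : ℝ) 1, (A.1 + t * d.1) * ‖φ (A + t • d)‖ ^ 2
      ≤ ∫ t in Ioo (0 : ℝ) 1, K * ∫ s in Ioo (0 : ℝ) 1,
          (1 - s) * ((F (t, s)).1 * energy φ (F (t, s))) := by
        refine setIntegral_mono_on ?_ (hGi'.integral_prod_left.const_mul K) measurableSet_Ioo hb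
        have hc : Continuous fun t : ℝ => (A.1 + t * d.1) * ‖φ (A + t • d)‖ ^ 2 := by
          have h1 : Continuous fun t : ℝ => φ (A + t • d) := hφ.continuous.comp (by fun_prop)
          fun_prop
        exact (hc.continuousOn.integrableOn_compact isCompact_Icc).mono_set Ioo_subset_Icc_self
    _ = K * ∫ y in Q, (1 - y.2) * ((F y).1 * energy φ (F y)) := by
        rw [integral_const_mul, Measure.volume_eq_prod, setIntegral_prod _ hGi]
    _ ≤ K * (Δ⁻¹ * ∫ x in D.ω, x.1 * energy φ x) := by
        rw [hcv']; gcongr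

/-! ### Smooth elements of `H¹_1(ω)` and density -/

/-- Representatives of the three components of an element of `L²_1(ω)³`. -/
def funs {D : Polygon} (u : L2Triple D) : Fin 3 → ℝ × ℝ → ℂ := fun i => u i

theorem memL2_funs {D : Polygon} (u : L2Triple D) : MemL2 D (funs u) := fun i => Lp.memLp (u i)

/-- The element of `L²_1(ω)³` with given representatives. -/
def toTriple {D : Polygon} {U : Fin 3 → ℝ × ℝ → ℂ} (hU : MemL2 D U) : L2Triple D :=
  WithLp.toLp 2 fun i => (hU i).toLp (U i)

theorem funs_toTriple_ae {D : Polygon} {U : Fin 3 → ℝ × ℝ → ℂ} (hU : MemL2 D U) (i : Fin 3) :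
    funs (toTriple hU) i =ᵐ[wt D.ω 1] U i := (hU i).coeFn_toLp

theorem pairing_congr_ae {D : Polygon} {w w' u u' : Fin 3 → ℝ × ℝ → ℂ}
    (hw : ∀ i, w i =ᵐ[wt D.ω 1] w' i) (hu : ∀ i, u i =ᵐ[wt D.ω 1] u' i) :
    pairing D w u = pairing D w' u' := by
  refine integral_congr_ae ?_
  filter_upwards [eventually_all.mpr hw, eventually_all.mpr hu] with x h1 h2
  simp only [h1, h2]

theorem inner_eq_pairing {D : Polygon} (w u : L2Triple D) :
    inner ℂ w u = pairing D (fun i x => starRingEnd ℂ (funs w i x)) (funs u) := by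
  have hw : MemL2 D fun i x => starRingEnd ℂ (funs w i x) := fun i => (memL2_funs w i).star
  rw [pairing_eq_sum hw (memL2_funs u), PiLp.inner_apply]
  refine Finset.sum_congr rfl fun i _ => ?_
  rw [L2.inner_def]
  refine integral_congr_ae (Eventually.of_forall fun x => ?_)
  simp only [RCLike.inner_apply, funs]
  ring

/-- The Hilbert space argument for density: it suffices to test with triples of functions, paired
without conjugation. -/
theorem dense_span_of_pairing {D : Polygon} {V : Submodule ℂ (L2Triple D)} {S : Set V}
    (h : ∀ w, MemL2 D w → (∀ k ∈ S, pairing D w (funs k.1) = 0) →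
      ∀ u : V, pairing D w (funs u.1) = 0) : Dense (Submodule.span ℂ S : Set V) := by
  intro u
  rw [Topology.IsInducing.subtypeVal.closure_eq_preimage_closure_image, mem_preimage]
  set K : Submodule ℂ (L2Triple D) := (Submodule.span ℂ S).map V.subtype with hK
  change (u : L2Triple D) ∈ closure (K : Set (L2Triple D))
  rw [← Submodule.topologicalClosure_coe, SetLike.mem_coe,
    ← Submodule.orthogonal_orthogonal_eq_closure]
  intro w hw
  rw [inner_eq_pairing]
  refine h _ (fun i => (memL2_funs w i).star) (fun k hk => ?_) u
  have h1 : inner ℂ (k : L2Triple D) w = 0 :=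
    hw _ (Submodule.mem_map_of_mem (Submodule.subset_span hk))
  refine (inner_eq_pairing w (k : L2Triple D)).symm.trans ?_
  rw [← inner_conj_symm, h1, map_zero]

theorem ae_eq_zero_of_isTest {D : Polygon} {f : ℝ × ℝ → ℂ} (hf : Integrable f (wt D.ω 1))
    (h : ∀ φ, IsTest D.ω φ → ∫ x in D.ω, f x * φ x = 0) : f =ᵐ[wt D.ω 1] 0 := by
  have h1 : IntegrableOn (fun x => x.1 • f x) D.ω := (integrable_wt_one_iff D).mp hf
  have h2 := D.isOpen.ae_eq_zero_of_integral_contDiff_smul_eq_zero (μ := volume)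
    (f := D.ω.indicator fun x => x.1 • f x)
    (((integrable_indicator_iff D.measurableSet).mpr h1).locallyIntegrable.locallyIntegrableOn _)
    (fun g hg hgc hgs => ?_)
  · refine (ae_wt_iff D 1).mpr ?_
    filter_upwards [ae_restrict_of_ae h2, ae_restrict_mem D.measurableSet] with x hx hxω
    have h3 := hx hxω
    rw [indicator_of_mem hxω, smul_eq_zero] at h3
    exact h3.resolve_left (D.pos x hxω).ne'
  · have hsub : tsupport (fun x : ℝ × ℝ => x.1 * g x) ⊆ tsupport g := tsupport_mul_subset_right
    have ht : IsTest D.ω fun x => ((x.1 * g x : ℝ) : ℂ) := by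
      refine ⟨ofReal_contDiff (contDiff_fst.mul hg), ?_, ?_⟩
      · rw [HasCompactSupport, tsupport_ofReal (f := fun x : ℝ × ℝ => x.1 * g x)]
        exact hgc.of_isClosed_subset (isClosed_tsupport _) hsub
      · rw [tsupport_ofReal (f := fun x : ℝ × ℝ => x.1 * g x)]
        exact hsub.trans hgs
    rw [← h _ ht, ← integral_indicator D.measurableSet]
    congr 1; ext x
    by_cases hx : x ∈ D.ω <;> simp [hx]
    ring

theorem IsWeakDeriv.ae_unique {D : Polygon} {e : ℝ × ℝ} {u g g' : ℝ × ℝ → ℂ}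
    (h : IsWeakDeriv D.ω e u g) (h' : IsWeakDeriv D.ω e u g') (hg : MemLp g 2 (wt D.ω 1))
    (hg' : MemLp g' 2 (wt D.ω 1)) : g =ᵐ[wt D.ω 1] g' := by
  have := isFiniteMeasure_wt_one D
  have h0 : (fun x => g x - g' x) =ᵐ[wt D.ω 1] 0 := by
    refine ae_eq_zero_of_isTest ((hg.sub hg').integrable one_le_two) fun φ hφ => ?_
    simp only [sub_mul]
    rw [integral_sub (integrableOn_mul_test D hg hφ.smooth.continuous hφ.compact hφ.supp)
      (integrableOn_mul_test D hg' hφ.smooth.continuous hφ.compact hφ.supp)]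
    rw [sub_eq_zero, ← neg_inj, ← h φ hφ, ← h' φ hφ]
  filter_upwards [h0] with x hx
  exact sub_eq_zero.mp hx

theorem mem_H1_iff {D : Polygon} {u : L2Triple D} : u ∈ H1 D ↔ IsGradIn D D.ω (funs u) :=
  ⟨fun h => Fin.forall_fin_two.mpr ⟨h.1, h.2⟩, fun h => ⟨h 0, h 1⟩⟩

theorem isGradIn_gradOf (D : Polygon) {φ : ℝ × ℝ → ℂ} (hφ : ContDiff ℝ (⊤ : ℕ∞) φ) :
    IsGradIn D D.ω (gradOf φ) := by
  intro i ψ hψ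
  change ∫ x in D.ω, φ x * fderiv ℝ ψ x (dir i) = -∫ x in D.ω, fderiv ℝ φ x (dir i) * ψ x
  have hl : IsLocalSmooth D fun x => φ x * ψ x := by
    have := (IsLocalSmooth.mk hψ.smooth hψ.compact (Or.inl hψ.supp) : IsLocalSmooth D ψ).mul hφ
    simpa only [mul_comm] using this
  have h1 := hl.integral_fderiv (dir i)
  have h2 : ∀ x, fderiv ℝ (fun x => φ x * ψ x) x (dir i) =
      φ x * fderiv ℝ ψ x (dir i) + fderiv ℝ φ x (dir i) * ψ x := by
    intro x
    rw [fderiv_fun_mul (hφ.differentiable (by simp) x) (hψ.smooth.differentiable (by simp) x)]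
    simp [mul_comm]
  have h3 : ∀ j, ∫ x, φ x * ψ x ∂(sideMeasure D j) = 0 := by
    intro j
    refine integral_eq_zero_of_ae ((ae_sideMeasure_mem D j).mono fun x hx => ?_)
    have : ψ x = 0 := image_eq_zero_of_notMem_tsupport fun hn =>
      Polygon.notMem_of_mem_side hx (hψ.supp hn)
    simp [this]
  simp_rw [h3, mul_zero, Finset.sum_const_zero, h2] at h1
  rw [integral_add] at h1
  · exact eq_neg_of_add_eq_zero_left h1
  · exact ((hφ.continuous.mul
      (continuous_fderiv_apply' hψ.smooth _)).integrable_of_hasCompactSupport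
      ((hψ.compact.fderiv_apply (𝕜 := ℝ) _).mul_left)).integrableOn
  · exact (((continuous_fderiv_apply' hφ _).mul
      hψ.smooth.continuous).integrable_of_hasCompactSupport hψ.compact.mul_left).integrableOn

/-- The smooth functions on the plane. -/
def smoothFun : Submodule ℂ (ℝ × ℝ → ℂ) where
  carrier := {φ | ContDiff ℝ (⊤ : ℕ∞) φ}
  add_mem' {φ ψ} h h' := by
    rw [mem_ofPred_eq] at h h' ⊢
    exact h.add h'
  zero_mem' := by
    rw [mem_ofPred_eq]
    exact contDiff_const
  smul_mem' c φ h := by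
    rw [mem_ofPred_eq] at h ⊢
    exact contDiff_const.smul h

theorem gradOf_add {φ ψ : ℝ × ℝ → ℂ} (hφ : ContDiff ℝ (⊤ : ℕ∞) φ) (hψ : ContDiff ℝ (⊤ : ℕ∞) ψ)
    (i : Fin 3) : gradOf (φ + ψ) i = gradOf φ i + gradOf ψ i := by
  refine Fin.cases rfl (fun j => ?_) i
  funext x
  change fderiv ℝ (φ + ψ) x (dir j) = fderiv ℝ φ x (dir j) + fderiv ℝ ψ x (dir j)
  rw [fderiv_add (hφ.differentiable (by simp) x) (hψ.differentiable (by simp) x)]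
  rfl

theorem gradOf_smul {φ : ℝ × ℝ → ℂ} (c : ℂ) (hφ : ContDiff ℝ (⊤ : ℕ∞) φ) (i : Fin 3) :
    gradOf (c • φ) i = c • gradOf φ i := by
  refine Fin.cases rfl (fun j => ?_) i
  funext x
  change fderiv ℝ (c • φ) x (dir j) = c • fderiv ℝ φ x (dir j)
  rw [fderiv_const_smul (hφ.differentiable (by simp) x)]
  rfl

/-- The element of `H¹_1(ω)` given by a function that is smooth up to the boundary. -/
def smoothToH1 (D : Polygon) : smoothFun →ₗ[ℂ] H1 D where
  toFun φ := ⟨toTriple (memL2_gradOf D φ.2), mem_H1_iff.mpr fun i => by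
    have h := funs_toTriple_ae (memL2_gradOf D φ.2)
    exact IsWeakDeriv.congr (isGradIn_gradOf D φ.2 i) (h 0) (h i.succ)⟩
  map_add' φ ψ := by
    refine Subtype.ext (PiLp.ext fun i => ?_)
    refine (MemLp.toLp_congr (memL2_gradOf D (φ + ψ).2 i)
      ((memL2_gradOf D φ.2 i).add (memL2_gradOf D ψ.2 i)) (Eventually.of_forall fun x => ?_)).trans
      (MemLp.toLp_add (memL2_gradOf D φ.2 i) (memL2_gradOf D ψ.2 i))
    exact congrFun (gradOf_add φ.2 ψ.2 i) x
  map_smul' c φ := by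
    refine Subtype.ext (PiLp.ext fun i => ?_)
    refine (MemLp.toLp_congr (memL2_gradOf D (c • φ).2 i)
      ((memL2_gradOf D φ.2 i).const_smul c) (Eventually.of_forall fun x => ?_)).trans
      (MemLp.toLp_const_smul c (memL2_gradOf D φ.2 i))
    exact congrFun (gradOf_smul c φ.2 i) x

theorem funs_smoothToH1_ae (D : Polygon) (φ : smoothFun) (i : Fin 3) :
    funs (smoothToH1 D φ).1 i =ᵐ[wt D.ω 1] gradOf φ i :=
  funs_toTriple_ae (memL2_gradOf D φ.2) i

theorem eq_smoothToH1 {D : Polygon} {u : H1 D} {φ : ℝ × ℝ → ℂ} (hφ : ContDiff ℝ (⊤ : ℕ∞) φ)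
    (h : u.1 0 =ᵐ[wt D.ω 1] φ) : u = smoothToH1 D ⟨φ, hφ⟩ := by
  refine Subtype.ext (PiLp.ext fun i => Lp.ext ?_)
  have h1 := funs_smoothToH1_ae D ⟨φ, hφ⟩
  refine Fin.cases (h.trans (h1 0).symm) (fun j => ?_) i
  have h2 : IsWeakDeriv D.ω (dir j) φ (funs u.1 j.succ) :=
    IsWeakDeriv.congr (mem_H1_iff.mp u.2 j) h.symm EventuallyEq.rfl
  exact (h2.ae_unique (isGradIn_gradOf D hφ j) (memL2_funs _ _) (memL2_gradOf D hφ _)).trans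
    (h1 j.succ).symm

theorem L2_norm_sq_eq {α : Type*} [MeasurableSpace α] {μ : Measure α} (f : Lp ℂ 2 μ) :
    ‖f‖ ^ 2 = ∫ x, ‖f x‖ ^ 2 ∂μ := by
  have h1 := inner_self_eq_norm_sq_to_K (𝕜 := ℂ) f
  rw [L2.inner_def] at h1
  have h2 : ∫ x, inner ℂ (f x) (f x) ∂μ = ((∫ x, ‖f x‖ ^ 2 ∂μ : ℝ) : ℂ) := by
    rw [← integral_complex_ofReal]
    refine integral_congr_ae (Eventually.of_forall fun x => ?_)
    simp only [inner_self_eq_norm_sq_to_K]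
    norm_cast
  rw [h2] at h1
  exact (Complex.ofReal_injective (by rw [h1]; push_cast; rfl)).symm

theorem norm_sq_smoothToH1 (D : Polygon) (φ : smoothFun) :
    ‖smoothToH1 D φ‖ ^ 2 = ∫ x, energy φ x ∂(wt D.ω 1) := by
  rw [Submodule.coe_norm, PiLp.norm_sq_eq_of_L2]
  have h1 : ∀ i, ‖(smoothToH1 D φ).1 i‖ ^ 2 = ∫ x, ‖gradOf φ i x‖ ^ 2 ∂(wt D.ω 1) := by
    intro i
    rw [L2_norm_sq_eq]
    refine integral_congr_ae ((funs_smoothToH1_ae D φ i).mono fun x hx => ?_)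
    simp only [← hx, funs]
  simp_rw [h1]
  rw [← integral_finsetSum]
  · refine integral_congr_ae (Eventually.of_forall fun x => ?_)
    simp only [Fin.sum_univ_three, energy]
    rfl
  · intro i _
    exact (memL2_gradOf D φ.2 i).integrable_norm_pow two_ne_zero

theorem dense_span_isLocalSmooth (D : Polygon) : Dense (Submodule.span ℂ
    {u : H1 D | ∃ (φ : ℝ × ℝ → ℂ) (h : IsLocalSmooth D φ), u = smoothToH1 D ⟨φ, h.smooth⟩} :
      Set (H1 D)) := by
  refine dense_span_of_pairing fun w hw hw0 u => ?_
  refine pairing_eq_zero_of_isLocalSmooth hw (fun φ hφ => ?_) (memL2_funs _) (mem_H1_iff.mp u.2)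
  rw [← hw0 _ ⟨φ, hφ, rfl⟩]
  exact pairing_congr_ae (fun _ => EventuallyEq.rfl)
    fun i => (funs_smoothToH1_ae D ⟨φ, hφ.smooth⟩ i).symm

theorem denseRange_smoothToH1 (D : Polygon) : DenseRange (smoothToH1 D) := by
  have h1 : Submodule.span ℂ {u : H1 D | ∃ (φ : ℝ × ℝ → ℂ) (h : IsLocalSmooth D φ),
      u = smoothToH1 D ⟨φ, h.smooth⟩} ≤ LinearMap.range (smoothToH1 D) := by
    rw [Submodule.span_le]
    rintro u ⟨φ, h, rfl⟩
    exact LinearMap.mem_range_self _ _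
  exact (dense_span_isLocalSmooth D).mono h1

/-! ### The measure on `γ_b` and the trace operator -/

/-- The measure `r dγ` on one side. -/
def sideWt (D : Polygon) (i : Fin (D.m + 3)) : Measure (ℝ × ℝ) :=
  (sideMeasure D i).withDensity fun x => ENNReal.ofReal x.1

theorem measurable_ofReal_fst : Measurable fun x : ℝ × ℝ => ENNReal.ofReal x.1 := by fun_prop

theorem bdryMeasure_eq_sum (D : Polygon) : bdryMeasure D = ∑ i ∈ sidesB D, sideWt D i := by
  ext s hs
  simp only [bdryMeasure, sideWt, withDensity_apply _ hs, Measure.finsetSum_apply]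
  simp only [← lintegral_indicator hs, lintegral_finsetSum_measure]

theorem sideWt_le_bdryMeasure {D : Polygon} {i : Fin (D.m + 3)} (hi : i ∈ sidesB D) :
    sideWt D i ≤ bdryMeasure D := by
  rw [bdryMeasure_eq_sum]
  exact Finset.single_le_sum (f := fun i => sideWt D i) (fun _ _ => Measure.zero_le _) hi

theorem ae_fst_nonneg_sideMeasure (D : Polygon) (i : Fin (D.m + 3)) :
    ∀ᵐ x ∂(sideMeasure D i), 0 ≤ x.1 := by
  filter_upwards [ae_sideMeasure_mem D i] with x hx
  obtain ⟨t, ht, rfl⟩ := Polygon.mem_side_iff.mp hx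
  have h1 := Polygon.fst_vertex_nonneg (D := D) i
  have h2 := Polygon.fst_vertex_nonneg (D := D) (i + 1)
  have e : (D.P i + t • D.vec i).1 = (1 - t) * (D.P i).1 + t * (D.P (i + 1)).1 := by
    simp [Polygon.vec]; ring
  rw [e]
  have := mul_nonneg (sub_nonneg.mpr ht.2) h1
  have := mul_nonneg ht.1 h2
  linarith

theorem integral_sideWt (D : Polygon) (i : Fin (D.m + 3)) {E : Type*} [NormedAddCommGroup E]
    [NormedSpace ℝ E] (f : ℝ × ℝ → E) :
    ∫ x, f x ∂(sideWt D i) = ∫ x, x.1 • f x ∂(sideMeasure D i) := by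
  rw [sideWt, integral_withDensity_eq_integral_toReal_smul measurable_ofReal_fst
    (Eventually.of_forall fun _ => ENNReal.ofReal_lt_top)]
  refine integral_congr_ae ((ae_fst_nonneg_sideMeasure D i).mono fun x hx => ?_)
  simp only [ENNReal.toReal_ofReal hx]

theorem isFiniteMeasure_sideWt (D : Polygon) (i : Fin (D.m + 3)) :
    IsFiniteMeasure (sideWt D i) := by
  have h1 : Integrable (fun x : ℝ × ℝ => x.1) (sideMeasure D i) :=
    integrable_sideMeasure continuous_fst
  exact isFiniteMeasure_withDensity_ofReal h1.2

theorem integrable_bdryMeasure (D : Polygon) {E : Type*} [NormedAddCommGroup E]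
    [SecondCountableTopologyEither (ℝ × ℝ) E] {f : ℝ × ℝ → E} (hf : Continuous f) :
    Integrable f (bdryMeasure D) := by
  rw [bdryMeasure_eq_sum, integrable_finsetSum_measure]
  intro i _
  have := isFiniteMeasure_sideWt D i
  obtain ⟨C, hC⟩ := exists_bound_side (D := D) (i := i) hf
  exact Integrable.of_bound hf.aestronglyMeasurable C
    ((withDensity_absolutelyContinuous _ _).ae_le hC)

theorem memLp_bdryMeasure (D : Polygon) {f : ℝ × ℝ → ℂ} (hf : Continuous f) :
    MemLp f 2 (bdryMeasure D) := by
  rw [memLp_two_iff_integrable_sq_norm hf.aestronglyMeasurable]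
  exact integrable_bdryMeasure D (by fun_prop)

theorem exists_trace_bound (D : Polygon) : ∃ C, 0 ≤ C ∧ ∀ φ : ℝ × ℝ → ℂ,
    ContDiff ℝ (⊤ : ℕ∞) φ →
      ∫ x, ‖φ x‖ ^ 2 ∂(bdryMeasure D) ≤ C * ∫ x, energy φ x ∂(wt D.ω 1) := by
  have h : ∀ i : Fin (D.m + 3), ∃ C, 0 ≤ C ∧ (i ≠ 0 → ∀ φ : ℝ × ℝ → ℂ,
      ContDiff ℝ (⊤ : ℕ∞) φ →
      ∫ x, ‖φ x‖ ^ 2 ∂(sideWt D i) ≤ C * ∫ x, energy φ x ∂(wt D.ω 1)) := by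
    intro i
    by_cases hi : i = 0
    · exact ⟨0, le_rfl, fun h => absurd hi h⟩
    obtain ⟨C, hC, hb⟩ := exists_side_bound D hi
    have hL := euclLength_pos (D := D) i
    refine ⟨euclLength (D.vec i) * C, by positivity, fun _ φ hφ => ?_⟩
    rw [integral_sideWt, integral_sideMeasure, integral_wt_one, mul_assoc, smul_eq_mul]
    refine mul_le_mul_of_nonneg_left ?_ hL.le
    simpa using hb φ hφ
  choose C hC hb using h
  refine ⟨∑ i ∈ sidesB D, C i, Finset.sum_nonneg fun i _ => hC i, fun φ hφ => ?_⟩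
  have hi : Integrable (fun x => ‖φ x‖ ^ 2) (bdryMeasure D) :=
    integrable_bdryMeasure D (by have := hφ.continuous; fun_prop)
  rw [bdryMeasure_eq_sum, integral_finsetSum_measure, Finset.sum_mul]
  · exact Finset.sum_le_sum fun i hi => hb i (Finset.ne_of_mem_erase hi) φ hφ
  · exact fun i hi' => hi.mono_measure (sideWt_le_bdryMeasure hi')

theorem smoothFun.continuous (φ : smoothFun) : Continuous (φ : ℝ × ℝ → ℂ) :=
  ContDiff.continuous (𝕜 := ℝ) (n := (⊤ : ℕ∞)) φ.2

/-- Restriction of smooth functions to `γ_b`. -/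
def smoothToBdry (D : Polygon) : smoothFun →ₗ[ℂ] Lp ℂ 2 (bdryMeasure D) where
  toFun φ := (memLp_bdryMeasure D (smoothFun.continuous φ)).toLp φ
  map_add' φ ψ := MemLp.toLp_add (memLp_bdryMeasure D (smoothFun.continuous φ))
    (memLp_bdryMeasure D (smoothFun.continuous ψ))
  map_smul' c φ := MemLp.toLp_const_smul c (memLp_bdryMeasure D (smoothFun.continuous φ))

theorem smoothToBdry_ae (D : Polygon) (φ : smoothFun) :
    smoothToBdry D φ =ᵐ[bdryMeasure D] φ :=
  (memLp_bdryMeasure D (smoothFun.continuous φ)).coeFn_toLp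

theorem exists_norm_smoothToBdry_le (D : Polygon) :
    ∃ C, ∀ φ, ‖smoothToBdry D φ‖ ≤ C * ‖smoothToH1 D φ‖ := by
  obtain ⟨C, hC, h⟩ := exists_trace_bound D
  refine ⟨Real.sqrt C, fun φ => ?_⟩
  refine le_of_sq_le_sq ?_ (by positivity)
  rw [mul_pow, Real.sq_sqrt hC, norm_sq_smoothToH1, L2_norm_sq_eq]
  refine le_trans (le_of_eq ?_) (h φ φ.2)
  refine integral_congr_ae ((smoothToBdry_ae D φ).mono fun x hx => ?_)
  simp only [hx]

/-- The trace operator on `γ_b`, the continuous extension of the restriction of smooth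
functions. -/
def traceOp (D : Polygon) : H1 D →L[ℂ] Lp ℂ 2 (bdryMeasure D) :=
  (smoothToBdry D).extendOfNorm (smoothToH1 D)

theorem isTraceOp_traceOp (D : Polygon) : IsTraceOp D (traceOp D) := by
  intro u φ hφ h
  rw [eq_smoothToH1 hφ h, traceOp, LinearMap.extendOfNorm_eq (denseRange_smoothToH1 D)
    (exists_norm_smoothToBdry_le D)]
  exact smoothToBdry_ae D _

theorem IsTraceOp.apply_smoothToH1 {D : Polygon} {T : H1 D →L[ℂ] Lp ℂ 2 (bdryMeasure D)}
    (hT : IsTraceOp D T) (φ : smoothFun) : T (smoothToH1 D φ) =ᵐ[bdryMeasure D] φ :=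
  hT _ _ φ.2 (funs_smoothToH1_ae D φ 0)

theorem IsTraceOp.unique {D : Polygon} {T T' : H1 D →L[ℂ] Lp ℂ 2 (bdryMeasure D)}
    (hT : IsTraceOp D T) (hT' : IsTraceOp D T') : T = T' := by
  refine DFunLike.coe_injective ((denseRange_smoothToH1 D).equalizer T.continuous T'.continuous ?_)
  funext φ
  exact Lp.ext ((hT.apply_smoothToH1 φ).trans (hT'.apply_smoothToH1 φ).symm)

/-- The functional `f ↦ ∫ f g r dγ` over one side is continuous on `L²(γ_b, r dγ)`. -/
theorem exists_sideFunctional {D : Polygon} {i : Fin (D.m + 3)} (hi : i ∈ sidesB D)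
    {g : ℝ × ℝ → ℂ} (hg : Continuous g) : ∃ ℓ : Lp ℂ 2 (bdryMeasure D) →L[ℂ] ℂ,
      ∀ f, ℓ f = ∫ x, f x * g x * (x.1 : ℂ) ∂(sideMeasure D i) := by
  have hle := sideWt_le_bdryMeasure hi
  have hgm := memLp_bdryMeasure D hg
  have hint : ∀ f : Lp ℂ 2 (bdryMeasure D), Integrable (fun x => f x * g x) (bdryMeasure D) :=
    fun f => (Lp.memLp f).integrable_mul hgm
  have hac : (ae (sideWt D i)) ≤ ae (bdryMeasure D) := ae_mono hle
  refine ⟨LinearMap.mkContinuous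
    { toFun := fun f => ∫ x, f x * g x ∂(sideWt D i)
      map_add' := fun f f' => ?_
      map_smul' := fun c f => ?_ } (eLpNorm g 2 (bdryMeasure D)).toReal fun f => ?_, fun f => ?_⟩
  · rw [← integral_add ((hint f).mono_measure hle) ((hint f').mono_measure hle)]
    refine integral_congr_ae (hac ((Lp.coeFn_add f f').mono fun x hx => ?_))
    simp only [hx, Pi.add_apply, add_mul]
  · rw [← integral_smul]
    refine integral_congr_ae (hac ((Lp.coeFn_smul c f).mono fun x hx => ?_))
    simp only [hx, Pi.smul_apply, smul_mul_assoc, RingHom.id_apply]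
  · calc ‖∫ x, f x * g x ∂(sideWt D i)‖ ≤ ∫ x, ‖f x * g x‖ ∂(sideWt D i) :=
        norm_integral_le_integral_norm _
      _ ≤ ∫ x, ‖f x * g x‖ ∂(bdryMeasure D) :=
        integral_mono_measure hle (Eventually.of_forall fun _ => norm_nonneg _) (hint f).norm
      _ ≤ (eLpNorm f 2 (bdryMeasure D)).toReal * (eLpNorm g 2 (bdryMeasure D)).toReal :=
        integral_norm_mul_le (Lp.memLp f) hgm
      _ = _ := by rw [← Lp.norm_def, mul_comm]
  · change ∫ x, f x * g x ∂(sideWt D i) = _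
    rw [integral_sideWt]
    refine integral_congr_ae (Eventually.of_forall fun x => ?_)
    simp only [Complex.real_smul]
    ring

/-! ### The normal trace operator -/

/-- The triple `(d, a, b)` for a field `(a, b)` with divergence `d`, stored as `(a, b, d)`. -/
def shift {D : Polygon} (p : L2Triple D) : Fin 3 → ℝ × ℝ → ℂ := fun i => funs p (i + 2)

theorem memL2_shift {D : Polygon} (p : L2Triple D) : MemL2 D (shift p) :=
  fun i => memL2_funs p (i + 2)

/-- The bilinear form `(p, u) ↦ ∬ (u d + a ∂_r u + b ∂_z u) r dr dz`, for `p = (a, b)` with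
divergence `d`. -/
def normalOp (D : Polygon) : HDiv D →L[ℂ] H1 D →L[ℂ] ℂ :=
  ∑ i : Fin 3, ((ContinuousLinearMap.mul ℂ ℂ).lpPairing (wt D.ω 1) 2 2).bilinearComp
    ((PiLp.proj 2 (𝕜 := ℂ) (fun _ : Fin 3 => Lp ℂ 2 (wt D.ω 1)) (i + 2)).comp (HDiv D).subtypeL)
    ((PiLp.proj 2 (𝕜 := ℂ) (fun _ : Fin 3 => Lp ℂ 2 (wt D.ω 1)) i).comp (H1 D).subtypeL)

theorem normalOp_apply {D : Polygon} (p : HDiv D) (u : H1 D) :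
    normalOp D p u = pairing D (shift p.1) (funs u.1) := by
  rw [pairing_eq_sum (memL2_shift _) (memL2_funs _), normalOp]
  simp only [sum_apply]
  refine Finset.sum_congr rfl fun i _ => ?_
  rw [ContinuousLinearMap.bilinearComp_apply, ContinuousLinearMap.lpPairing_eq_integral]
  rfl

theorem pairing_shift {D : Polygon} (p : L2Triple D) (u : Fin 3 → ℝ × ℝ → ℂ) :
    pairing D (shift p) u = ∫ x in D.ω, (x.1 : ℂ) *
      (funs p 2 x * u 0 x + funs p 0 x * u 1 x + funs p 1 x * u 2 x) := by
  rw [pairing, integral_wt_one]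
  simp only [Fin.sum_univ_three, Complex.real_smul]
  rfl

theorem IsTest.fst_mul {D : Polygon} {φ : ℝ × ℝ → ℂ} (h : IsTest D.ω φ) :
    IsTest D.ω fun x => (x.1 : ℂ) * φ x := by
  have hsub : tsupport (fun x : ℝ × ℝ => (x.1 : ℂ) * φ x) ⊆ tsupport φ := tsupport_mul_subset_right
  exact ⟨(ofReal_contDiff contDiff_fst).mul h.smooth,
    h.compact.of_isClosed_subset (isClosed_tsupport _) hsub, hsub.trans h.supp⟩

theorem fderiv_fst_mul {φ : ℝ × ℝ → ℂ} (h : ContDiff ℝ (⊤ : ℕ∞) φ) (x e : ℝ × ℝ) :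
    fderiv ℝ (fun x : ℝ × ℝ => (x.1 : ℂ) * φ x) x e =
      (x.1 : ℂ) * fderiv ℝ φ x e + (e.1 : ℂ) * φ x := by
  rw [hasFDerivAt_ofReal_mul contDiff_fst h x e]
  simp [fderiv_fst]

/-- A field pairs to zero with the gradients of test functions; the weight `r` turns the
axisymmetric divergence into the flat one. -/
theorem pairing_shift_gradOf_eq_zero {D : Polygon} (p : HDiv D) {φ : ℝ × ℝ → ℂ}
    (hφ : IsTest D.ω φ) : pairing D (shift p.1) (gradOf φ) = 0 := by
  have h := p.2 _ hφ.fst_mul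
  have hd := hφ.fst_mul.integrableOn_mul (p.1 2)
  set ψ : ℝ × ℝ → ℂ := fun x => (x.1 : ℂ) * φ x with hψ
  have hi : IntegrableOn (fun x => p.1 0 x * fderiv ℝ ψ x (1, 0) + p.1 1 x * fderiv ℝ ψ x (0, 1) -
      p.1 0 x / (x.1 : ℂ) * ψ x) D.ω :=
    ((hφ.fst_mul.integrableOn_mul_fderiv _ _).add
      (hφ.fst_mul.integrableOn_mul_fderiv _ _)).sub (hφ.fst_mul.integrableOn_div_mul _)
  rw [eq_neg_iff_add_eq_zero, ← integral_add hi hd] at h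
  rw [pairing_shift, ← h]
  refine setIntegral_congr_fun D.measurableSet fun x hx => ?_
  have hx0 : (x.1 : ℂ) ≠ 0 := by exact_mod_cast (D.pos x hx).ne'
  simp only [hψ, fderiv_fst_mul hφ.smooth]
  change (x.1 : ℂ) * (p.1 2 x * φ x + p.1 0 x * fderiv ℝ φ x (1, 0) +
    p.1 1 x * fderiv ℝ φ x (0, 1)) = _
  field_simp
  push_cast
  ring

/-- The divergence of a field that is smooth up to the boundary is the classical one. -/
theorem ae_div_eq {D : Polygon} (p : HDiv D) {a b : ℝ × ℝ → ℂ} (ha : ContDiff ℝ (⊤ : ℕ∞) a)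
    (hb : ContDiff ℝ (⊤ : ℕ∞) b) (hpa : p.1 0 =ᵐ[wt D.ω 1] a) (hpb : p.1 1 =ᵐ[wt D.ω 1] b) :
    ∀ᵐ x ∂(wt D.ω 1), (x.1 : ℂ) * p.1 2 x =
      fderiv ℝ (fun x => (x.1 : ℂ) * a x) x (1, 0) +
        fderiv ℝ (fun x => (x.1 : ℂ) * b x) x (0, 1) := by
  have := isFiniteMeasure_wt_one D
  set A : ℝ × ℝ → ℂ := fun x => (x.1 : ℂ) * a x with hA
  set B : ℝ × ℝ → ℂ := fun x => (x.1 : ℂ) * b x with hB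
  have hAs : ContDiff ℝ (⊤ : ℕ∞) A := (ofReal_contDiff contDiff_fst).mul ha
  have hBs : ContDiff ℝ (⊤ : ℕ∞) B := (ofReal_contDiff contDiff_fst).mul hb
  have hcA := continuous_fderiv_apply' hAs (1, 0)
  have hcB := continuous_fderiv_apply' hBs (0, 1)
  have hrd : MemLp (fun x : ℝ × ℝ => (x.1 : ℂ) * p.1 2 x) 2 (wt D.ω 1) :=
    memLp_continuous_mul D (ofReal_contDiff contDiff_fst).continuous (memL2_funs p.1 2)
  have hm1 := memLp_of_continuous D hcA
  have hm2 := memLp_of_continuous D hcB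
  have h0 : (fun x => (x.1 : ℂ) * p.1 2 x - (fderiv ℝ A x (1, 0) + fderiv ℝ B x (0, 1)))
      =ᵐ[wt D.ω 1] 0 := by
    refine ae_eq_zero_of_isTest ((hrd.sub (hm1.add hm2)).integrable one_le_two) fun φ hφ => ?_
    have hi : ∀ {f : ℝ × ℝ → ℂ}, MemLp f 2 (wt D.ω 1) → IntegrableOn (fun x => f x * φ x) D.ω :=
      fun hf => integrableOn_mul_test D hf hφ.smooth.continuous hφ.compact hφ.supp
    have hi' : ∀ {f : ℝ × ℝ → ℂ} (e : ℝ × ℝ), MemLp f 2 (wt D.ω 1) →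
        IntegrableOn (fun x => f x * fderiv ℝ φ x e) D.ω := fun e hf => by
      have hs := tsupport_fderiv_apply_subset (f := φ) ℝ e
      exact integrableOn_mul_test D hf (continuous_fderiv_apply' hφ.smooth e)
        (hφ.compact.of_isClosed_subset (isClosed_tsupport _) hs) (hs.trans hφ.supp)
    have hmA := memLp_of_continuous D hAs.continuous
    have hmB := memLp_of_continuous D hBs.continuous
    have e1 : ∫ x in D.ω, A x * fderiv ℝ φ x (1, 0) = -∫ x in D.ω, fderiv ℝ A x (1, 0) * φ x :=
      isGradIn_gradOf D hAs 0 φ hφ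
    have e2 : ∫ x in D.ω, B x * fderiv ℝ φ x (0, 1) = -∫ x in D.ω, fderiv ℝ B x (0, 1) * φ x :=
      isGradIn_gradOf D hBs 1 φ hφ
    have e3 : ∫ x in D.ω, ((x.1 : ℂ) * p.1 2 x * φ x + (A x * fderiv ℝ φ x (1, 0) +
        B x * fderiv ℝ φ x (0, 1))) = 0 := by
      rw [← pairing_shift_gradOf_eq_zero p hφ, pairing_shift]
      refine integral_congr_ae ?_
      filter_upwards [(ae_wt_iff D 1).mp hpa, (ae_wt_iff D 1).mp hpb] with x h1 h2
      change (x.1 : ℂ) * p.1 2 x * φ x + (A x * fderiv ℝ φ x (1, 0) + B x * fderiv ℝ φ x (0, 1)) =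
        (x.1 : ℂ) * (p.1 2 x * φ x + p.1 0 x * fderiv ℝ φ x (1, 0) +
          p.1 1 x * fderiv ℝ φ x (0, 1))
      rw [h1, h2, hA, hB]
      ring
    have hiA : IntegrableOn (fun x => A x * fderiv ℝ φ x (1, 0) +
        B x * fderiv ℝ φ x (0, 1)) D.ω := (hi' (1, 0) hmA).add (hi' (0, 1) hmB)
    rw [integral_add (hi hrd) hiA, integral_add (hi' (1, 0) hmA) (hi' (0, 1) hmB), e1, e2] at e3
    simp only [sub_mul, add_mul]
    have hi12 : IntegrableOn (fun x => fderiv ℝ A x (1, 0) * φ x +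
        fderiv ℝ B x (0, 1) * φ x) D.ω := (hi hm1).add (hi hm2)
    rw [integral_sub (hi hrd) hi12, integral_add (hi hm1) (hi hm2)]
    linear_combination e3
  filter_upwards [h0] with x hx
  exact sub_eq_zero.mp hx

/-- Green's formula for a smooth field and a function supported in `ω` or near a side. -/
theorem normalOp_smoothToH1 {D : Polygon} (p : HDiv D) {a b : ℝ × ℝ → ℂ}
    (ha : ContDiff ℝ (⊤ : ℕ∞) a) (hb : ContDiff ℝ (⊤ : ℕ∞) b) (hpa : p.1 0 =ᵐ[wt D.ω 1] a)
    (hpb : p.1 1 =ᵐ[wt D.ω 1] b) {φ : ℝ × ℝ → ℂ} (hφ : IsLocalSmooth D φ) :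
    normalOp D p (smoothToH1 D ⟨φ, hφ.smooth⟩) = ∑ i ∈ sidesB D, ∫ x, φ x *
      (a x * ((normal D i).1 : ℂ) + b x * ((normal D i).2 : ℂ)) * (x.1 : ℂ) ∂(sideMeasure D i) := by
  set A : ℝ × ℝ → ℂ := fun x => (x.1 : ℂ) * a x with hA
  set B : ℝ × ℝ → ℂ := fun x => (x.1 : ℂ) * b x with hB
  have hAs : ContDiff ℝ (⊤ : ℕ∞) A := (ofReal_contDiff contDiff_fst).mul ha
  have hBs : ContDiff ℝ (⊤ : ℕ∞) B := (ofReal_contDiff contDiff_fst).mul hb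
  have g1 := (hφ.mul hAs).integral_fderiv (1, 0)
  have g2 := (hφ.mul hBs).integral_fderiv (0, 1)
  have hint : ∀ {F : ℝ × ℝ → ℂ} (e : ℝ × ℝ), ContDiff ℝ (⊤ : ℕ∞) F →
      IntegrableOn (fun x => fderiv ℝ (fun x => φ x * F x) x e) D.ω := fun e hF =>
    ((continuous_fderiv_apply' (hφ.smooth.mul hF) e).integrable_of_hasCompactSupport
      ((hφ.compact.mul_right).fderiv_apply (𝕜 := ℝ) e)).integrableOn
  rw [normalOp_apply, pairing_congr_ae (fun _ => EventuallyEq.rfl)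
    (funs_smoothToH1_ae D ⟨φ, hφ.smooth⟩), pairing_shift]
  have hLHS : ∫ x in D.ω, (x.1 : ℂ) * (funs p.1 2 x * gradOf φ 0 x + funs p.1 0 x * gradOf φ 1 x +
      funs p.1 1 x * gradOf φ 2 x) = (∫ x in D.ω, fderiv ℝ (fun x => φ x * A x) x (1, 0)) +
        ∫ x in D.ω, fderiv ℝ (fun x => φ x * B x) x (0, 1) := by
    rw [← integral_add (hint _ hAs) (hint _ hBs)]
    refine integral_congr_ae ?_
    filter_upwards [(ae_wt_iff D 1).mp hpa, (ae_wt_iff D 1).mp hpb,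
      (ae_wt_iff D 1).mp (ae_div_eq p ha hb hpa hpb)] with x h1 h2 h3
    change (x.1 : ℂ) * (p.1 2 x * φ x + p.1 0 x * fderiv ℝ φ x (1, 0) +
      p.1 1 x * fderiv ℝ φ x (0, 1)) = _
    rw [fderiv_fun_mul (hφ.smooth.differentiable (by simp) x) (hAs.differentiable (by simp) x),
      fderiv_fun_mul (hφ.smooth.differentiable (by simp) x) (hBs.differentiable (by simp) x),
      h1, h2]
    simp only [add_apply, smul_apply, smul_eq_mul]
    simp only [hA, hB] at h3 ⊢
    linear_combination φ x * h3
  change ∫ x in D.ω, (x.1 : ℂ) * (funs p.1 2 x * gradOf φ 0 x + funs p.1 0 x * gradOf φ 1 x +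
      funs p.1 1 x * gradOf φ 2 x) = _
  rw [hLHS, g1, g2, ← Finset.sum_add_distrib]
  refine Finset.sum_congr rfl fun i _ => ?_
  have hcφ := hφ.smooth.continuous
  have hi : ∀ (c : ℂ) {F : ℝ × ℝ → ℂ}, Continuous F →
      Integrable (fun x => c * (φ x * F x)) (sideMeasure D i) := fun c F hF =>
    (integrable_sideMeasure (hcφ.mul hF)).const_mul c
  rw [← integral_const_mul, ← integral_const_mul, ← integral_add
    (hi _ hAs.continuous) (hi _ hBs.continuous)]
  refine integral_congr_ae (Eventually.of_forall fun x => ?_)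
  simp only [hA, hB]
  push_cast
  ring

theorem normalOp_of_smooth {D : Polygon} {T : H1 D →L[ℂ] Lp ℂ 2 (bdryMeasure D)}
    (hT : IsTraceOp D T) (p : HDiv D) {a b : ℝ × ℝ → ℂ} (ha : ContDiff ℝ (⊤ : ℕ∞) a)
    (hb : ContDiff ℝ (⊤ : ℕ∞) b) (hpa : p.1 0 =ᵐ[wt D.ω 1] a) (hpb : p.1 1 =ᵐ[wt D.ω 1] b)
    (u : H1 D) : normalOp D p u = ∑ i ∈ sidesB D, ∫ x, T u x *
      (a x * ((normal D i).1 : ℂ) + b x * ((normal D i).2 : ℂ)) * (x.1 : ℂ) ∂(sideMeasure D i) := by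
  have hc : ∀ i, Continuous fun x =>
      a x * ((normal D i).1 : ℂ) + b x * ((normal D i).2 : ℂ) := fun i =>
    (ha.continuous.mul continuous_const).add (hb.continuous.mul continuous_const)
  have h : ∀ i : sidesB D, ∃ ℓ : Lp ℂ 2 (bdryMeasure D) →L[ℂ] ℂ, ∀ f, ℓ f = ∫ x, f x *
      (a x * ((normal D i).1 : ℂ) + b x * ((normal D i).2 : ℂ)) * (x.1 : ℂ) ∂(sideMeasure D i) :=
    fun i => exists_sideFunctional i.2 (hc i)
  choose ℓ hℓ using h
  have hL : ∀ u, (∑ i : sidesB D, (ℓ i).comp T) u = ∑ i ∈ sidesB D, ∫ x, T u x *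
      (a x * ((normal D i).1 : ℂ) + b x * ((normal D i).2 : ℂ)) * (x.1 : ℂ) ∂(sideMeasure D i) := by
    intro u
    rw [sum_apply]
    exact (Finset.sum_congr rfl fun i _ => hℓ i (T u)).trans
      (Finset.sum_coe_sort (sidesB D) fun i => ∫ x, T u x *
        (a x * ((normal D i).1 : ℂ) + b x * ((normal D i).2 : ℂ)) * (x.1 : ℂ) ∂(sideMeasure D i))
  rw [← hL]
  refine DFunLike.congr_fun (ContinuousLinearMap.ext_on (dense_span_isLocalSmooth D) ?_) u
  rintro v ⟨φ, hφ, rfl⟩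
  rw [normalOp_smoothToH1 p ha hb hpa hpb hφ, hL]
  refine Finset.sum_congr rfl fun i hi => ?_
  have h1 := hT.apply_smoothToH1 ⟨φ, hφ.smooth⟩
  have h2 : ∀ᵐ x ∂(sideWt D i), T (smoothToH1 D ⟨φ, hφ.smooth⟩) x = φ x :=
    ae_mono (sideWt_le_bdryMeasure hi) h1
  have h3 : ∀ f : ℝ × ℝ → ℂ, ∫ x, f x * (x.1 : ℂ) ∂(sideMeasure D i) =
      ∫ x, f x ∂(sideWt D i) := fun f => by
    rw [integral_sideWt]
    simp only [Complex.real_smul, mul_comm]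
  rw [h3, h3]
  exact integral_congr_ae (h2.mono fun x hx => by simp only [hx])

theorem contDiff_div_fst {ψ : ℝ × ℝ → ℂ} (hψ : ContDiff ℝ (⊤ : ℕ∞) ψ)
    (hs : tsupport ψ ⊆ {x | 0 < x.1}) : ContDiff ℝ (⊤ : ℕ∞) fun x => ψ x / (x.1 : ℂ) := by
  rw [contDiff_iff_contDiffAt]
  intro x
  by_cases hx : x ∈ tsupport ψ
  · simp only [div_eq_mul_inv]
    refine hψ.contDiffAt.mul (ContDiffAt.inv (ofReal_contDiff contDiff_fst).contDiffAt ?_)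
    have : 0 < x.1 := hs hx
    exact_mod_cast this.ne'
  · have h0 : (fun x => ψ x / (x.1 : ℂ)) =ᶠ[𝓝 x] fun _ => 0 := by
      filter_upwards [notMem_tsupport_iff_eventuallyEq.mp hx] with y hy
      simp [hy]
    exact contDiffAt_const.congr_of_eventuallyEq h0

theorem fderiv_div_fst {ψ : ℝ × ℝ → ℂ} (hψ : ContDiff ℝ (⊤ : ℕ∞) ψ)
    (hs : tsupport ψ ⊆ {x | 0 < x.1}) {x : ℝ × ℝ} (hx : 0 < x.1) (e : ℝ × ℝ) :
    fderiv ℝ (fun x => ψ x / (x.1 : ℂ)) x e =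
      fderiv ℝ ψ x e / (x.1 : ℂ) - (e.1 : ℂ) * ψ x / (x.1 : ℂ) ^ 2 := by
  have hx0 : (x.1 : ℂ) ≠ 0 := by exact_mod_cast hx.ne'
  have h1 := fderiv_fst_mul (contDiff_div_fst hψ hs) x e
  have h2 : (fun x : ℝ × ℝ => (x.1 : ℂ) * (ψ x / (x.1 : ℂ))) = ψ := by
    funext y
    by_cases hy : y ∈ tsupport ψ
    · have : 0 < y.1 := hs hy
      have : (y.1 : ℂ) ≠ 0 := by exact_mod_cast this.ne'
      field_simp
    · simp [image_eq_zero_of_notMem_tsupport hy]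
  rw [h2] at h1
  rw [h1]
  field_simp
  ring

/-- The fields `e ψ / r` with divergence `∂_e ψ / r`, where `e` is a coordinate direction; they are
smooth up to the boundary.  Pairing with them is the integration by parts formula in `IsGradIn`. -/
theorem exists_field (D : Polygon) {ψ : ℝ × ℝ → ℂ} (hψ : IsTest {x | 0 < x.1} ψ) (i : Fin 2) :
    ∃ p : HDiv D, p.1 0 =ᵐ[wt D.ω 1] (fun x => ((dir i).1 : ℂ) * (ψ x / (x.1 : ℂ))) ∧
      p.1 1 =ᵐ[wt D.ω 1] (fun x => ((dir i).2 : ℂ) * (ψ x / (x.1 : ℂ))) ∧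
      p.1 2 =ᵐ[wt D.ω 1] (fun x => fderiv ℝ ψ x (dir i) / (x.1 : ℂ)) := by
  have hq := contDiff_div_fst hψ.smooth hψ.supp
  have hs := tsupport_fderiv_apply_subset (f := ψ) ℝ (dir i)
  have hd := continuous_div_fst (continuous_fderiv_apply' hψ.smooth (dir i)) (hs.trans hψ.supp)
  set a : ℝ × ℝ → ℂ := fun x => ((dir i).1 : ℂ) * (ψ x / (x.1 : ℂ)) with ha
  set b : ℝ × ℝ → ℂ := fun x => ((dir i).2 : ℂ) * (ψ x / (x.1 : ℂ)) with hb
  set d : ℝ × ℝ → ℂ := fun x => fderiv ℝ ψ x (dir i) / (x.1 : ℂ) with hd'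
  have hU : MemL2 D ![a, b, d] := by
    intro j
    fin_cases j
    · exact memLp_of_continuous D (continuous_const.mul hq.continuous)
    · exact memLp_of_continuous D (continuous_const.mul hq.continuous)
    · exact memLp_of_continuous D hd
  have hae := funs_toTriple_ae hU
  refine ⟨⟨toTriple hU, IsWeakDiv.congr (a := a) (b := b) (d := d) ?_ (hae 0) (hae 1) (hae 2)⟩,
    hae 0, hae 1, hae 2⟩
  intro φ hφ
  have hφr : tsupport φ ⊆ {x | 0 < x.1} := fun x hx => D.pos x (hφ.supp hx)
  have hφt : IsTest D.ω fun x => φ x / (x.1 : ℂ) := by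
    have hsub : tsupport (fun x : ℝ × ℝ => φ x / (x.1 : ℂ)) ⊆ tsupport φ := by
      simp only [div_eq_mul_inv]; exact tsupport_mul_subset_left
    exact ⟨contDiff_div_fst hφ.smooth fun x hx => D.pos x (hφ.supp hx),
      hφ.compact.of_isClosed_subset (isClosed_tsupport _) hsub, hsub.trans hφ.supp⟩
  have h1 : ∫ x in D.ω, ψ x * fderiv ℝ (fun x => φ x / (x.1 : ℂ)) x (dir i) =
    -∫ x in D.ω, fderiv ℝ ψ x (dir i) * (φ x / (x.1 : ℂ)) := isGradIn_gradOf D hψ.smooth i _ hφt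
  have h2 : ∫ x in D.ω, d x * φ x = ∫ x in D.ω, fderiv ℝ ψ x (dir i) * (φ x / (x.1 : ℂ)) := by
    congr 1; ext x; simp only [hd']; ring
  rw [h2, ← h1]
  refine setIntegral_congr_fun D.measurableSet fun x hx => ?_
  have hx0 : (x.1 : ℂ) ≠ 0 := by exact_mod_cast (D.pos x hx).ne'
  have h3 : fderiv ℝ φ x (dir i) = ((dir i).1 : ℂ) * fderiv ℝ φ x (1, 0) +
      ((dir i).2 : ℂ) * fderiv ℝ φ x (0, 1) := by
    have e : dir i = (dir i).1 • (1, 0) + (dir i).2 • (0, 1) := by simp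
    conv_lhs => rw [e]
    rw [map_add, map_smul, map_smul, Complex.real_smul, Complex.real_smul]
  simp only [fderiv_div_fst hφ.smooth hφr (D.pos x hx), h3, ha, hb]
  field_simp

theorem IsTest.mono {O O' : Set (ℝ × ℝ)} {φ : ℝ × ℝ → ℂ} (h : IsTest O φ) (hO : O ⊆ O') :
    IsTest O' φ := ⟨h.smooth, h.compact, h.supp.trans hO⟩

/-- A function with zero trace on `γ_b`, extended by zero, has a weak gradient across `γ_b`: Green's
formula for the smooth fields of `exists_field` has no boundary term. -/
theorem isGradIn_offVerts_of_trace_eq_zero {D : Polygon}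
    {T : H1 D →L[ℂ] Lp ℂ 2 (bdryMeasure D)} (hT : IsTraceOp D T) {u : H1 D} (hu : T u = 0) :
    IsGradIn D (offVerts D) (funs u.1) := by
  intro i ψ hψ
  have hψ' : IsTest {x | 0 < x.1} ψ := hψ.mono (offVerts_subset D)
  obtain ⟨p, hp0, hp1, hp2⟩ := exists_field D hψ' i
  have hq := contDiff_div_fst hψ'.smooth hψ'.supp
  have h1 := normalOp_of_smooth hT p (contDiff_const.mul hq) (contDiff_const.mul hq) hp0 hp1 u
  have h2 : normalOp D p u = 0 := by
    rw [h1]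
    refine Finset.sum_eq_zero fun j hj => ?_
    have h3 : ∀ᵐ x ∂(sideWt D j), T u x = 0 := by
      refine ae_mono (sideWt_le_bdryMeasure hj) ?_
      rw [hu]
      exact Lp.coeFn_zero ℂ 2 _
    have h4 : ∀ f : ℝ × ℝ → ℂ, ∫ x, f x * (x.1 : ℂ) ∂(sideMeasure D j) =
        ∫ x, f x ∂(sideWt D j) := fun f => by
      rw [integral_sideWt]
      simp only [Complex.real_smul, mul_comm]
    rw [h4]
    exact integral_eq_zero_of_ae (h3.mono fun x hx => by simp [hx])
  rw [normalOp_apply, pairing_shift] at h2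
  have hs := tsupport_fderiv_apply_subset (f := ψ) ℝ (dir i)
  rw [eq_neg_iff_add_eq_zero, ← integral_add
    (integrableOn_mul_of_tsupport D (memL2_funs u.1 0) (continuous_fderiv_apply' hψ.smooth (dir i))
      (hψ.compact.of_isClosed_subset (isClosed_tsupport _) hs) (hs.trans hψ'.supp))
    (integrableOn_mul_of_tsupport D (memL2_funs u.1 i.succ) hψ.smooth.continuous hψ.compact
      hψ'.supp), ← h2]
  refine integral_congr_ae ?_
  filter_upwards [(ae_wt_iff D 1).mp hp0, (ae_wt_iff D 1).mp hp1, (ae_wt_iff D 1).mp hp2,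
    ae_restrict_mem D.measurableSet] with x e0 e1 e2 hx
  have hx0 : (x.1 : ℂ) ≠ 0 := by exact_mod_cast (D.pos x hx).ne'
  have h5 : funs u.1 i.succ x =
      ((dir i).1 : ℂ) * funs u.1 1 x + ((dir i).2 : ℂ) * funs u.1 2 x := by
    fin_cases i <;> simp [dir]
  change _ = (x.1 : ℂ) * (p.1 2 x * funs u.1 0 x + p.1 0 x * funs u.1 1 x + p.1 1 x * funs u.1 2 x)
  rw [e0, e1, e2, h5]
  field_simp
  ring

/-- The form `normalOp` vanishes on the kernel of the trace, because test functions are dense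
there and a field pairs to zero with them. -/
theorem normalOp_eq_zero_of_trace_eq_zero {D : Polygon} {T : H1 D →L[ℂ] Lp ℂ 2 (bdryMeasure D)}
    (hT : IsTraceOp D T) (p : HDiv D) {u : H1 D} (hu : T u = 0) : normalOp D p u = 0 := by
  rw [normalOp_apply]
  exact pairing_eq_zero_of_isTest (memL2_shift _)
    (fun φ hφ => pairing_shift_gradOf_eq_zero p hφ) (memL2_funs _)
    (isGradIn_offVerts_of_trace_eq_zero hT hu)

theorem isNormalTraceOp_normalOp {D : Polygon} {T : H1 D →L[ℂ] Lp ℂ 2 (bdryMeasure D)}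
    (hT : IsTraceOp D T) : IsNormalTraceOp D T (normalOp D) :=
  ⟨fun p _ hu => normalOp_eq_zero_of_trace_eq_zero hT p hu,
    fun p _ _ ha hb hpa hpb u => normalOp_of_smooth hT p ha hb hpa hpb u⟩

/-- The fields that are smooth up to the boundary are dense: a triple that annihilates them has,
after a permutation of its components, the gradient structure of a function that vanishes on
`γ_b`. -/
theorem dense_span_smooth_HDiv (D : Polygon) : Dense (Submodule.span ℂ
    {p : HDiv D | ∃ a b : ℝ × ℝ → ℂ, ContDiff ℝ (⊤ : ℕ∞) a ∧ ContDiff ℝ (⊤ : ℕ∞) b ∧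
      p.1 0 =ᵐ[wt D.ω 1] a ∧ p.1 1 =ᵐ[wt D.ω 1] b} : Set (HDiv D)) := by
  refine dense_span_of_pairing fun w hw hw0 p => ?_
  have hh : MemL2 D fun i => w (i + 2) := fun i => hw (i + 2)
  have e : pairing D w (funs p.1) = pairing D (shift p.1) fun i => w (i + 2) := by
    refine integral_congr_ae (Eventually.of_forall fun x => ?_)
    simp only [Fin.sum_univ_three]
    change w 0 x * funs p.1 0 x + w 1 x * funs p.1 1 x + w 2 x * funs p.1 2 x =
      funs p.1 2 x * w 2 x + funs p.1 0 x * w 0 x + funs p.1 1 x * w 1 x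
    ring
  rw [e]
  refine pairing_eq_zero_of_isTest (memL2_shift _)
    (fun φ hφ => pairing_shift_gradOf_eq_zero p hφ) hh fun i ψ hψ => ?_
  have hψ' : IsTest {x | 0 < x.1} ψ := hψ.mono (offVerts_subset D)
  obtain ⟨q, hq0, hq1, hq2⟩ := exists_field D hψ' i
  have hq := contDiff_div_fst hψ'.smooth hψ'.supp
  have h2 := hw0 q ⟨_, _, contDiff_const.mul hq, contDiff_const.mul hq, hq0, hq1⟩
  rw [pairing, integral_wt_one] at h2
  have hs := tsupport_fderiv_apply_subset (f := ψ) ℝ (dir i)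
  rw [eq_neg_iff_add_eq_zero, ← integral_add
    (integrableOn_mul_of_tsupport D (hh 0) (continuous_fderiv_apply' hψ.smooth (dir i))
      (hψ.compact.of_isClosed_subset (isClosed_tsupport _) hs) (hs.trans hψ'.supp))
    (integrableOn_mul_of_tsupport D (hh i.succ) hψ.smooth.continuous hψ.compact hψ'.supp), ← h2]
  refine integral_congr_ae ?_
  filter_upwards [(ae_wt_iff D 1).mp hq0, (ae_wt_iff D 1).mp hq1, (ae_wt_iff D 1).mp hq2,
    ae_restrict_mem D.measurableSet] with x e0 e1 e2 hx
  have hx0 : (x.1 : ℂ) ≠ 0 := by exact_mod_cast (D.pos x hx).ne'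
  have h5 : w (i.succ + 2) x = ((dir i).1 : ℂ) * w 0 x + ((dir i).2 : ℂ) * w 1 x := by
    fin_cases i <;> simp [dir]
  simp only [Fin.sum_univ_three]
  change w 2 x * fderiv ℝ ψ x (dir i) + w (i.succ + 2) x * ψ x =
    x.1 • (w 0 x * q.1 0 x + w 1 x * q.1 1 x + w 2 x * q.1 2 x)
  rw [e0, e1, e2, h5, Complex.real_smul]
  field_simp
  ring

theorem IsNormalTraceOp.unique {D : Polygon} {T : H1 D →L[ℂ] Lp ℂ 2 (bdryMeasure D)}
    {N N' : HDiv D →L[ℂ] H1 D →L[ℂ] ℂ} (hN : IsNormalTraceOp D T N)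
    (hN' : IsNormalTraceOp D T N') : N = N' := by
  refine ContinuousLinearMap.ext_on (dense_span_smooth_HDiv D) ?_
  rintro p ⟨a, b, ha, hb, hpa, hpb⟩
  ext u
  rw [hN.smooth p a b ha hb hpa hpb u, hN'.smooth p a b ha hb hpa hpb u]

/-! ### Multipliers that depend on `r` only -/

theorem contDiff_mul_of_eq_zero_near {θ q : ℝ → ℝ} {δ : ℝ} (hδ : 0 < δ)
    (hθ : ContDiff ℝ (⊤ : ℕ∞) θ) (h0 : ∀ r, |r| < δ → θ r = 0)
    (hq : ∀ r, r ≠ 0 → ContDiffAt ℝ (⊤ : ℕ∞) q r) : ContDiff ℝ (⊤ : ℕ∞) fun r => θ r * q r := by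
  rw [contDiff_iff_contDiffAt]
  intro r
  by_cases hr : r = 0
  · have h1 : (fun r => θ r * q r) =ᶠ[𝓝 r] fun _ => 0 := by
      have : ∀ᶠ y in 𝓝 r, |y| < δ :=
        continuous_abs.continuousAt.eventually (eventually_lt_nhds (by simpa [hr] using hδ))
      filter_upwards [this] with y hy
      simp [h0 y hy]
    exact contDiffAt_const.congr_of_eventuallyEq h1
  · exact hθ.contDiffAt.mul (hq r hr)

theorem deriv_eq_zero_near {θ : ℝ → ℝ} {δ : ℝ} (h0 : ∀ r, |r| < δ → θ r = 0) :
    ∀ r, |r| < δ → deriv θ r = 0 := by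
  intro r hr
  have h1 : θ =ᶠ[𝓝 r] fun _ => 0 := by
    have : ∀ᶠ y in 𝓝 r, |y| < δ :=
      continuous_abs.continuousAt.eventually (eventually_lt_nhds hr)
    filter_upwards [this] with y hy
    exact h0 y hy
  rw [h1.deriv_eq, deriv_const]

theorem contDiff_deriv_top {θ : ℝ → ℝ} (hθ : ContDiff ℝ (⊤ : ℕ∞) θ) :
    ContDiff ℝ (⊤ : ℕ∞) (deriv θ) := (contDiff_infty_iff_deriv.mp hθ).2

theorem contDiffAt_inv_top (r : ℝ) (hr : r ≠ 0) : ContDiffAt ℝ (⊤ : ℕ∞) (fun r : ℝ => r⁻¹) r :=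
  contDiffAt_inv ℝ hr

theorem fderiv_conj {φ : ℝ × ℝ → ℂ} (x e : ℝ × ℝ) :
    fderiv ℝ (fun x => starRingEnd ℂ (φ x)) x e = starRingEnd ℂ (fderiv ℝ φ x e) := by
  have := Complex.conjCLE.comp_fderiv (f := φ) (x := x)
  have h2 := DFunLike.congr_fun this e
  exact h2

theorem IsTest.conj {O : Set (ℝ × ℝ)} {φ : ℝ × ℝ → ℂ} (h : IsTest O φ) :
    IsTest O fun x => starRingEnd ℂ (φ x) := by
  have hs : tsupport (fun x => starRingEnd ℂ (φ x)) = tsupport φ := by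
    unfold tsupport
    congr 1
    ext x; simp
  exact ⟨Complex.conjCLE.contDiff.comp h.smooth, by rw [HasCompactSupport, hs]; exact h.compact,
    hs ▸ h.supp⟩

theorem gradOf_conj (φ : ℝ × ℝ → ℂ) (i : Fin 3) (x : ℝ × ℝ) :
    gradOf (fun x => starRingEnd ℂ (φ x)) i x = starRingEnd ℂ (gradOf φ i x) := by
  refine Fin.cases rfl (fun j => ?_) i
  exact fderiv_conj x (dir j)

theorem pairing_conj_gradOf_eq_zero {D : Polygon} {W : Fin 3 → ℝ × ℝ → ℂ}
    (h : ∀ φ, IsTest D.ω φ → pairing D W (gradOf φ) = 0) {φ : ℝ × ℝ → ℂ} (hφ : IsTest D.ω φ) :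
    pairing D (fun i x => starRingEnd ℂ (W i x)) (gradOf φ) = 0 := by
  have h1 := congrArg (starRingEnd ℂ) (h _ hφ.conj)
  rw [pairing, ← integral_conj, map_zero] at h1
  rw [pairing, ← h1]
  congr 1; ext x
  rw [map_sum]
  refine Finset.sum_congr rfl fun i _ => ?_
  rw [map_mul, gradOf_conj, Complex.conj_conj]

theorem IsTest.ofReal_mul {O : Set (ℝ × ℝ)} {φ : ℝ × ℝ → ℂ} (h : IsTest O φ) {f : ℝ × ℝ → ℝ}
    (hf : ContDiff ℝ (⊤ : ℕ∞) f) : IsTest O fun x => (f x : ℂ) * φ x := by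
  have hsub : tsupport (fun x : ℝ × ℝ => (f x : ℂ) * φ x) ⊆ tsupport φ := tsupport_mul_subset_right
  exact ⟨(ofReal_contDiff hf).mul h.smooth,
    h.compact.of_isClosed_subset (isClosed_tsupport _) hsub, hsub.trans h.supp⟩

/-- The energy identity for the multiplier `ψ(r) / r`: the field `ψ w̄ / r` in the direction of `r`
pairs to zero with a function `w` that vanishes on `γ_b`. -/
theorem integral_mul_deriv_eq_zero {D : Polygon} {u : Fin 3 → ℝ × ℝ → ℂ} (hu : MemL2 D u)
    (h : IsGradIn D (offVerts D) u) {ψ : ℝ → ℝ} (hψ : ContDiff ℝ (⊤ : ℕ∞) ψ) {δ : ℝ} (hδ : 0 < δ)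
    (h0 : ∀ r, |r| < δ → ψ r = 0) :
    ∫ x in D.ω, (ψ x.1 * (2 * (starRingEnd ℂ (u 0 x) * u 1 x).re) + deriv ψ x.1 * ‖u 0 x‖ ^ 2) =
      0 := by
  -- division by `r` compensates the weight in `pairing`
  set θ₁ : ℝ → ℝ := fun r => ψ r * r⁻¹ with hθ₁
  set θ₂ : ℝ → ℝ := fun r => deriv ψ r * r⁻¹ with hθ₂
  have hc1 : Continuous fun x : ℝ × ℝ => (θ₁ x.1 : ℂ) := Complex.continuous_ofReal.comp
    ((contDiff_mul_of_eq_zero_near hδ hψ h0 contDiffAt_inv_top).continuous.comp continuous_fst)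
  have hc2 : Continuous fun x : ℝ × ℝ => (θ₂ x.1 : ℂ) := Complex.continuous_ofReal.comp
    ((contDiff_mul_of_eq_zero_near hδ (contDiff_deriv_top hψ) (deriv_eq_zero_near h0)
      contDiffAt_inv_top).continuous.comp continuous_fst)
  set W : Fin 3 → ℝ × ℝ → ℂ :=
    ![fun x => (θ₁ x.1 : ℂ) * u 1 x + (θ₂ x.1 : ℂ) * u 0 x, fun x => (θ₁ x.1 : ℂ) * u 0 x,
      fun _ => 0] with hW
  have hWm : MemL2 D W := by
    intro i
    fin_cases i
    · exact (memLp_continuous_mul D hc1 (hu 1)).add (memLp_continuous_mul D hc2 (hu 0))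
    · exact memLp_continuous_mul D hc1 (hu 0)
    · exact memLp_of_continuous D continuous_const
  have hψ1 : ContDiff ℝ (⊤ : ℕ∞) fun x : ℝ × ℝ => ψ x.1 := hψ.comp contDiff_fst
  have hg := h.mulGrad (offVerts_subset D) hu hψ1
  have hW0 : ∀ φ, IsTest D.ω φ → pairing D W (gradOf φ) = 0 := by
    intro φ hφ
    have h1 : ∫ x in D.ω, (ψ x.1 : ℂ) * u 0 x * fderiv ℝ φ x (1, 0) =
        -∫ x in D.ω, ((ψ x.1 : ℂ) * u 1 x +
          (fderiv ℝ (fun x : ℝ × ℝ => ψ x.1) x (1, 0) : ℂ) * u 0 x) * φ x :=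
      hg 0 φ (hφ.mono (subset_offVerts D))
    have hm := hu.mulGrad hψ1
    have hs := tsupport_fderiv_apply_subset (f := φ) ℝ (1, 0)
    have i1 : IntegrableOn (fun x => (ψ x.1 : ℂ) * u 0 x * fderiv ℝ φ x (1, 0)) D.ω :=
      integrableOn_mul_test D (hm 0) (continuous_fderiv_apply' hφ.smooth _)
        (hφ.compact.of_isClosed_subset (isClosed_tsupport _) hs) (hs.trans hφ.supp)
    have i2 : IntegrableOn (fun x => ((ψ x.1 : ℂ) * u 1 x +
          (fderiv ℝ (fun x : ℝ × ℝ => ψ x.1) x (1, 0) : ℂ) * u 0 x) * φ x) D.ω :=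
      integrableOn_mul_test D (hm 1) hφ.smooth.continuous hφ.compact hφ.supp
    rw [eq_neg_iff_add_eq_zero, ← integral_add i1 i2] at h1
    rw [pairing, integral_wt_one, ← h1]
    refine setIntegral_congr_fun D.measurableSet fun x hx => ?_
    have hx0 : (x.1 : ℂ) ≠ 0 := by exact_mod_cast (D.pos x hx).ne'
    simp only [Fin.sum_univ_three, fderiv_comp_fst hψ]
    change x.1 • (((θ₁ x.1 : ℂ) * u 1 x + (θ₂ x.1 : ℂ) * u 0 x) * φ x +
      (θ₁ x.1 : ℂ) * u 0 x * fderiv ℝ φ x (1, 0) + 0 * fderiv ℝ φ x (0, 1)) = _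
    simp only [hθ₁, hθ₂, Complex.real_smul]
    push_cast
    field_simp
    ring
  have hfin := pairing_eq_zero_of_isTest (w := fun i x => starRingEnd ℂ (W i x))
    (fun i => (hWm i).star) (fun φ hφ => pairing_conj_gradOf_eq_zero hW0 hφ) hu h
  rw [pairing, integral_wt_one] at hfin
  have e : ∫ x in D.ω, x.1 • ∑ i, starRingEnd ℂ (W i x) * u i x =
      ∫ x in D.ω, (((ψ x.1 * (2 * (starRingEnd ℂ (u 0 x) * u 1 x).re) +
        deriv ψ x.1 * ‖u 0 x‖ ^ 2 : ℝ)) : ℂ) := by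
    refine setIntegral_congr_fun D.measurableSet fun x hx => ?_
    have hx0 : (x.1 : ℂ) ≠ 0 := by exact_mod_cast (D.pos x hx).ne'
    have e1 : ((2 * (starRingEnd ℂ (u 0 x) * u 1 x).re : ℝ) : ℂ) =
        starRingEnd ℂ (u 0 x) * u 1 x + starRingEnd ℂ (u 1 x) * u 0 x := by
      rw [← Complex.add_conj]
      simp [mul_comm]
    have e2 : ((‖u 0 x‖ ^ 2 : ℝ) : ℂ) = starRingEnd ℂ (u 0 x) * u 0 x := by
      rw [← Complex.normSq_eq_norm_sq, Complex.normSq_eq_conj_mul_self]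
    simp only [Fin.sum_univ_three]
    change x.1 • (starRingEnd ℂ ((θ₁ x.1 : ℂ) * u 1 x + (θ₂ x.1 : ℂ) * u 0 x) * u 0 x +
      starRingEnd ℂ ((θ₁ x.1 : ℂ) * u 0 x) * u 1 x + starRingEnd ℂ 0 * u 2 x) = _
    have e0 : (((ψ x.1 * (2 * (starRingEnd ℂ (u 0 x) * u 1 x).re) +
        deriv ψ x.1 * ‖u 0 x‖ ^ 2 : ℝ)) : ℂ) = (ψ x.1 : ℂ) * (starRingEnd ℂ (u 0 x) * u 1 x +
          starRingEnd ℂ (u 1 x) * u 0 x) +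
          ((deriv ψ x.1 : ℝ) : ℂ) * (starRingEnd ℂ (u 0 x) * u 0 x) := by
      rw [← e1, ← e2]; push_cast; ring
    rw [e0]
    simp only [hθ₁, hθ₂, Complex.real_smul, map_add, map_mul, Complex.conj_ofReal, map_zero]
    push_cast
    field_simp
    ring
  rw [e, integral_complex_ofReal] at hfin
  exact_mod_cast hfin

/-- The energy identity for a field `ζ(r) p̄` and a function that vanishes on `γ_b`. -/
theorem integral_mul_field_eq_zero {D : Polygon} (p : HDiv D) {u : Fin 3 → ℝ × ℝ → ℂ}
    (hu : MemL2 D u) (h : IsGradIn D (offVerts D) u) {ζ : ℝ → ℝ} (hζ : ContDiff ℝ (⊤ : ℕ∞) ζ) :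
    ∫ x in D.ω, (x.1 : ℂ) * ((ζ x.1 : ℂ) * (starRingEnd ℂ (p.1 2 x) * u 0 x +
      starRingEnd ℂ (p.1 0 x) * u 1 x + starRingEnd ℂ (p.1 1 x) * u 2 x) +
        ((deriv ζ x.1 : ℝ) : ℂ) * (starRingEnd ℂ (p.1 0 x) * u 0 x)) = 0 := by
  have hc1 : Continuous fun x : ℝ × ℝ => (ζ x.1 : ℂ) :=
    Complex.continuous_ofReal.comp (hζ.continuous.comp continuous_fst)
  have hc2 : Continuous fun x : ℝ × ℝ => ((deriv ζ x.1 : ℝ) : ℂ) :=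
    Complex.continuous_ofReal.comp ((contDiff_deriv_top hζ).continuous.comp continuous_fst)
  have hp : ∀ i, MemLp (fun x => starRingEnd ℂ (p.1 i x)) 2 (wt D.ω 1) :=
    fun i => (memL2_funs p.1 i).star
  set W : Fin 3 → ℝ × ℝ → ℂ :=
    ![fun x => (ζ x.1 : ℂ) * starRingEnd ℂ (p.1 2 x) +
        ((deriv ζ x.1 : ℝ) : ℂ) * starRingEnd ℂ (p.1 0 x),
      fun x => (ζ x.1 : ℂ) * starRingEnd ℂ (p.1 0 x),
      fun x => (ζ x.1 : ℂ) * starRingEnd ℂ (p.1 1 x)] with hW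
  have hWm : MemL2 D W := by
    intro i
    fin_cases i
    · exact (memLp_continuous_mul D hc1 (hp 2)).add (memLp_continuous_mul D hc2 (hp 0))
    · exact memLp_continuous_mul D hc1 (hp 0)
    · exact memLp_continuous_mul D hc1 (hp 1)
  have hζ1 : ContDiff ℝ (⊤ : ℕ∞) fun x : ℝ × ℝ => ζ x.1 := hζ.comp contDiff_fst
  have hW0 : ∀ φ, IsTest D.ω φ → pairing D W (gradOf φ) = 0 := by
    intro φ hφ
    have h1 := pairing_conj_gradOf_eq_zero (W := shift p.1)
      (fun φ hφ => pairing_shift_gradOf_eq_zero p hφ) (hφ.ofReal_mul hζ1)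
    rw [← h1]
    refine integral_congr_ae (Eventually.of_forall fun x => ?_)
    simp only [Fin.sum_univ_three]
    change ((ζ x.1 : ℂ) * starRingEnd ℂ (p.1 2 x) +
        ((deriv ζ x.1 : ℝ) : ℂ) * starRingEnd ℂ (p.1 0 x)) * φ x +
        (ζ x.1 : ℂ) * starRingEnd ℂ (p.1 0 x) * fderiv ℝ φ x (1, 0) +
        (ζ x.1 : ℂ) * starRingEnd ℂ (p.1 1 x) * fderiv ℝ φ x (0, 1) =
      starRingEnd ℂ (p.1 2 x) * ((ζ x.1 : ℂ) * φ x) +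
        starRingEnd ℂ (p.1 0 x) * fderiv ℝ (fun x : ℝ × ℝ => (ζ x.1 : ℂ) * φ x) x (1, 0) +
        starRingEnd ℂ (p.1 1 x) * fderiv ℝ (fun x : ℝ × ℝ => (ζ x.1 : ℂ) * φ x) x (0, 1)
    rw [hasFDerivAt_ofReal_mul hζ1 hφ.smooth x (1, 0),
      hasFDerivAt_ofReal_mul hζ1 hφ.smooth x (0, 1),
      fderiv_comp_fst hζ, fderiv_comp_fst hζ]
    push_cast
    ring
  have hfin := pairing_eq_zero_of_isTest hWm hW0 hu h
  rw [pairing, integral_wt_one] at hfin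
  rw [← hfin]
  congr 1; ext x
  simp only [Fin.sum_univ_three, Complex.real_smul]
  change _ = (x.1 : ℂ) * (((ζ x.1 : ℂ) * starRingEnd ℂ (p.1 2 x) +
        ((deriv ζ x.1 : ℝ) : ℂ) * starRingEnd ℂ (p.1 0 x)) * u 0 x +
        (ζ x.1 : ℂ) * starRingEnd ℂ (p.1 0 x) * u 1 x +
        (ζ x.1 : ℂ) * starRingEnd ℂ (p.1 1 x) * u 2 x)
  ring

/-- Cutoff functions in `r` near the axis: identities that hold with all of them pass to the limit,
because `r |η_n'|` is bounded and supported near `r = 0`. -/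
theorem exists_axis_cutoff_limit (D : Polygon) : ∃ η : ℕ → ℝ → ℝ,
    (∀ n, ContDiff ℝ (⊤ : ℕ∞) (η n)) ∧
    (∀ (n : ℕ) (r : ℝ), |r| < 1 / ((n : ℝ) + 1) → η n r = 0) ∧
    ∀ (E : Type) [NormedAddCommGroup E] [NormedSpace ℝ E] (g₁ g₂ : ℝ × ℝ → E),
      IntegrableOn g₁ D.ω → IntegrableOn (fun x => x.1⁻¹ • g₂ x) D.ω →
      (∀ n, ∫ x in D.ω, (η n x.1 • g₁ x + deriv (η n) x.1 • g₂ x) = 0) →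
      ∫ x in D.ω, g₁ x = 0 := by
  obtain ⟨η, M, hs, h01, h1, h0, hd⟩ := exists_axis_cutoff
  refine ⟨η, hs, h0, fun E _ _ g₁ g₂ hg₁ hg₂ h => ?_⟩
  have hM : 0 ≤ M := by simpa using (abs_nonneg _).trans (hd 0 0)
  have hg₂m : AEStronglyMeasurable g₂ (volume.restrict D.ω) := by
    have : AEStronglyMeasurable (fun x : ℝ × ℝ => x.1 • (x.1⁻¹ • g₂ x)) (volume.restrict D.ω) :=
      continuous_fst.aestronglyMeasurable.smul hg₂.1
    refine this.congr ?_
    filter_upwards [ae_restrict_mem D.measurableSet] with x hx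
    rw [smul_smul, mul_inv_cancel₀ (D.pos x hx).ne', one_smul]
  have hzero : ∀ (n : ℕ) r, 2 / ((n : ℝ) + 1) < r → deriv (η n) r = 0 := by
    intro n r hr
    rw [(h1 n r hr).deriv_eq]
    exact deriv_const r 1
  have hlim := tendsto_integral_of_dominated_convergence
    (F := fun (n : ℕ) x => η n x.1 • g₁ x + deriv (η n) x.1 • g₂ x) (f := g₁)
    (μ := volume.restrict D.ω) (fun x => ‖g₁ x‖ + 2 * M * ‖x.1⁻¹ • g₂ x‖)
    (fun n => ?_) ?_ (fun n => ?_) ?_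
  · refine tendsto_nhds_unique hlim ?_
    simp only [h]
    exact tendsto_const_nhds
  · exact (((hs n).continuous.comp continuous_fst).aestronglyMeasurable.smul hg₁.1).add
      (((contDiff_deriv_top (hs n)).continuous.comp continuous_fst).aestronglyMeasurable.smul hg₂m)
  · exact hg₁.norm.add (hg₂.norm.const_mul _)
  · filter_upwards [ae_restrict_mem D.measurableSet] with x hx
    have hx0 := D.pos x hx
    refine (norm_add_le _ _).trans (add_le_add ?_ ?_)
    · rw [norm_smul, Real.norm_eq_abs, abs_of_nonneg (h01 n _).1]
      exact mul_le_of_le_one_left (norm_nonneg _) (h01 n _).2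
    · rw [norm_smul, norm_smul, ← mul_assoc, Real.norm_eq_abs, norm_inv, Real.norm_eq_abs,
        abs_of_pos hx0]
      refine mul_le_mul_of_nonneg_right ?_ (norm_nonneg _)
      rw [← div_eq_mul_inv, le_div_iff₀ hx0]
      rcases lt_or_ge (2 / ((n : ℝ) + 1)) x.1 with hr | hr
      · rw [hzero n _ hr]
        simpa using hM
      · calc |deriv (η n) x.1| * x.1 ≤ (n + 1) * M * (2 / ((n : ℝ) + 1)) := by
              gcongr
              exact hd n _
          _ = 2 * M := by field_simp
  · filter_upwards [ae_restrict_mem D.measurableSet] with x hx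
    have hx0 := D.pos x hx
    refine tendsto_const_nhds.congr' ?_
    have hev : ∀ᶠ n : ℕ in atTop, 2 / ((n : ℝ) + 1) < x.1 := by
      have : Tendsto (fun n : ℕ => 2 / ((n : ℝ) + 1)) atTop (𝓝 0) := by
        simpa [div_eq_mul_inv] using (tendsto_one_div_add_atTop_nhds_zero_nat (𝕜 := ℝ)).const_mul 2
      exact this.eventually (eventually_lt_nhds hx0)
    filter_upwards [hev] with n hn
    rw [(h1 n _ hn).self_of_nhds, hzero n _ hn]
    simp

/-! ### Hardy's equality and the weighted energy identity -/

theorem integrableOn_continuous_mul (D : Polygon) {c f : ℝ × ℝ → ℝ} (hc : Continuous c)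
    (hf : IntegrableOn f D.ω) : IntegrableOn (fun x => c x * f x) D.ω := by
  obtain ⟨C, hC⟩ := D.isBounded.isCompact_closure.exists_bound_of_continuousOn hc.continuousOn
  refine (hf.norm.const_mul C).mono' (hc.aestronglyMeasurable.mul hf.1) ?_
  filter_upwards [ae_restrict_mem D.measurableSet] with x hx
  rw [norm_mul]
  exact mul_le_mul_of_nonneg_right (hC x (subset_closure hx)) (norm_nonneg _)

theorem integrableOn_sq_div {D : Polygon} {f : ℝ × ℝ → ℂ} (hf : MemLp f 2 (wt D.ω (-1))) :
    IntegrableOn (fun x => x.1⁻¹ * ‖f x‖ ^ 2) D.ω := by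
  have := ((memLp_two_wt_iff D (-1)).mp hf).2
  simpa only [Real.rpow_neg_one] using this

theorem aestronglyMeasurable_of_memLp {D : Polygon} {τ : ℝ} {f : ℝ × ℝ → ℂ}
    (hf : MemLp f 2 (wt D.ω τ)) : AEStronglyMeasurable f (volume.restrict D.ω) :=
  (aestronglyMeasurable_wt_iff D τ).mp hf.1

/-- Hardy's equality with the weight `1 / r²` replaced by `1 / (r² + e)`, so that all integrals
converge as soon as `u ∈ H¹_{-1}(ω)`. -/
theorem integral_regularized_hardy {D : Polygon} {u : Fin 3 → ℝ × ℝ → ℂ} (hu : MemL2 D u)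
    (hneg : ∀ i, MemLp (u i) 2 (wt D.ω (-1))) (h : IsGradIn D (offVerts D) u) {e : ℝ} (he : 0 < e) :
    IntegrableOn (fun x => (x.1 ^ 2 + e)⁻¹ * (starRingEnd ℂ (u 0 x) * u 1 x).re) D.ω ∧
    IntegrableOn (fun x => x.1 * ((x.1 ^ 2 + e)⁻¹) ^ 2 * ‖u 0 x‖ ^ 2) D.ω ∧
    ∫ x in D.ω, (x.1 ^ 2 + e)⁻¹ * (starRingEnd ℂ (u 0 x) * u 1 x).re =
      ∫ x in D.ω, x.1 * ((x.1 ^ 2 + e)⁻¹) ^ 2 * ‖u 0 x‖ ^ 2 := by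
  have hpos : ∀ r : ℝ, 0 < r ^ 2 + e := fun r => by positivity
  have iN := integrableOn_sq_div (hneg 0)
  have iN1 := integrableOn_sq_div (hneg 1)
  have iS : IntegrableOn (fun x => x.1⁻¹ * (starRingEnd ℂ (u 0 x) * u 1 x).re) D.ω := by
    refine (iN.add iN1).mono' ?_ ?_
    · refine (measurable_fst.inv.aestronglyMeasurable).mul
        (Complex.continuous_re.comp_aestronglyMeasurable ?_)
      exact (Complex.continuous_conj.comp_aestronglyMeasurable
        (aestronglyMeasurable_of_memLp (hu 0))).mul (aestronglyMeasurable_of_memLp (hu 1))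
    · filter_upwards [ae_restrict_mem D.measurableSet] with x hx
      have hx0 := D.pos x hx
      have h1 : |(starRingEnd ℂ (u 0 x) * u 1 x).re| ≤ ‖u 0 x‖ * ‖u 1 x‖ := by
        refine (Complex.abs_re_le_norm _).trans ?_
        rw [norm_mul, RCLike.norm_conj]
      have h2 : ‖u 0 x‖ * ‖u 1 x‖ ≤ ‖u 0 x‖ ^ 2 + ‖u 1 x‖ ^ 2 := by
        nlinarith [sq_nonneg (‖u 0 x‖ - ‖u 1 x‖), sq_nonneg ‖u 0 x‖, sq_nonneg ‖u 1 x‖]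
      rw [norm_mul, Real.norm_eq_abs, Real.norm_eq_abs, abs_of_pos (inv_pos.mpr hx0), Pi.add_apply,
        ← mul_add]
      exact mul_le_mul_of_nonneg_left (h1.trans h2) (inv_pos.mpr hx0).le
  set q : ℝ → ℝ := fun r => (r ^ 2 + e)⁻¹ with hq
  have hqs : ContDiff ℝ (⊤ : ℕ∞) q :=
    ((contDiff_id.pow 2).add contDiff_const).inv fun r => (hpos r).ne'
  have hqd : ∀ r, HasDerivAt q (-(2 * r) * (q r) ^ 2) r := by
    intro r
    have h1 : HasDerivAt (fun r : ℝ => r ^ 2 + e) (2 * r) r := by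
      simpa using (hasDerivAt_pow 2 r).add_const e
    refine (h1.fun_inv (hpos r).ne').congr_deriv ?_
    simp only [hq]
    field_simp
  have hcq : Continuous q := hqs.continuous
  have jS : IntegrableOn (fun x => q x.1 * (starRingEnd ℂ (u 0 x) * u 1 x).re) D.ω := by
    refine (integrableOn_continuous_mul D (c := fun x => x.1 * q x.1) (by fun_prop) iS).congr_fun
      (fun x hx => ?_) D.measurableSet
    have := (D.pos x hx).ne'
    field_simp
  have jN : IntegrableOn (fun x => x.1 * (q x.1) ^ 2 * ‖u 0 x‖ ^ 2) D.ω := by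
    refine (integrableOn_continuous_mul D (c := fun x => x.1 ^ 2 * (q x.1) ^ 2) (by fun_prop)
      iN).congr_fun (fun x hx => ?_) D.measurableSet
    have := (D.pos x hx).ne'
    field_simp
  refine ⟨jS, jN, ?_⟩
  have jSN : IntegrableOn (fun x => 2 * (q x.1 * (starRingEnd ℂ (u 0 x) * u 1 x).re) -
      2 * (x.1 * (q x.1) ^ 2 * ‖u 0 x‖ ^ 2)) D.ω := (jS.const_mul 2).sub (jN.const_mul 2)
  obtain ⟨η, hηs, hη0, hlim⟩ := exists_axis_cutoff_limit D
  have h0 := hlim ℝ (fun x => 2 * (q x.1 * (starRingEnd ℂ (u 0 x) * u 1 x).re) -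
    2 * (x.1 * (q x.1) ^ 2 * ‖u 0 x‖ ^ 2)) (fun x => q x.1 * ‖u 0 x‖ ^ 2)
    jSN ?_ fun n => ?_
  · rw [integral_sub (jS.const_mul 2) (jN.const_mul 2), integral_const_mul,
      integral_const_mul] at h0
    linarith
  · refine (integrableOn_continuous_mul D (c := fun x => q x.1) (by fun_prop) iN).congr_fun
      (fun x hx => ?_) D.measurableSet
    simp only [smul_eq_mul]
    ring
  · have hn : (0 : ℝ) < 1 / ((n : ℝ) + 1) := by positivity
    have h1 := integral_mul_deriv_eq_zero hu h ((hηs n).mul hqs) hn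
      (fun r hr => by simp [hη0 n r hr])
    rw [← h1]
    refine integral_congr_ae (Eventually.of_forall fun x => ?_)
    have h2 : deriv (fun r => η n r * q r) x.1 =
        deriv (η n) x.1 * q x.1 + η n x.1 * (-(2 * x.1) * (q x.1) ^ 2) :=
      (((hηs n).differentiable (by simp) x.1).hasDerivAt.mul (hqd x.1)).deriv
    simp only [smul_eq_mul]
    rw [h2]
    ring

/-- Hardy's inequality and equality for functions that vanish on `γ_b`: the regularized equality and
Cauchy's inequality bound the integrals of `r |u|² / (r² + e)²` uniformly in `e`. -/
theorem hardy {D : Polygon} {u : Fin 3 → ℝ × ℝ → ℂ} (hu : MemL2 D u)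
    (hneg : ∀ i, MemLp (u i) 2 (wt D.ω (-1))) (h : IsGradIn D (offVerts D) u) :
    IntegrableOn (fun x => (x.1 ^ 3)⁻¹ * ‖u 0 x‖ ^ 2) D.ω ∧
    ∫ x in D.ω, (x.1 ^ 2)⁻¹ * (starRingEnd ℂ (u 0 x) * u 1 x).re =
      ∫ x in D.ω, (x.1 ^ 3)⁻¹ * ‖u 0 x‖ ^ 2 := by
  have iN1 := integrableOn_sq_div (hneg 1)
  set e : ℕ → ℝ := fun n => 1 / ((n : ℝ) + 1) with he
  have he0 : ∀ n, 0 < e n := fun n => by positivity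
  have het : Tendsto e atTop (𝓝 0) := tendsto_one_div_add_atTop_nhds_zero_nat
  have hreg := fun n => integral_regularized_hardy hu hneg h (he0 n)
  have hre : ∀ x, |(starRingEnd ℂ (u 0 x) * u 1 x).re| ≤ ‖u 0 x‖ * ‖u 1 x‖ := fun x => by
    refine (Complex.abs_re_le_norm _).trans ?_
    rw [norm_mul, RCLike.norm_conj]
  have hbound : ∀ n, ∫ x in D.ω, x.1 * ((x.1 ^ 2 + e n)⁻¹) ^ 2 * ‖u 0 x‖ ^ 2 ≤
      ∫ x in D.ω, x.1⁻¹ * ‖u 1 x‖ ^ 2 := by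
    intro n
    obtain ⟨jS, jN, heq⟩ := hreg n
    have h1 : ∫ x in D.ω, (x.1 ^ 2 + e n)⁻¹ * (starRingEnd ℂ (u 0 x) * u 1 x).re ≤
        ∫ x in D.ω, ((1 / 2) * (x.1 * ((x.1 ^ 2 + e n)⁻¹) ^ 2 * ‖u 0 x‖ ^ 2) +
          (1 / 2) * (x.1⁻¹ * ‖u 1 x‖ ^ 2)) := by
      refine setIntegral_mono_on jS ((jN.const_mul _).add (iN1.const_mul _)) D.measurableSet
        fun x hx => ?_
      have hx0 := D.pos x hx
      set Q := (x.1 ^ 2 + e n)⁻¹ with hQ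
      have hQ0 : 0 ≤ Q := by have := he0 n; positivity
      have h2 := (le_abs_self _).trans (hre x)
      have h3 : Q * (‖u 0 x‖ * ‖u 1 x‖) ≤
          1 / 2 * (x.1 * Q ^ 2 * ‖u 0 x‖ ^ 2) + 1 / 2 * (x.1⁻¹ * ‖u 1 x‖ ^ 2) := by
        have h4 : 0 ≤ x.1⁻¹ * (x.1 * Q * ‖u 0 x‖ - ‖u 1 x‖) ^ 2 := by positivity
        have h5 : x.1⁻¹ * (x.1 * Q * ‖u 0 x‖ - ‖u 1 x‖) ^ 2 = x.1 * Q ^ 2 * ‖u 0 x‖ ^ 2 +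
            x.1⁻¹ * ‖u 1 x‖ ^ 2 - 2 * (Q * (‖u 0 x‖ * ‖u 1 x‖)) := by
          field_simp
          ring
        linarith
      exact (mul_le_mul_of_nonneg_left h2 hQ0).trans h3
    rw [heq, integral_add (jN.const_mul _) (iN1.const_mul _), integral_const_mul,
      integral_const_mul] at h1
    linarith
  have hlimN : ∀ x ∈ D.ω, Tendsto (fun n => x.1 * ((x.1 ^ 2 + e n)⁻¹) ^ 2 * ‖u 0 x‖ ^ 2) atTop
      (𝓝 ((x.1 ^ 3)⁻¹ * ‖u 0 x‖ ^ 2)) := by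
    intro x hx
    have hx0 := (D.pos x hx).ne'
    have h1 : Tendsto (fun n => (x.1 ^ 2 + e n)⁻¹) atTop (𝓝 ((x.1 ^ 2 + 0)⁻¹)) :=
      (het.const_add _).inv₀ (by simpa using hx0)
    have h2 := ((h1.pow 2).const_mul x.1).mul_const (‖u 0 x‖ ^ 2)
    rw [add_zero] at h2
    have h3 : x.1 * ((x.1 ^ 2)⁻¹) ^ 2 = (x.1 ^ 3)⁻¹ := by field_simp
    rwa [h3] at h2
  -- Fatou's lemma, with the bound `hbound`
  have iN3 : IntegrableOn (fun x => (x.1 ^ 3)⁻¹ * ‖u 0 x‖ ^ 2) D.ω := by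
    have hm : AEStronglyMeasurable (fun x => (x.1 ^ 3)⁻¹ * ‖u 0 x‖ ^ 2) (volume.restrict D.ω) :=
      ((measurable_fst.pow_const 3).inv.aestronglyMeasurable).mul
        ((aestronglyMeasurable_of_memLp (hu 0)).norm.pow 2)
    refine ⟨hm, ?_⟩
    rw [hasFiniteIntegral_iff_enorm]
    have h1 : ∫⁻ x in D.ω, ‖(x.1 ^ 3)⁻¹ * ‖u 0 x‖ ^ 2‖ₑ = ∫⁻ x in D.ω, liminf (fun n =>
        ‖x.1 * ((x.1 ^ 2 + e n)⁻¹) ^ 2 * ‖u 0 x‖ ^ 2‖ₑ) atTop := by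
      refine lintegral_congr_ae ?_
      filter_upwards [ae_restrict_mem D.measurableSet] with x hx
      exact ((hlimN x hx).enorm.liminf_eq).symm
    rw [h1]
    refine (lintegral_liminf_le' fun n => (hreg n).2.1.1.enorm).trans_lt ?_
    refine lt_of_le_of_lt (b := ENNReal.ofReal (∫ x in D.ω, x.1⁻¹ * ‖u 1 x‖ ^ 2)) ?_
      ENNReal.ofReal_lt_top
    refine liminf_le_of_frequently_le' (Frequently.of_forall fun n => ?_)
    have h2 : ∫⁻ x in D.ω, ‖x.1 * ((x.1 ^ 2 + e n)⁻¹) ^ 2 * ‖u 0 x‖ ^ 2‖ₑ =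
        ENNReal.ofReal (∫ x in D.ω, x.1 * ((x.1 ^ 2 + e n)⁻¹) ^ 2 * ‖u 0 x‖ ^ 2) := by
      rw [ofReal_integral_eq_lintegral_ofReal (hreg n).2.1]
      · refine lintegral_congr_ae ?_
        filter_upwards [ae_restrict_mem D.measurableSet] with x hx
        have := D.pos x hx
        exact Real.enorm_of_nonneg (by positivity)
      · filter_upwards [ae_restrict_mem D.measurableSet] with x hx
        have := D.pos x hx
        positivity
    rw [h2]
    exact ENNReal.ofReal_le_ofReal (hbound n)
  refine ⟨iN3, ?_⟩
  have hb : IntegrableOn (fun x => (x.1 ^ 3)⁻¹ * ‖u 0 x‖ ^ 2 + x.1⁻¹ * ‖u 1 x‖ ^ 2) D.ω :=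
    iN3.add iN1
  have l1 : Tendsto (fun n => ∫ x in D.ω, x.1 * ((x.1 ^ 2 + e n)⁻¹) ^ 2 * ‖u 0 x‖ ^ 2) atTop
      (𝓝 (∫ x in D.ω, (x.1 ^ 3)⁻¹ * ‖u 0 x‖ ^ 2)) := by
    refine tendsto_integral_of_dominated_convergence _ (fun n => (hreg n).2.1.1) iN3
      (fun n => ?_) ?_
    · filter_upwards [ae_restrict_mem D.measurableSet] with x hx
      have hx0 := D.pos x hx
      have h1 : (x.1 ^ 2 + e n)⁻¹ ≤ (x.1 ^ 2)⁻¹ :=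
        inv_anti₀ (by positivity) (by linarith [he0 n])
      have h2 : 0 ≤ (x.1 ^ 2 + e n)⁻¹ := by have := he0 n; positivity
      rw [Real.norm_of_nonneg (by positivity)]
      refine mul_le_mul_of_nonneg_right ?_ (sq_nonneg _)
      calc x.1 * ((x.1 ^ 2 + e n)⁻¹) ^ 2 ≤ x.1 * ((x.1 ^ 2)⁻¹) ^ 2 := by gcongr
        _ = (x.1 ^ 3)⁻¹ := by field_simp
    · filter_upwards [ae_restrict_mem D.measurableSet] with x hx
      exact hlimN x hx
  have l2 : Tendsto (fun n => ∫ x in D.ω, (x.1 ^ 2 + e n)⁻¹ * (starRingEnd ℂ (u 0 x) * u 1 x).re)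
      atTop (𝓝 (∫ x in D.ω, (x.1 ^ 2)⁻¹ * (starRingEnd ℂ (u 0 x) * u 1 x).re)) := by
    refine tendsto_integral_of_dominated_convergence
      (fun x => (x.1 ^ 3)⁻¹ * ‖u 0 x‖ ^ 2 + x.1⁻¹ * ‖u 1 x‖ ^ 2)
      (fun n => (hreg n).1.1) hb (fun n => ?_) ?_
    · filter_upwards [ae_restrict_mem D.measurableSet] with x hx
      have hx0 := D.pos x hx
      have h1 : (x.1 ^ 2 + e n)⁻¹ ≤ (x.1 ^ 2)⁻¹ :=
        inv_anti₀ (by positivity) (by linarith [he0 n])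
      have h2 : 0 ≤ (x.1 ^ 2 + e n)⁻¹ := by have := he0 n; positivity
      rw [norm_mul, Real.norm_of_nonneg h2, Real.norm_eq_abs]
      refine (mul_le_mul h1 (hre x) (abs_nonneg _) (by positivity)).trans ?_
      have h3 : (x.1 ^ 3)⁻¹ * ‖u 0 x‖ ^ 2 + x.1⁻¹ * ‖u 1 x‖ ^ 2 -
          (x.1 ^ 2)⁻¹ * (‖u 0 x‖ * ‖u 1 x‖) = x.1⁻¹ * ((x.1⁻¹ * ‖u 0 x‖ - ‖u 1 x‖) ^ 2 +
            x.1⁻¹ * ‖u 0 x‖ * ‖u 1 x‖) := by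
        field_simp
        ring
      have h4 : 0 ≤ x.1⁻¹ * ((x.1⁻¹ * ‖u 0 x‖ - ‖u 1 x‖) ^ 2 +
            x.1⁻¹ * ‖u 0 x‖ * ‖u 1 x‖) := by positivity
      linarith
    · filter_upwards [ae_restrict_mem D.measurableSet] with x hx
      have hx0 := (D.pos x hx).ne'
      have h1 : Tendsto (fun n => (x.1 ^ 2 + e n)⁻¹) atTop (𝓝 ((x.1 ^ 2 + 0)⁻¹)) :=
        (het.const_add _).inv₀ (by simpa using hx0)
      rw [add_zero] at h1
      exact h1.mul_const _
  refine tendsto_nhds_unique l2 ?_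
  simp only [fun n => (hreg n).2.2]
  exact l1

theorem integrableOn_weight_conj_mul {D : Polygon} {a b : ℝ × ℝ → ℂ} {c A B : ℝ × ℝ → ℝ}
    (hc : Measurable c) (ha : AEStronglyMeasurable a (volume.restrict D.ω))
    (hb : AEStronglyMeasurable b (volume.restrict D.ω))
    (hA : IntegrableOn (fun x => A x * ‖a x‖ ^ 2) D.ω)
    (hB : IntegrableOn (fun x => B x * ‖b x‖ ^ 2) D.ω)
    (h : ∀ x ∈ D.ω, 0 ≤ A x ∧ 0 ≤ B x ∧ c x ^ 2 ≤ A x * B x) :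
    IntegrableOn (fun x => (c x : ℂ) * (starRingEnd ℂ (a x) * b x)) D.ω := by
  have hAB : IntegrableOn (fun x => A x * ‖a x‖ ^ 2 + B x * ‖b x‖ ^ 2) D.ω := hA.add hB
  refine hAB.mono' ?_ ?_
  · exact (Complex.measurable_ofReal.comp hc).aestronglyMeasurable.mul
      ((Complex.continuous_conj.comp_aestronglyMeasurable ha).mul hb)
  · filter_upwards [ae_restrict_mem D.measurableSet] with x hx
    obtain ⟨h1, h2, h3⟩ := h x hx
    rw [norm_mul, norm_mul, RCLike.norm_conj, Complex.norm_real, Real.norm_eq_abs]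
    have h4 : 0 ≤ A x * ‖a x‖ ^ 2 := by positivity
    have h5 : 0 ≤ B x * ‖b x‖ ^ 2 := by positivity
    refine abs_le_of_sq_le_sq' ?_ (add_nonneg h4 h5) |>.2
    have h6 : (|c x| * (‖a x‖ * ‖b x‖)) ^ 2 = c x ^ 2 * (‖a x‖ ^ 2 * ‖b x‖ ^ 2) := by
      rw [mul_pow, mul_pow, sq_abs]
    have h7 := mul_le_mul_of_nonneg_right h3 (by positivity : 0 ≤ ‖a x‖ ^ 2 * ‖b x‖ ^ 2)
    rw [h6]
    nlinarith [mul_nonneg h4 h5, sq_nonneg (A x * ‖a x‖ ^ 2), sq_nonneg (B x * ‖b x‖ ^ 2)]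

/-- The weighted energy identity: the equation `Δ₀ w = f` is conjugated and tested with `w / r²`,
cut off near the axis.  The derivative of `1 / r²` gives a term that is evaluated by Hardy's
equality. -/
theorem integral_weighted_energy {D : Polygon} {w : H1 D} {f : Lp ℂ 2 (wt D.ω 1)}
    (hneg : MemH1Neg w) (hlap : IsLaplacian w f) (h : IsGradIn D (offVerts D) (funs w.1)) :
    IntegrableOn (fun x => (x.1⁻¹ : ℝ) * (starRingEnd ℂ (f x) * w.1 0 x)) D.ω ∧
    (∫ x in D.ω, ((x.1⁻¹ : ℝ) : ℂ) * (starRingEnd ℂ (f x) * w.1 0 x)).re +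
      ∫ x in D.ω, x.1⁻¹ * (‖w.1 1 x‖ ^ 2 + ‖w.1 2 x‖ ^ 2) =
        2 * ∫ x in D.ω, (x.1 ^ 3)⁻¹ * ‖w.1 0 x‖ ^ 2 := by
  have hu := memL2_funs w.1
  obtain ⟨iN3, hardy_eq⟩ := hardy hu hneg h
  have hm : ∀ i, AEStronglyMeasurable (w.1 i) (volume.restrict D.ω) :=
    fun i => aestronglyMeasurable_of_memLp (hneg i)
  have iN := fun i => integrableOn_sq_div (hneg i)
  have if1 : IntegrableOn (fun x => x.1 * ‖f x‖ ^ 2) D.ω := by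
    have := ((memLp_two_wt_iff D 1).mp (Lp.memLp f)).2
    simpa only [Real.rpow_one] using this
  have iF : IntegrableOn (fun x => ((x.1⁻¹ : ℝ) : ℂ) * (starRingEnd ℂ (f x) * w.1 0 x)) D.ω := by
    refine integrableOn_weight_conj_mul (A := fun x => x.1) (B := fun x => (x.1 ^ 3)⁻¹)
      measurable_fst.inv (aestronglyMeasurable_of_memLp (Lp.memLp f)) (hm 0) if1 iN3
      fun x hx => ?_
    have hx0 := D.pos x hx
    refine ⟨hx0.le, by positivity, le_of_eq ?_⟩
    field_simp
  have iG : IntegrableOn (fun x => x.1⁻¹ * (‖w.1 1 x‖ ^ 2 + ‖w.1 2 x‖ ^ 2)) D.ω := by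
    simp only [mul_add]
    exact (iN 1).add (iN 2)
  have iK : IntegrableOn (fun x => (((x.1 ^ 2)⁻¹ : ℝ) : ℂ) *
      (starRingEnd ℂ (w.1 1 x) * w.1 0 x)) D.ω := by
    refine integrableOn_weight_conj_mul (A := fun x => x.1⁻¹) (B := fun x => (x.1 ^ 3)⁻¹)
      (measurable_fst.pow_const 2).inv (hm 1) (hm 0) (iN 1) iN3 fun x hx => ?_
    have hx0 := D.pos x hx
    refine ⟨by positivity, by positivity, le_of_eq ?_⟩
    field_simp
  refine ⟨iF, ?_⟩
  have iG' : IntegrableOn (fun x => ((x.1⁻¹ * (‖w.1 1 x‖ ^ 2 + ‖w.1 2 x‖ ^ 2) : ℝ) : ℂ)) D.ω :=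
    iG.ofReal
  have iFG : IntegrableOn (fun x => ((x.1⁻¹ : ℝ) : ℂ) * (starRingEnd ℂ (f x) * w.1 0 x) +
      ((x.1⁻¹ * (‖w.1 1 x‖ ^ 2 + ‖w.1 2 x‖ ^ 2) : ℝ) : ℂ)) D.ω := iF.add iG'
  have iFGK : IntegrableOn (fun x => ((x.1⁻¹ : ℝ) : ℂ) * (starRingEnd ℂ (f x) * w.1 0 x) +
      ((x.1⁻¹ * (‖w.1 1 x‖ ^ 2 + ‖w.1 2 x‖ ^ 2) : ℝ) : ℂ) -
      2 * ((((x.1 ^ 2)⁻¹ : ℝ) : ℂ) * (starRingEnd ℂ (w.1 1 x) * w.1 0 x))) D.ω :=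
    iFG.sub (iK.const_mul 2)
  obtain ⟨η, hηs, hη0, hlim⟩ := exists_axis_cutoff_limit D
  have hzero := hlim ℂ _
    (fun x => ((x.1⁻¹ : ℝ) : ℂ) * (starRingEnd ℂ (w.1 1 x) * w.1 0 x)) iFGK ?_ fun n => ?_
  · rw [integral_sub iFG (iK.const_mul 2), integral_add iF iG', integral_const_mul,
      integral_complex_ofReal] at hzero
    have hK : (∫ x in D.ω, (((x.1 ^ 2)⁻¹ : ℝ) : ℂ) * (starRingEnd ℂ (w.1 1 x) * w.1 0 x)).re =
        ∫ x in D.ω, (x.1 ^ 3)⁻¹ * ‖w.1 0 x‖ ^ 2 := by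
      change RCLike.re (∫ x in D.ω, (((x.1 ^ 2)⁻¹ : ℝ) : ℂ) *
        (starRingEnd ℂ (w.1 1 x) * w.1 0 x)) = _
      rw [← integral_re iK]
      refine Eq.trans ?_ hardy_eq
      refine integral_congr_ae (Eventually.of_forall fun x => ?_)
      change ((((x.1 ^ 2)⁻¹ : ℝ) : ℂ) * (starRingEnd ℂ (w.1 1 x) * w.1 0 x)).re =
        (x.1 ^ 2)⁻¹ * (starRingEnd ℂ (w.1 0 x) * w.1 1 x).re
      rw [Complex.re_ofReal_mul]
      simp only [Complex.mul_re, Complex.conj_re, Complex.conj_im]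
      ring
    have hre := congrArg Complex.re hzero
    rw [Complex.sub_re, Complex.add_re, Complex.ofReal_re, Complex.zero_re] at hre
    have h2 : (2 * ∫ x in D.ω, (((x.1 ^ 2)⁻¹ : ℝ) : ℂ) *
        (starRingEnd ℂ (w.1 1 x) * w.1 0 x)).re = 2 * ∫ x in D.ω, (x.1 ^ 3)⁻¹ * ‖w.1 0 x‖ ^ 2 := by
      rw [← hK, ← Complex.re_ofReal_mul]
      norm_num
    linarith
  · refine iK.congr_fun (fun x hx => ?_) D.measurableSet
    have hx0 : (x.1 : ℂ) ≠ 0 := by exact_mod_cast (D.pos x hx).ne'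
    simp only [Complex.real_smul]
    push_cast
    field_simp
  · have hn : (0 : ℝ) < 1 / ((n : ℝ) + 1) := by positivity
    -- the multiplier `ζ = η_n / r²` is smooth since `η_n` vanishes near `0`
    set q : ℝ → ℝ := fun r => (r ^ 2)⁻¹ with hq
    have hqs : ∀ r, r ≠ 0 → ContDiffAt ℝ (⊤ : ℕ∞) q r := fun r hr =>
      (contDiffAt_id.pow 2).inv (pow_ne_zero 2 hr)
    have hqd : ∀ r, r ≠ 0 → HasDerivAt q (-(2 * (r ^ 3)⁻¹)) r := by
      intro r hr
      have h1 : HasDerivAt (fun r : ℝ => r ^ 2) (2 * r) r := by simpa using hasDerivAt_pow 2 r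
      refine (h1.fun_inv (pow_ne_zero 2 hr)).congr_deriv ?_
      field_simp
    have h1 := integral_mul_field_eq_zero (gradField w f hlap) hu h
      (contDiff_mul_of_eq_zero_near hn (hηs n) (hη0 n) hqs)
    rw [← h1]
    refine setIntegral_congr_fun D.measurableSet fun x hx => ?_
    have hx0 : (x.1 : ℂ) ≠ 0 := by exact_mod_cast (D.pos x hx).ne'
    have h2 : deriv (fun r => η n r * q r) x.1 =
        deriv (η n) x.1 * (x.1 ^ 2)⁻¹ + η n x.1 * (-(2 * (x.1 ^ 3)⁻¹)) :=
      (((hηs n).differentiable (by simp) x.1).hasDerivAt.mul (hqd _ (D.pos x hx).ne')).deriv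
    have h3 : ∀ z : ℂ, ((‖z‖ ^ 2 : ℝ) : ℂ) = starRingEnd ℂ z * z := fun z => by
      rw [← Complex.normSq_eq_norm_sq, Complex.normSq_eq_conj_mul_self]
    have h4 : ((x.1⁻¹ * (‖w.1 1 x‖ ^ 2 + ‖w.1 2 x‖ ^ 2) : ℝ) : ℂ) = ((x.1⁻¹ : ℝ) : ℂ) *
        (starRingEnd ℂ (w.1 1 x) * w.1 1 x + starRingEnd ℂ (w.1 2 x) * w.1 2 x) := by
      rw [← h3, ← h3]; push_cast; ring
    beta_reduce
    rw [h2, h4]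
    change _ = (x.1 : ℂ) * (((η n x.1 * (x.1 ^ 2)⁻¹ : ℝ) : ℂ) * (starRingEnd ℂ (f x) * w.1 0 x +
      starRingEnd ℂ (w.1 1 x) * w.1 1 x + starRingEnd ℂ (w.1 2 x) * w.1 2 x) +
      ((deriv (η n) x.1 * (x.1 ^ 2)⁻¹ + η n x.1 * (-(2 * (x.1 ^ 3)⁻¹)) : ℝ) : ℂ) *
        (starRingEnd ℂ (w.1 1 x) * w.1 0 x))
    simp only [Complex.real_smul]
    push_cast
    field_simp
    ring

theorem memLp_neg_three {D : Polygon} {w : H1 D} (hneg : MemH1Neg w)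
    (h : IsGradIn D (offVerts D) (funs w.1)) : MemLp (w.1 0) 2 (wt D.ω (-3)) := by
  refine (memLp_two_wt_iff D (-3)).mpr ⟨aestronglyMeasurable_of_memLp (hneg 0), ?_⟩
  refine (hardy (memL2_funs w.1) hneg h).1.congr_fun (fun x hx => ?_) D.measurableSet
  have hx0 := D.pos x hx
  change (x.1 ^ 3)⁻¹ * ‖w.1 0 x‖ ^ 2 = x.1 ^ (-3 : ℝ) * ‖w.1 0 x‖ ^ 2
  rw [Real.rpow_neg hx0.le]
  norm_cast

/-- The energy identity in terms of the measures `wt`. -/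
theorem weighted_identity {D : Polygon} {w : H1 D} {f : Lp ℂ 2 (wt D.ω 1)}
    (hneg : MemH1Neg w) (hlap : IsLaplacian w f) (h : IsGradIn D (offVerts D) (funs w.1)) :
    Integrable (fun x => -(starRingEnd ℂ (w.1 0 x) / (x.1 : ℂ) ^ 2 * f x)) (wt D.ω 1) ∧
    (∫ x, -(starRingEnd ℂ (w.1 0 x) / (x.1 : ℂ) ^ 2 * f x) ∂(wt D.ω 1)).re =
      ∫ x, (‖w.1 1 x‖ ^ 2 + ‖w.1 2 x‖ ^ 2) ∂(wt D.ω (-1)) -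
        2 * ∫ x, ‖w.1 0 x‖ ^ 2 ∂(wt D.ω (-3)) := by
  obtain ⟨iF, hE⟩ := integral_weighted_energy hneg hlap h
  have hpt : ∀ x ∈ D.ω, -(starRingEnd ℂ (((x.1⁻¹ : ℝ) : ℂ) * (starRingEnd ℂ (f x) * w.1 0 x))) =
      x.1 • -(starRingEnd ℂ (w.1 0 x) / (x.1 : ℂ) ^ 2 * f x) := by
    intro x hx
    have hx0 : (x.1 : ℂ) ≠ 0 := by exact_mod_cast (D.pos x hx).ne'
    simp only [map_mul, Complex.conj_conj, Complex.conj_ofReal, Complex.real_smul]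
    push_cast
    field_simp
  constructor
  · rw [integrable_wt_one_iff]
    refine IntegrableOn.congr_fun ?_ hpt D.measurableSet
    exact (Complex.conjCLE.toContinuousLinearMap.integrable_comp iF).neg
  · rw [integral_wt_one, ← setIntegral_congr_fun D.measurableSet hpt, integral_neg, integral_conj,
      Complex.neg_re, Complex.conj_re, integral_wt, integral_wt]
    have e1 : ∫ x in D.ω, x.1 ^ (-1 : ℝ) • (‖w.1 1 x‖ ^ 2 + ‖w.1 2 x‖ ^ 2) =
        ∫ x in D.ω, x.1⁻¹ * (‖w.1 1 x‖ ^ 2 + ‖w.1 2 x‖ ^ 2) := by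
      simp only [Real.rpow_neg_one, smul_eq_mul]
    have e2 : ∫ x in D.ω, x.1 ^ (-3 : ℝ) • ‖w.1 0 x‖ ^ 2 =
        ∫ x in D.ω, (x.1 ^ 3)⁻¹ * ‖w.1 0 x‖ ^ 2 := by
      refine setIntegral_congr_fun D.measurableSet fun x hx => ?_
      have hx0 := D.pos x hx
      change x.1 ^ (-3 : ℝ) * ‖w.1 0 x‖ ^ 2 = (x.1 ^ 3)⁻¹ * ‖w.1 0 x‖ ^ 2
      rw [Real.rpow_neg hx0.le]
      norm_cast
    rw [e1, e2]
    linarith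

/-- Green's formula holds by the definition of `normalOp`, for the field `∇v` with divergence
`f`. -/
theorem green_formula {D : Polygon} (u v : H1 D) (f : Lp ℂ 2 (wt D.ω 1)) (h : IsLaplacian v f) :
    Integrable (fun x => u.1 0 x * f x + (u.1 1 x * v.1 1 x + u.1 2 x * v.1 2 x)) (wt D.ω 1) ∧
    ∫ x, (u.1 0 x * f x + (u.1 1 x * v.1 1 x + u.1 2 x * v.1 2 x)) ∂(wt D.ω 1) =
      normalOp D (gradField v f h) u := by
  have hi : ∀ g k : Lp ℂ 2 (wt D.ω 1), Integrable (fun x => g x * k x) (wt D.ω 1) :=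
    fun g k => (Lp.memLp g).integrable_mul (Lp.memLp k)
  refine ⟨(hi _ _).add ((hi _ _).add (hi _ _)), ?_⟩
  rw [normalOp_apply, pairing]
  refine integral_congr_ae (Eventually.of_forall fun x => ?_)
  simp only [Fin.sum_univ_three]
  change _ = f x * u.1 0 x + v.1 1 x * u.1 1 x + v.1 2 x * u.1 2 x
  ring

end Meridian

end

theorem mainTheorem12 (D : Meridian.Polygon) :
    (∃! T : Meridian.H1 D →L[ℂ] Lp ℂ 2 (Meridian.bdryMeasure D), Meridian.IsTraceOp D T) ∧
    ∀ T : Meridian.H1 D →L[ℂ] Lp ℂ 2 (Meridian.bdryMeasure D), Meridian.IsTraceOp D T →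
      (∃! N : Meridian.HDiv D →L[ℂ] Meridian.H1 D →L[ℂ] ℂ, Meridian.IsNormalTraceOp D T N) ∧
      (∀ N : Meridian.HDiv D →L[ℂ] Meridian.H1 D →L[ℂ] ℂ, Meridian.IsNormalTraceOp D T N →
        ∀ (u v : Meridian.H1 D) (f : Lp ℂ 2 (Meridian.wt D.ω 1)) (h : Meridian.IsLaplacian v f),
          Integrable (fun x => u.1 0 x * f x + (u.1 1 x * v.1 1 x + u.1 2 x * v.1 2 x))
            (Meridian.wt D.ω 1) ∧
          ∫ x, (u.1 0 x * f x + (u.1 1 x * v.1 1 x + u.1 2 x * v.1 2 x)) ∂(Meridian.wt D.ω 1) =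
            N (Meridian.gradField v f h) u) ∧
      (∀ (w : Meridian.H1 D) (f : Lp ℂ 2 (Meridian.wt D.ω 1)),
        Meridian.MemH1Neg w → T w = 0 → Meridian.IsLaplacian w f →
          MemLp (w.1 0) 2 (Meridian.wt D.ω (-3)) ∧
          Integrable (fun x => -(starRingEnd ℂ (w.1 0 x) / (x.1 : ℂ) ^ 2 * f x))
            (Meridian.wt D.ω 1) ∧
          (∫ x, -(starRingEnd ℂ (w.1 0 x) / (x.1 : ℂ) ^ 2 * f x) ∂(Meridian.wt D.ω 1)).re =
            ∫ x, (‖w.1 1 x‖ ^ 2 + ‖w.1 2 x‖ ^ 2) ∂(Meridian.wt D.ω (-1)) -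
              2 * ∫ x, ‖w.1 0 x‖ ^ 2 ∂(Meridian.wt D.ω (-3))) := by
  refine ⟨⟨Meridian.traceOp D, Meridian.isTraceOp_traceOp D,
    fun _ hT => hT.unique (Meridian.isTraceOp_traceOp D)⟩, fun T hT => ?_⟩
  have hN := Meridian.isNormalTraceOp_normalOp hT
  refine ⟨⟨Meridian.normalOp D, hN, fun _ hN' => hN'.unique hN⟩,
    fun N hN' u v f h => ?_, fun w f hneg hw hlap => ?_⟩
  · rw [hN'.unique hN]
    exact Meridian.green_formula u v f h
  · have hg := Meridian.isGradIn_offVerts_of_trace_eq_zero hT hw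
    exact ⟨Meridian.memLp_neg_three hneg hg, Meridian.weighted_identity hneg hlap hg⟩
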